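/- Let $I_1,I_2,I_3\subseteq\mathbb R$ be non-empty open intervals, let $(u,v,w)=(u_1,u_2,u_3)\in I_1\times I_2\times I_3$, and let $f=f_1(u)$, $\varphi=f_2(v)$, $\psi=f_3(w)$ be smooth nowhere vanishing functions on $I_1,I_2,I_3$ with antiderivatives $F_1,F_2,F_3$. Statements on the transformed system refer to the domain where $u,v,w$ are pairwise distinct. An operator $J$ is called Hamiltonian if it maps compactly supported smooth covector fields to compactly supported smooth vector fields and the bracket $\{a,b\}_u=\int a_iJ^{ij}b_j\,dx$ is skew-symmetric and satisfies the Jacobi identity, for smooth fields $u(x)$ that are constant near $\pm\infty$ and smooth compactly supported $a,b,c$; here $(d/dx)^{-1}\theta=\frac12\big(\int_{-\infty}^x\theta-\int_x^\infty\theta\big)$. Operators are compatible if all their linear combinations are Hamiltonian. (1) With $B=2w^2-u^2-v^2$, $A=v^2-u^2$, $N=u+v-2w$, $M=u-v$, the forms $B\,dx+A\,dt$ and $N\,dx+M\,dt$ are closed by virtue of the linear system $u_t=u_x$, $v_t=-v_x$, $w_t=0$, and the reciprocal transformation $d\tilde x=B\,dx+A\,dt$, $d\tilde t=N\,dx+M\,dt$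 maps it to $$u_{\tilde t}=(v+w)u_{\tilde x},\qquad v_{\tilde t}=(u+w)v_{\tilde x},\qquad w_{\tilde t}=(u+v)w_{\tilde x}.\qquad(*)$$ That is: near every point of every smooth solution of the linear system the new variables exist and form a change of coordinates; and whenever $(\tilde x,\tilde t)$ are new variables for a field, the field is smooth in them, and it satisfies $(*)$ in them if and only if it satisfies the linear system in $(x,t)$. (2) The metric $du^2/f+dv^2/\varphi+4\,dw^2/\psi$ is flat; its Dubrovin–Novikov operator $$\mathrm{diag}(f,\varphi,\tfrac14\psi)\frac{d}{dx}+\tfrac12\,\mathrm{diag}(f'u_x,\varphi'v_x,\tfrac14\psi'w_x)$$ is Hamiltonian, and the linear system is Hamiltonian with respect to it, with some density $h$ which has a flux $k$ (that is, $h\,dx+k\,dt$ is closed by virtue of the linear system). (3) The densities $N$ and $B$ generate, with this operator, the flows $$u_\tau=\tfrac12f'u_x,\ v_\tau=\tfrac12\varphi'v_x,\ w_\tau=-\tfrac14\psi'w_x,\qquad u_\zeta=-(2f+uf')u_x,\ v_\zeta=-(2\varphi+v\varphi')v_x,\ w_\zeta=(\psi+\tfrac12w\psi')w_x,$$ which commute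 with the linear system. Put $$Q=2(u^2f+v^2\varphi+w^2\psi),\quad R=\tfrac12(f+\varphi+\psi),\quad P=-uf-v\varphi-w\psi+F_1(u)+F_2(v)+F_3(w),\quad S=-uf-v\varphi-w\psi-F_1(u)-F_2(v)-F_3(w).$$ Then $Q=\frac12(\nabla B)^2$, $R=\frac12(\nabla N)^2$, $P+S=(\nabla B,\nabla N)$, and the forms $d\tilde x=B\,dx+A\,dt+P\,d\tau+Q\,d\zeta$, $d\tilde t=N\,dx+M\,dt+R\,d\tau+S\,d\zeta$ are closed by virtue of the three systems. This extended transformation maps, in the sense of (1), the three systems to $(*)$, $u^i_\tau=\mu^iu^i_{\tilde x}$ and $u^i_\zeta=\lambda^iu^i_{\tilde x}$, where, for $\{i,j,k\}=\{1,2,3\}$, $$\eta^i=u_j+u_k,\quad \mu^i=-\tfrac12(u_i-u_j)(u_i-u_k)f_i'(u_i)-\eta^iR-P,\quad \lambda^i=(u_i-u_j)(u_i-u_k)\big(2f_i(u_i)+u_if_i'(u_i)\big)-\eta^iS-Q;$$ the last two flows commute with $(*)$. (4) We have $BM-AN\ne0$. The transformed metric, whose covariant components are $\tilde g_{ij}=\dfrac{(M-N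 c_i)(M-N c_j)}{(BM-AN)^2}\,g_{ij}$, with $g$ the metric of (2) and $(c_1,c_2,c_3)=(1,-1,0)$, is $$d\tilde s^2=\sum_i\frac{du_i^2}{(u_i-u_j)^2(u_i-u_k)^2f_i(u_i)},$$ with curvature tensor $\tilde R^{ij}_{kl}=(\lambda^i+\lambda^j+\mu^i\eta^j+\mu^j\eta^i)(\delta^i_k\delta^j_l-\delta^i_l\delta^j_k)$ (no summation). (5) With $\tilde g^{ii}=(u_i-u_j)^2(u_i-u_k)^2f_i(u_i)$ and $x$ written for $\tilde x$, the operator $\tilde J$ with local part $$\tilde g^{ii}\delta^{ij}\frac d{dx}+b^{ij},\qquad b^{ii}=\tilde g^{ii}\Big[\frac{f_i'(u_i)}{2f_i(u_i)}u^i_x+\sum_{j\ne i}\frac{u^i_x-u^j_x}{u_i-u_j}\Big],\qquad b^{ij}=\frac{\tilde g^{jj}u^i_x+\tilde g^{ii}u^j_x}{u_i-u_j}\ (i\ne j),$$ and with the four-term tail $$\lambda^iu^i_x\Big(\frac d{dx}\Big)^{-1}u^j_x+\mu^iu^i_x\Big(\frac d{dx}\Big)^{-1}\eta^ju^j_x+\eta^iu^i_x\Big(\frac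 d{dx}\Big)^{-1}\mu^ju^j_x+u^i_x\Big(\frac d{dx}\Big)^{-1}\lambda^ju^j_x$$ is Hamiltonian, and its local part is $\tilde g^{ij}\frac d{dx}-\tilde g^{is}\tilde\Gamma^j_{sk}u^k_x$ with the Levi-Civita connection of $d\tilde s^2$. If $h$ is a density with which the linear system is Hamiltonian in (2), with flux $k$, then $(*)$ is Hamiltonian with respect to $\tilde J$ with the transformed density $\tilde h=(hM-kN)/(BM-AN)$; here $(d/dx)^{-1}$ of $w^j u^j_x\,\partial\tilde h/\partial u^j$ ($w\in\{1,\eta,\mu,\lambda\}$) is understood as a suitable function $q_w(u)$ with $\partial q_w/\partial u^j=w^j\,\partial\tilde h/\partial u^j$. (6) All these operators $\tilde J$ (for all $f,\varphi,\psi$ on the given intervals) are pairwise compatible and depend linearly on $(f,\varphi,\psi)$. Two of them coincide if and only if the functions $f,\varphi,\psi$ are the same; in particular there are infinitely many, and the choice of antiderivatives does not matter. (7) If $f=\alpha$, $\varphi=\beta$, $\psi=\gamma$ are non-zero constants with $\alpha+\beta+\gamma=0$, then (with the antiderivatives $\alpha u,\beta v,\gamma w$) $\lambda^i=\mu^i=0$,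 the metric $d\tilde s^2$ is flat, and $\tilde J$ is its local Dubrovin–Novikov operator. For non-zero constants with $\alpha+\beta+\gamma\neq0$ the metric is not flat. -/

import Mathlib

open scoped ContDiff

namespace HydroType

noncomputable section

/-- Field values `(u, v, w)`, indexed by `0, 1, 2`. -/
abbrev State : Type := Fin 3 → ℝ

/-- Partial derivative with respect to the `k`-th coordinate. -/
def pd {m : ℕ} (k : Fin m) (g : (Fin m → ℝ) → ℝ) (y : Fin m → ℝ) : ℝ :=
  fderiv ℝ g y (Pi.single k 1)

/-! ### Riemannian geometry in coordinates (any signature) -/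

/-- Christoffel symbols `Γ^i_{sk}` of the Levi-Civita connection of the covariant metric `g`. -/
def christoffel (g : State → Matrix (Fin 3) (Fin 3) ℝ) (i s k : Fin 3) (p : State) : ℝ :=
  (1 / 2) * ∑ m, (g p)⁻¹ i m *
    (pd s (fun q => g q m k) p + pd k (fun q => g q m s) p - pd m (fun q => g q s k) p)

/-- The curvature tensor `R^i_{jkl}`. -/
def riemann (g : State → Matrix (Fin 3) (Fin 3) ℝ) (i j k l : Fin 3) (p : State) : ℝ :=
  pd k (christoffel g i l j) p - pd l (christoffel g i k j) p
    + ∑ m, (christoffel g i k m p * christoffel g m l j p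
      - christoffel g i l m p * christoffel g m k j p)

/-- The curvature tensor with a raised index, `R^{ij}_{kl} = g^{jm} R^i_{mkl}`; a metric of constant
curvature `c` has `R^{ij}_{kl} = c (δ^i_k δ^j_l - δ^i_l δ^j_k)`. -/
def curvature (g : State → Matrix (Fin 3) (Fin 3) ℝ) (i j k l : Fin 3) (p : State) : ℝ :=
  ∑ m, (g p)⁻¹ j m * riemann g i m k l p

/-- The metric `g` is flat on `Ω`. -/
def FlatOn (Ω : Set State) (g : State → Matrix (Fin 3) (Fin 3) ℝ) : Prop :=
  ∀ p ∈ Ω, ∀ i j k l, curvature g i j k l p = 0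

/-! ### Operators, Hamiltonian operators -/

/-- A matrix (pseudo)differential operator depending on the fields: `J u c` is the value of the
operator `J`, taken at the fields `u(x)`, on the covector field `c(x)`. -/
abbrev Op : Type := (ℝ → State) → (ℝ → State) → ℝ → State

/-- Smooth fields `u(x)` with values in `Ω`. -/
def SmoothFields (Ω : Set State) : Set (ℝ → State) :=
  {u | ContDiff ℝ ∞ u ∧ ∀ x, u x ∈ Ω}

/-- Smooth fields with values in `Ω` which are constant near `-∞` and near `+∞`. -/
def Fields (Ω : Set State) : Set (ℝ → State) :=
  {u | u ∈ SmoothFields Ω ∧ HasCompactSupport (deriv u)}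

/-- Smooth compactly supported test (co)vector fields. -/
def Test : Set (ℝ → State) := {a | ContDiff ℝ ∞ a ∧ HasCompactSupport a}

/-- `u^i_x`. -/
def dx (u : ℝ → State) (i : Fin 3) (x : ℝ) : ℝ := deriv (fun y => u y i) x

/-- The skew-symmetric inverse of `d/dx`,
`(d/dx)⁻¹ θ = ½ (∫_{-∞}^x θ - ∫_x^{∞} θ)`. -/
def dinv (θ : ℝ → ℝ) (x : ℝ) : ℝ :=
  (1 / 2) * ((∫ y in Set.Iic x, θ y) - ∫ y in Set.Ioi x, θ y)

/-- The bracket `{a, b}_u = ∫ a_i J^{ij} b_j dx`; it is the Poisson bracket, at the fields `u`, of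
functionals whose variational derivatives at `u` are `a` and `b`. -/
def bracket (J : Op) (u a b : ℝ → State) : ℝ := ∫ x, ∑ i, a x i * J u b x i

/-- `J` is a Hamiltonian operator on the fields with values in `Ω`: it maps test covectors to test
vectors, the bracket is skew-symmetric, and it satisfies the Jacobi identity. The term
`{{a, b}, c}` is the derivative of `u ↦ {a, b}_u` along `J c`. -/
def IsHamiltonian (Ω : Set State) (J : Op) : Prop :=
  ∀ u ∈ Fields Ω,
    (∀ b ∈ Test, J u b ∈ Test) ∧
    (∀ a ∈ Test, ∀ b ∈ Test, bracket J u a b = -bracket J u b a) ∧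
    (∀ a ∈ Test, ∀ b ∈ Test, ∀ c ∈ Test, ∃ d₁ d₂ d₃ : ℝ,
      HasDerivAt (fun ε : ℝ => bracket J (u + ε • J u c) a b) d₁ 0 ∧
      HasDerivAt (fun ε : ℝ => bracket J (u + ε • J u a) b c) d₂ 0 ∧
      HasDerivAt (fun ε : ℝ => bracket J (u + ε • J u b) c a) d₃ 0 ∧
      d₁ + d₂ + d₃ = 0)

/-- Compatibility: every linear combination of the two operators is Hamiltonian. -/
def Compatible (Ω : Set State) (J₁ J₂ : Op) : Prop :=
  ∀ c₁ c₂ : ℝ, IsHamiltonian Ω (fun u c x => c₁ • J₁ u c x + c₂ • J₂ u c x)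

/-- The local operator of Dubrovin-Novikov type
`g^{ij} d/dx - g^{is} Γ^j_{sk} u^k_x` of the covariant metric `g`. -/
def dnOp (g : State → Matrix (Fin 3) (Fin 3) ℝ) : Op := fun u c x i =>
  ∑ j, ((g (u x))⁻¹ i j * deriv (fun y => c y j) x
    - ∑ s, ∑ k, (g (u x))⁻¹ i s * christoffel g j s k (u x) * dx u k x * c x j)

/-- The tail `∑_α L_α u_x (d/dx)⁻¹ R_α u_x` with diagonal affinors `L_α`, `R_α`. -/
def tailOp {A : Type} [Fintype A] (L R : A → State → State) : Op := fun u c x i =>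
  ∑ α, L α (u x) i * dx u i x * dinv (fun y => ∑ j, R α (u y) j * dx u j y * c y j) x

/-- The gradient `∂h/∂u^i`. -/
def grad (h : State → ℝ) (p : State) : State := fun i => pd i h p

/-- The system `u^i_t = v^i(u) u^i_x` is `u_t = J ∂h/∂u` for the local operator `J`. -/
def IsLocalHamiltonianFlow (Ω : Set State) (J : Op) (h : State → ℝ) (v : State → State) : Prop :=
  ∀ u ∈ SmoothFields Ω, ∀ x i, J u (fun y => grad h (u y)) x i = v (u x) i * dx u i x

/-- The system `u^i_t = v^i(u) u^i_x` is `u_t = J ∂h/∂u` for the nonlocal operator `J` with local part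
`Jloc` and tail `∑_α L_α u_x (d/dx)⁻¹ R_α u_x`: every `R_α^j u^j_x ∂h/∂u^j` is a total derivative
`(q_α(u))_x`, and the value of `(d/dx)⁻¹` on it is `q_α(u)`. -/
def IsNonlocalHamiltonianFlow {A : Type} [Fintype A] (Ω : Set State) (Jloc : Op)
    (L R : A → State → State) (h : State → ℝ) (v : State → State) : Prop :=
  ∃ q : A → State → ℝ,
    (∀ α, ContDiffOn ℝ ∞ (q α) Ω) ∧
    (∀ α, ∀ p ∈ Ω, ∀ j, pd j (q α) p = R α p j * pd j h p) ∧
    ∀ u ∈ SmoothFields Ω, ∀ x i,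
      Jloc u (fun y => grad h (u y)) x i + ∑ α, L α (u x) i * dx u i x * q α (u x)
        = v (u x) i * dx u i x

/-- The right hand side `v^i(u) u^i_x` of a diagonal system. -/
def flow (v : State → State) (u : ℝ → State) (x : ℝ) : State := fun i => v (u x) i * dx u i x

/-- The flows `u^i_t = v^i u^i_x` and `u^i_s = z^i u^i_x` commute: `(u_t)_s = (u_s)_t`. -/
def FlowsCommute (Ω : Set State) (v z : State → State) : Prop :=
  ∀ u ∈ SmoothFields Ω, ∀ x i, ∃ d : ℝ,
    HasDerivAt (fun ε : ℝ => flow v (u + ε • flow z u) x i) d 0 ∧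
    HasDerivAt (fun ε : ℝ => flow z (u + ε • flow v u) x i) d 0

/-! ### Multi-time systems and reciprocal transformations -/

/-- On `D`, the field `u(y)`, `y = (y⁰, y¹, …, y^m)`, satisfies
`∂u^i/∂y^{k+1} = V_k^i(u) ∂u^i/∂y⁰` for all `k`, `i`. -/
def Solves {m : ℕ} (V : Fin m → State → State) (D : Set (Fin (m + 1) → ℝ))
    (u : (Fin (m + 1) → ℝ) → State) : Prop :=
  ∀ y ∈ D, ∀ k i, pd k.succ (fun z => u z i) y = V k (u y) i * pd 0 (fun z => u z i) y

/-- The one-form `∑ θ_k(u) dy^k` is closed by virtue of the equations. -/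
def ClosedByVirtue {m : ℕ} (Ω : Set State) (V : Fin m → State → State)
    (θ : Fin (m + 1) → State → ℝ) : Prop :=
  ∀ (D : Set (Fin (m + 1) → ℝ)) (u : (Fin (m + 1) → ℝ) → State), IsOpen D →
    ContDiffOn ℝ ∞ u D → Set.MapsTo u D Ω → Solves V D u →
    ∀ y ∈ D, ∀ j k, pd j (fun z => θ k (u z)) y = pd k (fun z => θ j (u z)) y

/-- `X` is the change of independent variables
`dX⁰ = ∑ θ_k(u) dy^k`, `dX¹ = ∑ σ_k(u) dy^k`, `X^k = y^k` for `k ≥ 2`, on `D`. -/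
def IsReciprocal {m : ℕ} (θ σ : Fin (m + 2) → State → ℝ) (D : Set (Fin (m + 2) → ℝ))
    (u : (Fin (m + 2) → ℝ) → State) (X : (Fin (m + 2) → ℝ) → (Fin (m + 2) → ℝ)) : Prop :=
  DifferentiableOn ℝ X D ∧ ∀ y ∈ D,
    (∀ k, pd k (fun z => X z 0) y = θ k (u y)) ∧
    (∀ k, pd k (fun z => X z 1) y = σ k (u y)) ∧
    ∀ l : Fin m, X y l.succ.succ = y l.succ.succ

/-- The reciprocal transformation with the forms `θ`, `σ` maps the system with speeds `V` to the
system with speeds `V'`: near every point of every solution of the first system the new variables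
exist and are a change of coordinates; and whenever `X` are new variables for `u`, the field `u'`
given by `u' ∘ X = u` is smooth, and it satisfies the second system exactly when `u` satisfies
the first. -/
def MapsSystem {m : ℕ} (Ω : Set State) (θ σ : Fin (m + 2) → State → ℝ)
    (V V' : Fin (m + 1) → State → State) : Prop :=
  ∀ (D : Set (Fin (m + 2) → ℝ)) (u : (Fin (m + 2) → ℝ) → State), IsOpen D →
    ContDiffOn ℝ ∞ u D → Set.MapsTo u D Ω →
    (Solves V D u → ∀ y ∈ D, ∃ D' ⊆ D, IsOpen D' ∧ y ∈ D' ∧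
      ∃ (X : (Fin (m + 2) → ℝ) → (Fin (m + 2) → ℝ)) (u' : (Fin (m + 2) → ℝ) → State),
        IsReciprocal θ σ D' u X ∧ Set.InjOn X D' ∧ ∀ z ∈ D', u' (X z) = u z) ∧
    ∀ (X : (Fin (m + 2) → ℝ) → (Fin (m + 2) → ℝ)) (u' : (Fin (m + 2) → ℝ) → State),
      IsReciprocal θ σ D u X → (∀ z ∈ D, u' (X z) = u z) →
      IsOpen (X '' D) ∧ ContDiffOn ℝ ∞ u' (X '' D) ∧ (Solves V D u ↔ Solves V' (X '' D) u')

/-! ### The linear system and the transformation -/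

/-- Fields with `u ∈ I 0`, `v ∈ I 1`, `w ∈ I 2`. -/
def Box (I : Fin 3 → Set ℝ) : Set State := {p | ∀ i, p i ∈ I i}

/-- Fields in the box with pairwise distinct values. -/
def Dom (I : Fin 3 → Set ℝ) : Set State := {p | (∀ i, p i ∈ I i) ∧ Function.Injective p}

/-- `f 0 = f(u)`, `f 1 = φ(v)`, `f 2 = ψ(w)` are smooth and nowhere zero on the intervals, and `F i`
is an antiderivative of `f i` there. -/
def Admissible (I : Fin 3 → Set ℝ) (f F : Fin 3 → ℝ → ℝ) : Prop :=
  ∀ i, ContDiffOn ℝ ∞ (f i) (I i) ∧ ∀ s ∈ I i, f i s ≠ 0 ∧ HasDerivAt (F i) (f i s) s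

/-- Speeds of the linear system `u_t = u_x`, `v_t = -v_x`, `w_t = 0`. -/
def linSpeed (_ : State) : State := ![1, -1, 0]

/-- The factors `1, 1, 1/4`. -/
def kap : State := ![1, 1, 1 / 4]

/-- The metric `du²/f + dv²/φ + 4 dw²/ψ`. -/
def linMetric (f : Fin 3 → ℝ → ℝ) (p : State) : Matrix (Fin 3) (Fin 3) ℝ :=
  Matrix.diagonal fun i => 1 / (kap i * f i (p i))

/-- The local operator
`diag(f, φ, ψ/4) d/dx + ½ diag(f' u_x, φ' v_x, ψ' w_x / 4)`. -/
def linOp (f : Fin 3 → ℝ → ℝ) : Op := fun u c x i =>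
  kap i * f i (u x i) * deriv (fun y => c y i) x
    + (1 / 2) * (kap i * deriv (f i) (u x i) * dx u i x) * c x i

def dB (p : State) : ℝ := 2 * p 2 ^ 2 - p 0 ^ 2 - p 1 ^ 2
def dA (p : State) : ℝ := p 1 ^ 2 - p 0 ^ 2
def dN (p : State) : ℝ := p 0 + p 1 - 2 * p 2
def dM (p : State) : ℝ := p 0 - p 1

/-- Speeds of the flow generated by `N`: `½ f'`, `½ φ'`, `-¼ ψ'`. -/
def nSpeed (f : Fin 3 → ℝ → ℝ) (p : State) : State :=
  ![(1 / 2) * deriv (f 0) (p 0), (1 / 2) * deriv (f 1) (p 1), -(1 / 4) * deriv (f 2) (p 2)]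

/-- Speeds of the flow generated by `B`: `-(2f + u f')`, `-(2φ + v φ')`, `ψ + ½ w ψ'`. -/
def bSpeed (f : Fin 3 → ℝ → ℝ) (p : State) : State :=
  ![-(2 * f 0 (p 0) + p 0 * deriv (f 0) (p 0)), -(2 * f 1 (p 1) + p 1 * deriv (f 1) (p 1)),
    f 2 (p 2) + (1 / 2) * p 2 * deriv (f 2) (p 2)]

def fluxQ (f : Fin 3 → ℝ → ℝ) (p : State) : ℝ := 2 * ∑ i, p i ^ 2 * f i (p i)
def fluxR (f : Fin 3 → ℝ → ℝ) (p : State) : ℝ := (1 / 2) * ∑ i, f i (p i)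
def fluxP (f F : Fin 3 → ℝ → ℝ) (p : State) : ℝ := ∑ i, (-(p i * f i (p i)) + F i (p i))
def fluxS (f F : Fin 3 → ℝ → ℝ) (p : State) : ℝ := ∑ i, (-(p i * f i (p i)) - F i (p i))

/-! ### The transformed system and its operators

Indices are taken modulo `3`, so that `i`, `i + 1`, `i + 2` are the three different indices. -/

/-- `(p_i - p_j)(p_i - p_k)` with `{i, j, k} = {0, 1, 2}`. -/
def prodDiff (p : State) (i : Fin 3) : ℝ := (p i - p (i + 1)) * (p i - p (i + 2))

/-- `η = (v + w, u + w, u + v)`. -/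
def eta (p : State) : State := fun i => p (i + 1) + p (i + 2)

def mu (f F : Fin 3 → ℝ → ℝ) (p : State) : State := fun i =>
  -(1 / 2) * prodDiff p i * deriv (f i) (p i) - eta p i * fluxR f p - fluxP f F p

def lam (f F : Fin 3 → ℝ → ℝ) (p : State) : State := fun i =>
  prodDiff p i * (2 * f i (p i) + p i * deriv (f i) (p i)) - eta p i * fluxS f F p - fluxQ f p

/-- Contravariant components `(p_i - p_j)² (p_i - p_k)² f_i(p_i)` of the transformed metric. -/
def gUp (f : Fin 3 → ℝ → ℝ) (p : State) (i : Fin 3) : ℝ := prodDiff p i ^ 2 * f i (p i)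

/-- The transformed metric `∑ du_i² / ((u_i - u_j)² (u_i - u_k)² f_i(u_i))`. -/
def tMetric (f : Fin 3 → ℝ → ℝ) (p : State) : Matrix (Fin 3) (Fin 3) ℝ :=
  Matrix.diagonal fun i => 1 / gUp f p i

/-- The matrix, linear in `ξ = u_x`, of the zero order terms of the local part. -/
def tMat (f : Fin 3 → ℝ → ℝ) (p ξ : State) : Matrix (Fin 3) (Fin 3) ℝ := fun i j =>
  if i = j then
    gUp f p i * (deriv (f i) (p i) / (2 * f i (p i)) * ξ i
      + (ξ i - ξ (i + 1)) / (p i - p (i + 1)) + (ξ i - ξ (i + 2)) / (p i - p (i + 2)))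
  else (gUp f p j * ξ i + gUp f p i * ξ j) / (p i - p j)

/-- The local part of the transformed operator. -/
def tLocal (f : Fin 3 → ℝ → ℝ) : Op := fun u c x i =>
  gUp f (u x) i * deriv (fun y => c y i) x
    + ∑ j, tMat f (u x) (fun k => dx u k x) i j * c x j

/-- The four columns `λ, μ, η, 1` of the left factor of the tail. -/
def tailL (f F : Fin 3 → ℝ → ℝ) : Fin 4 → State → State :=
  ![lam f F, mu f F, eta, fun _ _ => 1]

/-- The four rows `1, η, μ, λ` of the right factor of the tail. -/
def tailR (f F : Fin 3 → ℝ → ℝ) : Fin 4 → State → State :=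
  ![fun _ _ => 1, eta, mu f F, lam f F]

/-- The transformed nonlocal operator. -/
def tOp (f F : Fin 3 → ℝ → ℝ) : Op := fun u c x =>
  tLocal f u c x + tailOp (tailL f F) (tailR f F) u c x

end

end HydroType

open HydroType

namespace HydroType

open Filter Topology MeasureTheory Set

noncomputable section

/-! ### The skew-symmetric primitive -/

/-! The tail pairs the affinors `1, η, μ, λ` with each other through the involution `Fin.rev` of
four indices. An operator of this kind, with a local part `g d/dx + b u_x` and diagonal affinors,
satisfies the Jacobi identity as soon as three things hold: `b` comes from a torsion-free metric
connection, every affinor satisfies the Codazzi equation, and the curvature is the quadratic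
expression in the affinors that the tail prescribes (the Gauss equation).

The analytic half, ending in `genOp_isHamiltonian`, differentiates the bracket along a vector `X` by
uniform first order expansions in `ε`. It integrates by parts, using that `dinv` is skew-symmetric,
until `X` appears without derivatives. The Jacobi identity then becomes a pointwise polynomial
identity in jets, with the values of the nonlocal integrals as free variables. The algebraic half,
`jacobi_of_connection`, proves this identity from Gauss and Codazzi: the connection terms cancel
because there is no torsion, and the rest is a determinant with dependent columns.

For the transformed metric both equations are rational identities in the values of `f, f', F`
(`jet_gauss`, `jet_codazzi`). They need `f` non-zero, but the Jacobi identity itself does not divide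
by `f`, so it extends to all values by continuity (`jet_jacobi`). Hence the operator, rewritten as
`polyOp`, is Hamiltonian even when the functions have zeros. Since it depends linearly on them,
compatibility follows. The same Gauss identity gives the curvature of the metric.

A reciprocal transformation is reduced to algebra by `mapsSystem_of_speeds`: closed forms have local
potentials, a non-zero determinant makes them coordinates, and the chain rule converts one system
into the other exactly when the speeds are related by a fractional linear formula.

For densities, the transformed density and flux `s, t` solve `h = sB + tN`, `k = sA + tM`.
Differentiating this gives their gradients and explicit potentials for the four nonlocal terms, and
the flow is then compared coefficient by coefficient in `u_x` (`flow_identity`).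

On constant fields only `g d/dx` survives, so the operator determines `f, φ, ψ`. A change of
antiderivatives produces four extra tail terms which cancel in pairs. -/

theorem hasCompactSupport_of_zero_off {θ : ℝ → ℝ} {R : ℝ} (h : ∀ x, x ∉ Icc (-R) R → θ x = 0) :
    HasCompactSupport θ :=
  HasCompactSupport.intro isCompact_Icc h

theorem exists_zero_off {E : Type*} [Zero E] {θ : ℝ → E}
    (h : HasCompactSupport θ) : ∃ R, 0 ≤ R ∧ ∀ x, x ∉ Icc (-R) R → θ x = 0 := by
  obtain ⟨R, hR⟩ := (IsCompact.isBounded h).subset_closedBall 0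
  refine ⟨max R 0, le_max_right _ _, fun x hx => ?_⟩
  by_contra hne
  have := hR (subset_tsupport θ hne)
  rw [Metric.mem_closedBall, dist_zero_right, Real.norm_eq_abs] at this
  exact hx (abs_le.1 (this.trans (le_max_left _ _)))

/-- Up to a constant `dinv θ` is an ordinary primitive, so the fundamental theorem of calculus
applies to it. -/
theorem dinv_eq {θ : ℝ → ℝ} (hi : Integrable θ) (x : ℝ) :
    dinv θ x = (∫ y in (0 : ℝ)..x, θ y) + ((∫ y in Iic 0, θ y) - (1 / 2) * ∫ y, θ y) := by
  have h1 := intervalIntegral.integral_Iic_sub_Iic (hi.integrableOn (s := Iic 0))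
    (hi.integrableOn (s := Iic x))
  have h2 := intervalIntegral.integral_Iic_add_Ioi (hi.integrableOn (s := Iic x))
    (hi.integrableOn (s := Ioi x))
  unfold dinv
  linarith

theorem hasDerivAt_dinv {θ : ℝ → ℝ} (hc : Continuous θ) (hs : HasCompactSupport θ) (x : ℝ) :
    HasDerivAt (dinv θ) (θ x) x := by
  have hi : Integrable θ := hc.integrable_of_hasCompactSupport hs
  rw [funext (dinv_eq hi)]
  exact (intervalIntegral.integral_hasDerivAt_right (hc.intervalIntegrable _ _)
    (hc.stronglyMeasurableAtFilter _ _) hc.continuousAt).add_const _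

theorem continuous_dinv {θ : ℝ → ℝ} (hc : Continuous θ) (hs : HasCompactSupport θ) :
    Continuous (dinv θ) :=
  continuous_iff_continuousAt.2 fun x => (hasDerivAt_dinv hc hs x).continuousAt

theorem contDiff_dinv {θ : ℝ → ℝ} (hc : ContDiff ℝ ∞ θ) (hs : HasCompactSupport θ) :
    ContDiff ℝ ∞ (dinv θ) := by
  have h := hasDerivAt_dinv hc.continuous hs
  rw [contDiff_infty_iff_deriv]
  refine ⟨fun x => (h x).differentiableAt, ?_⟩
  rwa [funext fun x => (h x).deriv]

theorem dinv_add_mul {θ₁ θ₂ : ℝ → ℝ} (h₁ : Integrable θ₁) (h₂ : Integrable θ₂) (c₁ c₂ x : ℝ) :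
    dinv (fun y => c₁ * θ₁ y + c₂ * θ₂ y) x = c₁ * dinv θ₁ x + c₂ * dinv θ₂ x := by
  unfold dinv
  rw [integral_add (h₁.integrableOn.const_mul c₁) (h₂.integrableOn.const_mul c₂),
    integral_add (h₁.integrableOn.const_mul c₁) (h₂.integrableOn.const_mul c₂)]
  simp only [integral_const_mul]
  ring

theorem abs_setIntegral_le {θ : ℝ → ℝ} {R C : ℝ} (hR : 0 ≤ R) (hC : ∀ x, |θ x| ≤ C)
    (h0 : ∀ x, x ∉ Icc (-R) R → θ x = 0) {s : Set ℝ} (hs : MeasurableSet s) :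
    |∫ y in s, θ y| ≤ C * (2 * R) := by
  have hC0 : 0 ≤ C := (abs_nonneg _).trans (hC 0)
  have h1 : ∫ y in s ∩ Icc (-R) R, θ y = ∫ y in s, θ y :=
    (setIntegral_eq_of_subset_of_forall_sdiff_eq_zero hs inter_subset_left
      fun x hx => h0 x fun hx' => hx.2 ⟨hx.1, hx'⟩).symm
  have hv : volume.real (Icc (-R) R) = 2 * R := by
    rw [Real.volume_real_Icc_of_le (by linarith)]; ring
  have hfin : volume (s ∩ Icc (-R) R) < ⊤ :=
    (measure_mono inter_subset_right).trans_lt measure_Icc_lt_top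
  rw [← h1, ← Real.norm_eq_abs]
  refine (norm_setIntegral_le_of_norm_le_const hfin fun x _ => hC x).trans ?_
  rw [← hv]
  exact mul_le_mul_of_nonneg_left
    (measureReal_mono inter_subset_right measure_Icc_lt_top.ne) hC0

theorem abs_dinv_le {θ : ℝ → ℝ} {R C : ℝ} (hR : 0 ≤ R) (hC : ∀ x, |θ x| ≤ C)
    (h0 : ∀ x, x ∉ Icc (-R) R → θ x = 0) (x : ℝ) : |dinv θ x| ≤ C * (2 * R) := by
  have h1 := abs_le.1 (abs_setIntegral_le hR hC h0 (measurableSet_Iic (a := x)))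
  have h2 := abs_le.1 (abs_setIntegral_le hR hC h0 (measurableSet_Ioi (a := x)))
  unfold dinv
  rw [abs_le]
  constructor <;> linarith [h1.1, h1.2, h2.1, h2.2]

theorem abs_integral_le {θ : ℝ → ℝ} {R C : ℝ} (hR : 0 ≤ R) (hC : ∀ x, |θ x| ≤ C)
    (h0 : ∀ x, x ∉ Icc (-R) R → θ x = 0) : |∫ y, θ y| ≤ C * (2 * R) := by
  simpa using abs_setIntegral_le hR hC h0 MeasurableSet.univ

theorem integral_hasDerivAt_eq_zero {K K' : ℝ → ℝ} (h : ∀ x, HasDerivAt K (K' x) x)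
    (hK' : Continuous K') (hs : HasCompactSupport K) : ∫ x, K' x = 0 := by
  have hd : K' = deriv K := funext fun x => (h x).deriv.symm
  refine integral_eq_zero_of_hasDerivAt_of_integrable h
    (hK'.integrable_of_hasCompactSupport ?_)
    ((continuous_iff_continuousAt.2 fun x => (h x).continuousAt).integrable_of_hasCompactSupport hs)
  rw [hd]
  exact hs.deriv

/-- Near `±∞` the function `dinv θ` equals `±½ ∫ θ`, so the product of two such functions has the
same value at both ends. Its derivative therefore has integral zero. -/
theorem integral_mul_dinv {θ₁ θ₂ : ℝ → ℝ} (h₁ : Continuous θ₁) (s₁ : HasCompactSupport θ₁)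
    (h₂ : Continuous θ₂) (s₂ : HasCompactSupport θ₂) :
    ∫ x, θ₁ x * dinv θ₂ x = -∫ x, dinv θ₁ x * θ₂ x := by
  have i1 : Integrable fun x => θ₁ x * dinv θ₂ x :=
    (h₁.mul (continuous_dinv h₂ s₂)).integrable_of_hasCompactSupport s₁.mul_right
  have i2 : Integrable fun x => dinv θ₁ x * θ₂ x :=
    ((continuous_dinv h₁ s₁).mul h₂).integrable_of_hasCompactSupport s₂.mul_left
  obtain ⟨R₁, hR₁, z₁⟩ := exists_zero_off s₁
  obtain ⟨R₂, hR₂, z₂⟩ := exists_zero_off s₂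
  have ends : ∀ {θ : ℝ → ℝ} {R : ℝ} (_ : Continuous θ) (_ : HasCompactSupport θ)
      (_ : ∀ x, x ∉ Icc (-R) R → θ x = 0) (x : ℝ),
      (R < x → dinv θ x = (1 / 2) * ∫ y, θ y) ∧ (x < -R → dinv θ x = -((1 / 2) * ∫ y, θ y)) := by
    intro θ R hc hs hz x
    have hi : Integrable θ := hc.integrable_of_hasCompactSupport hs
    have h2 := intervalIntegral.integral_Iic_add_Ioi (hi.integrableOn (s := Iic x))
      (hi.integrableOn (s := Ioi x))
    constructor
    · intro hx
      have : ∫ y in Ioi x, θ y = 0 := setIntegral_eq_zero_of_forall_eq_zero fun y hy =>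
        hz y fun h => absurd h.2 (not_le.2 (hx.trans hy))
      unfold dinv
      linarith
    · intro hx
      have : ∫ y in Iic x, θ y = 0 := setIntegral_eq_zero_of_forall_eq_zero fun y hy =>
        hz y fun h => absurd h.1 (not_le.2 (lt_of_le_of_lt hy hx))
      unfold dinv
      linarith
  -- The subtracted constant is this common end value; it makes the product compactly supported.
  have hK := integral_hasDerivAt_eq_zero
    (K := fun x => dinv θ₁ x * dinv θ₂ x - (1 / 4) * ((∫ y, θ₁ y) * ∫ y, θ₂ y))
    (fun x => ((hasDerivAt_dinv h₁ s₁ x).mul (hasDerivAt_dinv h₂ s₂ x)).sub_const _)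
    ((h₁.mul (continuous_dinv h₂ s₂)).add ((continuous_dinv h₁ s₁).mul h₂))
    (hasCompactSupport_of_zero_off (R := max R₁ R₂) fun x hx => by
      have : max R₁ R₂ < x ∨ x < -max R₁ R₂ := by
        by_contra! h
        exact hx ⟨h.2, h.1⟩
      rcases this with h | h
      · rw [(ends h₁ s₁ z₁ x).1 ((le_max_left _ _).trans_lt h),
          (ends h₂ s₂ z₂ x).1 ((le_max_right _ _).trans_lt h)]
        ring
      · rw [(ends h₁ s₁ z₁ x).2 (by linarith [le_max_left R₁ R₂]),
          (ends h₂ s₂ z₂ x).2 (by linarith [le_max_right R₁ R₂])]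
        ring)
  rw [integral_add i1 i2] at hK
  linarith

/-! ### Uniform first order expansions in a parameter -/

/-- `φ ε x = φ 0 x + ε φ' x + O(ε²)` uniformly in `x`, with bounded continuous coefficients. -/
def Expands (φ : ℝ → ℝ → ℝ) (φ' : ℝ → ℝ) : Prop :=
  ((∀ᶠ ε in 𝓝 (0 : ℝ), Continuous (φ ε)) ∧ Continuous φ') ∧
    (∃ M, ∀ x, |φ 0 x| ≤ M ∧ |φ' x| ≤ M) ∧
    ∃ C, ∀ᶠ ε in 𝓝 (0 : ℝ), ∀ x, |φ ε x - φ 0 x - ε * φ' x| ≤ C * ε ^ 2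

theorem Expands.affine {φ φ' : ℝ → ℝ} (hc : Continuous φ) (hc' : Continuous φ')
    (h : ∃ M, ∀ x, |φ x| ≤ M) (h' : ∃ M, ∀ x, |φ' x| ≤ M) :
    Expands (fun ε x => φ x + ε * φ' x) φ' := by
  obtain ⟨M, hM⟩ := h
  obtain ⟨M', hM'⟩ := h'
  refine ⟨⟨Eventually.of_forall fun ε => hc.add (hc'.const_mul ε), hc'⟩,
    ⟨max M M', fun x => ⟨?_, (hM' x).trans (le_max_right _ _)⟩⟩, 0, ?_⟩
  · simpa using (hM x).trans (le_max_left _ _)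
  · refine Eventually.of_forall fun ε x => ?_
    rw [show φ x + ε * φ' x - (φ x + 0 * φ' x) - ε * φ' x = 0 by ring]
    simp

theorem Expands.const {φ : ℝ → ℝ} (hc : Continuous φ) (h : ∃ M, ∀ x, |φ x| ≤ M) :
    Expands (fun _ => φ) fun _ => 0 := by
  simpa using Expands.affine (φ' := fun _ => 0) hc continuous_const h ⟨0, by simp⟩

theorem Expands.add {φ ψ : ℝ → ℝ → ℝ} {φ' ψ' : ℝ → ℝ} (hφ : Expands φ φ') (hψ : Expands ψ ψ') :
    Expands (fun ε x => φ ε x + ψ ε x) fun x => φ' x + ψ' x := by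
  obtain ⟨⟨hcφ, hcφ'⟩, ⟨M, hM⟩, C, hC⟩ := hφ
  obtain ⟨⟨hcψ, hcψ'⟩, ⟨N, hN⟩, D, hD⟩ := hψ
  refine ⟨⟨hcφ.mp (hcψ.mono fun ε h1 h2 => h2.add h1), hcφ'.add hcψ'⟩,
    ⟨M + N, fun x => ⟨?_, ?_⟩⟩, C + D, ?_⟩
  · exact (abs_add_le _ _).trans (add_le_add (hM x).1 (hN x).1)
  · exact (abs_add_le _ _).trans (add_le_add (hM x).2 (hN x).2)
  · filter_upwards [hC, hD] with ε h1 h2 x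
    calc _ = |(φ ε x - φ 0 x - ε * φ' x) + (ψ ε x - ψ 0 x - ε * ψ' x)| := by ring_nf
      _ ≤ C * ε ^ 2 + D * ε ^ 2 := (abs_add_le _ _).trans (add_le_add (h1 x) (h2 x))
      _ = _ := by ring

theorem Expands.sum {ι : Type*} (s : Finset ι) {φ : ι → ℝ → ℝ → ℝ} {φ' : ι → ℝ → ℝ}
    (h : ∀ i ∈ s, Expands (φ i) (φ' i)) :
    Expands (fun ε x => ∑ i ∈ s, φ i ε x) fun x => ∑ i ∈ s, φ' i x := by
  classical
  induction s using Finset.induction_on with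
  | empty => simpa using Expands.const (φ := fun _ => 0) continuous_const ⟨0, by simp⟩
  | insert i s hi ih =>
    simp only [Finset.sum_insert hi]
    exact (h i (Finset.mem_insert_self _ _)).add
      (ih fun j hj => h j (Finset.mem_insert_of_mem hj))

/-- Boundedness of the coefficients, which is part of `Expands`, keeps the error of the product
quadratic uniformly in `x`. -/
theorem Expands.mul {φ ψ : ℝ → ℝ → ℝ} {φ' ψ' : ℝ → ℝ} (hφ : Expands φ φ') (hψ : Expands ψ ψ') :
    Expands (fun ε x => φ ε x * ψ ε x) fun x => φ' x * ψ 0 x + φ 0 x * ψ' x := by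
  obtain ⟨⟨hcφ, hcφ'⟩, ⟨M, hM⟩, C, hC⟩ := hφ
  obtain ⟨⟨hcψ, hcψ'⟩, ⟨N, hN⟩, D, hD⟩ := hψ
  have hM0 : 0 ≤ M := (abs_nonneg _).trans (hM 0).1
  have hN0 : 0 ≤ N := (abs_nonneg _).trans (hN 0).1
  -- With `r`, `s` the remainders of the two factors, the error is `r·ψ + (φ 0 + εφ')·s + ε²φ'ψ'`.
  -- The three summands of the constant bound these for `|ε| < 1`; absolute values are needed
  -- because `C` and `D` may be negative.
  refine ⟨⟨hcφ.mp (hcψ.mono fun ε h1 h2 => h2.mul h1),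
    (hcφ'.mul hcψ.self_of_nhds).add (hcφ.self_of_nhds.mul hcψ')⟩,
    ⟨M * N + M * N, fun x => ⟨?_, ?_⟩⟩,
    |C| * (2 * N + |D|) + 2 * M * |D| + M * N, ?_⟩
  · rw [abs_mul]
    nlinarith [mul_le_mul (hM x).1 (hN x).1 (abs_nonneg _) hM0]
  · refine (abs_add_le _ _).trans (add_le_add ?_ ?_) <;> rw [abs_mul]
    · exact mul_le_mul (hM x).2 (hN x).1 (abs_nonneg _) hM0
    · exact mul_le_mul (hM x).1 (hN x).2 (abs_nonneg _) hM0
  · have h1 : ∀ᶠ ε in 𝓝 (0 : ℝ), |ε| < 1 := by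
      filter_upwards [Metric.ball_mem_nhds (0 : ℝ) one_pos] with ε hε
      simpa using hε
    filter_upwards [hC, hD, h1] with ε hr hs hε x
    have hε2 : ε ^ 2 ≤ 1 := by
      rw [← sq_abs]; exact pow_le_one₀ (abs_nonneg _) hε.le
    have hr' : |φ ε x - φ 0 x - ε * φ' x| ≤ |C| * ε ^ 2 :=
      (hr x).trans (mul_le_mul_of_nonneg_right (le_abs_self C) (sq_nonneg ε))
    have hs' : |ψ ε x - ψ 0 x - ε * ψ' x| ≤ |D| * ε ^ 2 :=
      (hs x).trans (mul_le_mul_of_nonneg_right (le_abs_self D) (sq_nonneg ε))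
    have hlin : ∀ {a b K : ℝ}, |a| ≤ K → |b| ≤ K → |a + ε * b| ≤ 2 * K := by
      intro a b K ha hb
      refine (abs_add_le _ _).trans ?_
      rw [abs_mul]
      nlinarith [abs_nonneg ε, abs_nonneg b]
    have hA := hlin (hM x).1 (hM x).2
    have hB := hlin (hN x).1 (hN x).2
    have hs'' : |ψ ε x - ψ 0 x - ε * ψ' x| ≤ |D| :=
      hs'.trans (by nlinarith [abs_nonneg D])
    calc |φ ε x * ψ ε x - φ 0 x * ψ 0 x - ε * (φ' x * ψ 0 x + φ 0 x * ψ' x)|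
        = |(φ ε x - φ 0 x - ε * φ' x) * ((ψ 0 x + ε * ψ' x) + (ψ ε x - ψ 0 x - ε * ψ' x))
            + (φ 0 x + ε * φ' x) * (ψ ε x - ψ 0 x - ε * ψ' x) + ε ^ 2 * (φ' x * ψ' x)| := by
          congr 1; ring
      _ ≤ (|C| * ε ^ 2) * (2 * N + |D|) + 2 * M * (|D| * ε ^ 2) + ε ^ 2 * (M * N) := by
          refine (abs_add_le _ _).trans (add_le_add ((abs_add_le _ _).trans (add_le_add ?_ ?_)) ?_)
          · rw [abs_mul]
            exact mul_le_mul hr' ((abs_add_le _ _).trans (add_le_add hB hs'')) (abs_nonneg _)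
              (by positivity)
          · rw [abs_mul]
            exact mul_le_mul hA hs' (abs_nonneg _) (by positivity)
          · rw [abs_mul, abs_mul, abs_of_nonneg (sq_nonneg ε)]
            exact mul_le_mul_of_nonneg_left
              (mul_le_mul (hM x).2 (hN x).2 (abs_nonneg _) hM0) (sq_nonneg ε)
      _ = _ := by ring

theorem Expands.congr {φ ψ : ℝ → ℝ → ℝ} {φ' ψ' : ℝ → ℝ} (h : Expands φ φ')
    (e : ∀ᶠ ε in 𝓝 (0 : ℝ), φ ε = ψ ε) (e' : φ' = ψ') : Expands ψ ψ' := by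
  subst e'
  have e0 : φ 0 = ψ 0 := e.self_of_nhds
  obtain ⟨hc, hM, C, hC⟩ := h
  refine ⟨⟨hc.1.mp (e.mono fun ε h1 h2 => h1 ▸ h2), hc.2⟩, e0 ▸ hM, C, ?_⟩
  filter_upwards [hC, e] with ε h1 h2
  rwa [← h2, ← e0]

/-- The functions `φ ε`, for small `ε`, and `φ'` vanish off a common compact interval. -/
def CommonSupport (φ : ℝ → ℝ → ℝ) (φ' : ℝ → ℝ) : Prop :=
  ∃ R, 0 ≤ R ∧ (∀ ε x, x ∉ Icc (-R) R → φ ε x = 0) ∧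
    ∀ x, x ∉ Icc (-R) R → φ' x = 0

theorem hasDerivAt_of_quadratic {F : ℝ → ℝ} {F' C : ℝ}
    (h : ∀ᶠ ε in 𝓝 (0 : ℝ), |F ε - F 0 - ε * F'| ≤ C * ε ^ 2) : HasDerivAt F F' 0 := by
  rw [hasDerivAt_iff_isLittleO]
  have h1 : (fun ε : ℝ => F ε - F 0 - (ε - 0) • F') =O[𝓝 0] fun ε : ℝ => ε ^ 2 := by
    refine Asymptotics.IsBigO.of_bound C ?_
    filter_upwards [h] with ε hε
    simpa using hε
  refine h1.trans_isLittleO ?_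
  simpa using Asymptotics.isLittleO_pow_id (𝕜 := ℝ) one_lt_two

/-- The remainder is `O(ε²)` and lives on a fixed interval, so its integrals are `O(ε²)` too. This
replaces dominated convergence. -/
theorem CommonSupport.remainder {φ : ℝ → ℝ → ℝ} {φ' : ℝ → ℝ} (h : Expands φ φ')
    (hs : CommonSupport φ φ') : ∃ R C, 0 ≤ R ∧ Integrable φ' ∧ Integrable (φ 0) ∧
      ∀ᶠ ε in 𝓝 (0 : ℝ), Integrable (φ ε) ∧ (∀ x, |φ ε x - φ 0 x - ε * φ' x| ≤ C * ε ^ 2) ∧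
        ∀ x, x ∉ Icc (-R) R → φ ε x - φ 0 x - ε * φ' x = 0 := by
  obtain ⟨⟨hc, hc'⟩, -, C, hC⟩ := h
  obtain ⟨R, hR, h1, h3⟩ := hs
  refine ⟨R, C, hR, hc'.integrable_of_hasCompactSupport (hasCompactSupport_of_zero_off h3),
    hc.self_of_nhds.integrable_of_hasCompactSupport (hasCompactSupport_of_zero_off (h1 0)), ?_⟩
  filter_upwards [hC, hc] with ε hε h4
  refine ⟨h4.integrable_of_hasCompactSupport (hasCompactSupport_of_zero_off (h1 ε)), hε,
    fun x hx => ?_⟩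
  rw [h1 ε x hx, h1 0 x hx, h3 x hx]
  ring

theorem Expands.hasDerivAt_integral {φ : ℝ → ℝ → ℝ} {φ' : ℝ → ℝ} (h : Expands φ φ')
    (hs : CommonSupport φ φ') : HasDerivAt (fun ε => ∫ x, φ ε x) (∫ x, φ' x) 0 := by
  obtain ⟨R, C, hR, i', i0, hev⟩ := hs.remainder h
  refine hasDerivAt_of_quadratic (C := C * (2 * R)) ?_
  filter_upwards [hev] with ε ⟨iε, hb, hz⟩
  have : (∫ x, φ ε x) - (∫ x, φ 0 x) - ε * ∫ x, φ' x = ∫ x, (φ ε x - φ 0 x - ε * φ' x) := by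
    rw [← integral_sub iε i0, ← integral_const_mul]
    exact (integral_sub (f := fun x => φ ε x - φ 0 x) (iε.sub i0) (i'.const_mul ε)).symm
  rw [this]
  exact (abs_integral_le hR hb hz).trans (le_of_eq (by ring))

/-- On functions supported in a fixed interval `dinv` is linear and bounded in the sup norm. Its
values are only bounded, not compactly supported, which is why `Expands` asks for no support
condition. -/
theorem Expands.dinv {φ : ℝ → ℝ → ℝ} {φ' : ℝ → ℝ} (h : Expands φ φ')
    (hs : CommonSupport φ φ') : Expands (fun ε => dinv (φ ε)) (dinv φ') := by
  obtain ⟨R, C, hR, i', i0, hev⟩ := hs.remainder h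
  obtain ⟨⟨hc, hc'⟩, ⟨M, hM⟩, -⟩ := h
  obtain ⟨R', hR', h1, h3⟩ := hs
  refine ⟨⟨hc.mono fun ε h => continuous_dinv h (hasCompactSupport_of_zero_off (h1 ε)),
      continuous_dinv hc' (hasCompactSupport_of_zero_off h3)⟩,
    ⟨M * (2 * R'), fun x => ⟨abs_dinv_le hR' (fun x => (hM x).1) (h1 0) x,
    abs_dinv_le hR' (fun x => (hM x).2) h3 x⟩⟩, C * (2 * R), ?_⟩
  filter_upwards [hev] with ε ⟨iε, hb, hz⟩ x
  have e1 := dinv_add_mul (iε.sub i0) i' 1 (-ε) x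
  have e2 := dinv_add_mul iε i0 1 (-1) x
  have : HydroType.dinv (φ ε) x - HydroType.dinv (φ 0) x - ε * HydroType.dinv φ' x
      = HydroType.dinv (fun x => φ ε x - φ 0 x - ε * φ' x) x := by
    have f1 : (fun y => 1 * (φ ε - φ 0) y + -ε * φ' y) = fun x => φ ε x - φ 0 x - ε * φ' x := by
      ext y; simp only [Pi.sub_apply]; ring
    have f2 : (fun y => 1 * φ ε y + -1 * φ 0 y) = φ ε - φ 0 := by
      ext y; simp only [Pi.sub_apply]; ring
    rw [f1] at e1
    rw [f2] at e2
    rw [e1, e2]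
    ring
  rw [this]
  exact (abs_dinv_le hR hb hz x).trans (le_of_eq (by ring))

/-! ### Composition with perturbed fields -/

theorem fderiv_eq_sum_pd {m : ℕ} (g : (Fin m → ℝ) → ℝ) (p v : Fin m → ℝ) :
    fderiv ℝ g p v = ∑ k, pd k g p * v k := by
  have : v = ∑ k, v k • (Pi.single k 1 : Fin m → ℝ) := by
    ext j
    simp [Finset.sum_apply, Pi.single_apply]
  conv_lhs => rw [this]
  simp [map_sum, pd, mul_comm]

/-! ### Fields and test functions -/

theorem dx_eq {u : ℝ → State} (hu : ContDiff ℝ ∞ u) (i : Fin 3) (x : ℝ) :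
    dx u i x = deriv u x i := by
  have h : HasDerivAt u (deriv u x) x := (hu.differentiable (by simp) x).hasDerivAt
  exact ((hasDerivAt_pi.1 h) i).deriv

theorem contDiff_apply_comp {u : ℝ → State} (hu : ContDiff ℝ ∞ u) (i : Fin 3) :
    ContDiff ℝ ∞ fun x => u x i := contDiff_pi.1 hu i

theorem contDiff_dx {u : ℝ → State} (hu : ContDiff ℝ ∞ u) (i : Fin 3) : ContDiff ℝ ∞ (dx u i) :=
  (contDiff_infty_iff_deriv.1 (contDiff_apply_comp hu i)).2

theorem hasDerivAt_apply {u : ℝ → State} (hu : ContDiff ℝ ∞ u) (i : Fin 3) (x : ℝ) :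
    HasDerivAt (fun y => u y i) (dx u i x) x :=
  ((contDiff_apply_comp hu i).differentiable (by simp) x).hasDerivAt

theorem hasCompactSupport_apply {u : ℝ → State} (hu : HasCompactSupport u) (i : Fin 3) :
    HasCompactSupport fun x => u x i :=
  hu.comp_left (g := fun p : State => p i) rfl

theorem hasCompactSupport_dx {u : ℝ → State} (hu : ContDiff ℝ ∞ u)
    (hs : HasCompactSupport (deriv u)) (i : Fin 3) : HasCompactSupport (dx u i) := by
  rw [funext (dx_eq hu i)]
  exact hasCompactSupport_apply hs i

theorem dx_add_smul {u X : ℝ → State} (hu : ContDiff ℝ ∞ u) (hX : ContDiff ℝ ∞ X) (ε : ℝ)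
    (i : Fin 3) (x : ℝ) : dx (u + ε • X) i x = dx u i x + ε * dx X i x :=
  ((hasDerivAt_apply hu i x).add ((hasDerivAt_apply hX i x).const_mul ε)).deriv

theorem exists_bound_of_hasCompactSupport {E : Type*} [NormedAddCommGroup E] {θ : ℝ → E}
    (hc : Continuous θ) (hs : HasCompactSupport θ) : ∃ M, ∀ x, ‖θ x‖ ≤ M :=
  hs.exists_bound_of_continuous hc

/-- A field is constant on both unbounded ends, so its range is already attained on a compact
interval. -/
theorem exists_compact_range {Ω : Set State} {u : ℝ → State} (hu : u ∈ Fields Ω) :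
    ∃ K, IsCompact K ∧ K ⊆ Ω ∧ ∀ x, u x ∈ K := by
  obtain ⟨⟨hc, hΩ⟩, hs⟩ := hu
  obtain ⟨R, hR, hz⟩ := exists_zero_off hs
  have hd : ∀ x, x ∉ Icc (-R) R → HasDerivAt u 0 x := fun x hx => by
    have := (hc.differentiable (by simp) x).hasDerivAt
    rwa [hz x hx] at this
  -- The extra unit puts the endpoints strictly where the derivative is known to vanish.
  refine ⟨u '' Icc (-(R + 1)) (R + 1), isCompact_Icc.image hc.continuous, ?_, fun x => ?_⟩
  · rintro _ ⟨x, -, rfl⟩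
    exact hΩ x
  rcases lt_or_ge x (-(R + 1)) with hx | hx
  · refine ⟨-(R + 1), ⟨le_refl _, by linarith⟩, ?_⟩
    exact constant_of_has_deriv_right_zero hc.continuous.continuousOn
      (fun y hy => (hd y fun h => by linarith [h.1, hy.2]).hasDerivWithinAt) _ ⟨hx.le, le_rfl⟩
  rcases lt_or_ge (R + 1) x with hx' | hx'
  · refine ⟨R + 1, ⟨by linarith, le_rfl⟩, ?_⟩
    exact (constant_of_has_deriv_right_zero hc.continuous.continuousOn
      (fun y hy => (hd y fun h => by linarith [h.2, hy.1]).hasDerivWithinAt) _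
      ⟨hx'.le, le_rfl⟩).symm
  · exact ⟨x, ⟨hx, hx'⟩, rfl⟩

theorem add_smul_mem_fields {Ω : Set State} (hΩ : IsOpen Ω) {u X : ℝ → State} (hu : u ∈ Fields Ω)
    (hX : X ∈ Test) : ∀ᶠ ε in 𝓝 (0 : ℝ), u + ε • X ∈ Fields Ω := by
  obtain ⟨K, hK, hKΩ, huK⟩ := exists_compact_range hu
  obtain ⟨⟨hc, -⟩, hs⟩ := hu
  obtain ⟨M, hM⟩ := exists_bound_of_hasCompactSupport hX.1.continuous hX.2
  have hM0 : 0 ≤ M := (norm_nonneg _).trans (hM 0)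
  obtain ⟨δ, hδ, hsub⟩ := hK.exists_thickening_subset_open hΩ hKΩ
  have hsmall : ∀ᶠ ε in 𝓝 (0 : ℝ), |ε| * M < δ := by
    have : Tendsto (fun ε : ℝ => |ε| * M) (𝓝 0) (𝓝 (|0| * M)) :=
      (continuous_abs.mul continuous_const).tendsto 0
    rw [abs_zero, zero_mul] at this
    exact this.eventually_lt_const hδ
  filter_upwards [hsmall] with ε hε
  refine ⟨⟨hc.add (hX.1.const_smul ε), fun x => hsub ?_⟩, ?_⟩
  · refine Metric.mem_thickening_iff.2 ⟨u x, huK x, ?_⟩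
    rw [dist_eq_norm, Pi.add_apply, add_sub_cancel_left, Pi.smul_apply, norm_smul,
      Real.norm_eq_abs]
    exact (mul_le_mul_of_nonneg_left (hM x) (abs_nonneg _)).trans_lt hε
  · have : deriv (u + ε • X) = deriv u + ε • deriv X := by
      ext1 x
      exact ((hc.differentiable (by simp) x).hasDerivAt.add
        ((hX.1.differentiable (by simp) x).hasDerivAt.const_smul ε)).deriv
    rw [this]
    exact hs.add (hX.2.deriv.smul_left (f := fun _ => ε))

theorem contDiff_comp_field {Ω : Set State} {g : State → ℝ}
    (hg : ContDiffOn ℝ ∞ g Ω) {u : ℝ → State} (hu : u ∈ SmoothFields Ω) :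
    ContDiff ℝ ∞ fun x => g (u x) := by
  rw [← contDiffOn_univ]
  exact hg.comp hu.1.contDiffOn fun x _ => hu.2 x

theorem contDiffOn_pd {m : ℕ} {Ω : Set (Fin m → ℝ)} (hΩ : IsOpen Ω) {g : (Fin m → ℝ) → ℝ}
    (hg : ContDiffOn ℝ ∞ g Ω) (k : Fin m) : ContDiffOn ℝ ∞ (pd k g) Ω :=
  (hg.fderiv_of_isOpen hΩ (by simp)).clm_apply contDiffOn_const

theorem hasDerivAt_comp_field {g : State → ℝ} {u : ℝ → State} {x : ℝ}
    (hg : DifferentiableAt ℝ g (u x)) (hu : ContDiff ℝ ∞ u) :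
    HasDerivAt (fun x => g (u x)) (∑ k, pd k g (u x) * dx u k x) x := by
  have h := hg.hasFDerivAt.comp_hasDerivAt x (hu.differentiable (by simp) x).hasDerivAt
  rw [fderiv_eq_sum_pd] at h
  simp only [← dx_eq hu] at h
  exact h

/-- Second order Taylor estimate. The range of `u` is compact in the open set `Ω`, so one bound for
the second derivative serves for all `x` at once. -/
theorem expands_comp {Ω : Set State} (hΩ : IsOpen Ω) {g : State → ℝ} (hg : ContDiffOn ℝ ∞ g Ω)
    {u X : ℝ → State} (huF : u ∈ Fields Ω) (hX : X ∈ Test) :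
    Expands (fun ε x => g ((u + ε • X) x)) fun x => ∑ k, pd k g (u x) * X x k := by
  have hcont : ∀ᶠ ε in 𝓝 (0 : ℝ), Continuous fun x => g ((u + ε • X) x) :=
    (add_smul_mem_fields hΩ huF hX).mono fun ε h => (contDiff_comp_field hg h.1).continuous
  have hcont' : Continuous fun x => ∑ k, pd k g (u x) * X x k :=
    continuous_finsetSum _ fun k _ =>
      (contDiff_comp_field (contDiffOn_pd hΩ hg k) huF.1).continuous.mul
        (contDiff_apply_comp hX.1 k).continuous
  obtain ⟨K, hK, hKΩ, hu⟩ := exists_compact_range huF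
  obtain ⟨M, hM⟩ := exists_bound_of_hasCompactSupport hX.1.continuous hX.2
  have hM0 : 0 ≤ M := (norm_nonneg _).trans (hM 0)
  obtain ⟨δ, hδ, hsub⟩ := hK.exists_cthickening_subset_open hΩ hKΩ
  have hT : IsCompact (Metric.cthickening δ K) := hK.cthickening
  have hg1 : ContDiffOn ℝ ∞ (fderiv ℝ g) Ω := hg.fderiv_of_isOpen hΩ (by simp)
  have hg2 : ContDiffOn ℝ ∞ (fderiv ℝ (fderiv ℝ g)) Ω := hg1.fderiv_of_isOpen hΩ (by simp)
  obtain ⟨C, hC⟩ := hT.exists_bound_of_continuousOn (E := State →L[ℝ] State →L[ℝ] ℝ)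
    (hg2.continuousOn.mono hsub)
  obtain ⟨A, hA⟩ := hK.exists_bound_of_continuousOn (hg.continuousOn.mono hKΩ)
  obtain ⟨A', hA'⟩ := hK.exists_bound_of_continuousOn (hg1.continuousOn.mono hKΩ)
  have hC0 : 0 ≤ C := (norm_nonneg _).trans (hC (u 0) (Metric.self_subset_cthickening _ (hu 0)))
  have hA0 : 0 ≤ A' := (norm_nonneg _).trans (hA' (u 0) (hu 0))
  refine ⟨⟨hcont, hcont'⟩, ⟨max A (A' * M), fun x => ⟨?_, ?_⟩⟩, C * M ^ 2, ?_⟩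
  · simpa using (hA (u x) (hu x)).trans (le_max_left _ _)
  · change |∑ k, pd k g (u x) * X x k| ≤ _
    rw [← fderiv_eq_sum_pd]
    refine le_trans ?_ (le_max_right _ _)
    exact ((fderiv ℝ g (u x)).le_opNorm _).trans
      (mul_le_mul (hA' _ (hu x)) (hM x) (norm_nonneg _) hA0)
  · have hsmall : ∀ᶠ ε in 𝓝 (0 : ℝ), |ε| * M < δ := by
      have : Tendsto (fun ε : ℝ => |ε| * M) (𝓝 0) (𝓝 (|0| * M)) :=
        (continuous_abs.mul continuous_const).tendsto 0
      rw [abs_zero, zero_mul] at this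
      exact this.eventually_lt_const hδ
    filter_upwards [hsmall] with ε hε x
    rw [← fderiv_eq_sum_pd]
    set p := u x with hp
    set q := p + ε • X x with hq
    have hqp : ‖q - p‖ ≤ |ε| * M := by
      rw [hq, add_sub_cancel_left, norm_smul, Real.norm_eq_abs]
      exact mul_le_mul_of_nonneg_left (hM x) (abs_nonneg _)
    -- The mean value inequality needs convex sets; the thickening need not be convex, but the balls
    -- inside it are.
    have hball : Metric.ball p δ ⊆ Metric.cthickening δ K :=
      (Metric.ball_subset_thickening (hu x) δ).trans (Metric.thickening_subset_cthickening _ _)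
    have hpb : p ∈ Metric.ball p δ := Metric.mem_ball_self hδ
    have hqb : q ∈ Metric.ball p δ := by
      rw [mem_ball_iff_norm]; exact hqp.trans_lt hε
    have hdg : ∀ y ∈ Metric.ball p δ, DifferentiableAt ℝ g y := fun y hy =>
      (hg.differentiableOn (by simp)).differentiableAt (hΩ.mem_nhds (hsub (hball hy)))
    have hdg1 : ∀ y ∈ Metric.ball p δ, DifferentiableAt ℝ (fderiv ℝ g) y := fun y hy =>
      (hg1.differentiableOn (by simp)).differentiableAt (hΩ.mem_nhds (hsub (hball hy)))
    have hlip : ∀ y ∈ Metric.ball p δ, ‖fderiv ℝ g y - fderiv ℝ g p‖ ≤ C * ‖y - p‖ := fun y hy =>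
      (convex_ball p δ).norm_image_sub_le_of_norm_fderiv_le hdg1
        (fun z hz => hC z (hball hz)) hpb hy
    have hseg : segment ℝ p q ⊆ Metric.ball p δ := (convex_ball p δ).segment_subset hpb hqb
    have hmv := (convex_segment p q).norm_image_sub_le_of_norm_hasFDerivWithin_le'
      (f := g) (f' := fderiv ℝ g) (φ := fderiv ℝ g p) (C := C * ‖q - p‖)
      (fun y hy => (hdg y (hseg hy)).hasFDerivAt.hasFDerivWithinAt)
      (fun y hy => (hlip y (hseg hy)).trans (mul_le_mul_of_nonneg_left
        (by
          rw [segment_eq_image_lineMap] at hy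
          obtain ⟨t, ht, rfl⟩ := hy
          rw [AffineMap.lineMap_apply, vsub_eq_sub, vadd_eq_add, add_sub_cancel_right, norm_smul,
            Real.norm_eq_abs, abs_of_nonneg ht.1]
          exact mul_le_of_le_one_left (norm_nonneg _) ht.2) hC0))
      (left_mem_segment ℝ p q) (right_mem_segment ℝ p q)
    have e1 : (u + ε • X) x = q := rfl
    have e2 : (u + (0 : ℝ) • X) x = p := by simp [hp]
    rw [e1, e2, ← Real.norm_eq_abs]
    have e3 : ε * fderiv ℝ g p (X x) = fderiv ℝ g p (q - p) := by
      rw [hq, add_sub_cancel_left, map_smul, smul_eq_mul]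
    rw [e3]
    refine hmv.trans ?_
    calc C * ‖q - p‖ * ‖q - p‖ ≤ C * (|ε| * M) * (|ε| * M) := by gcongr
      _ = C * M ^ 2 * ε ^ 2 := by rw [← sq_abs ε]; ring

/-! ### Weakly nonlocal operators with diagonal leading coefficient and diagonal affinors -/

/-- The operator `g^i d/dx + b^{ij}_k u^k_x + ∑ L_α u_x (d/dx)⁻¹ R_α u_x`. -/
def genOp {A : Type} [Fintype A] (g : Fin 3 → State → ℝ) (b : Fin 3 → Fin 3 → Fin 3 → State → ℝ)
    (L R : A → State → State) : Op := fun u c x i =>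
  g i (u x) * deriv (fun y => c y i) x + (∑ j, ∑ k, b i j k (u x) * dx u k x * c x j)
    + tailOp L R u c x i

/-- The density `∑ w^j u^j_x c_j`. -/
def tailDensity (w : State → State) (u c : ℝ → State) (x : ℝ) : ℝ :=
  ∑ j, w (u x) j * dx u j x * c x j

section

variable {Ω : Set State}

theorem tailDensity_contDiff {w : State → State} (hw : ∀ i, ContDiffOn ℝ ∞ (fun p => w p i) Ω)
    {u c : ℝ → State} (hu : u ∈ SmoothFields Ω) (hc : c ∈ Test) :
    ContDiff ℝ ∞ (tailDensity w u c) :=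
  ContDiff.sum fun j _ => ((contDiff_comp_field (hw j) hu).mul (contDiff_dx hu.1 j)).mul
    (contDiff_apply_comp hc.1 j)

theorem tailDensity_eq_zero (w : State → State) (u : ℝ → State) {c : ℝ → State} {x : ℝ}
    (hx : c x = 0) : tailDensity w u c x = 0 := by
  simp [tailDensity, hx]

theorem tailDensity_hasCompactSupport (w : State → State) (u : ℝ → State) {c : ℝ → State}
    (hc : c ∈ Test) : HasCompactSupport (tailDensity w u c) :=
  hc.2.mono fun x hx => by
    contrapose! hx
    simpa using tailDensity_eq_zero w u (by simpa using hx)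

theorem contDiff_tail {w : State → State} (hw : ∀ i, ContDiffOn ℝ ∞ (fun p => w p i) Ω)
    {u c : ℝ → State} (hu : u ∈ SmoothFields Ω) (hc : c ∈ Test) :
    ContDiff ℝ ∞ (dinv (tailDensity w u c)) :=
  contDiff_dinv (tailDensity_contDiff hw hu hc) (tailDensity_hasCompactSupport w u hc)

theorem tailOp_eq {A : Type} [Fintype A] (L R : A → State → State) (u c : ℝ → State) (x : ℝ)
    (i : Fin 3) : tailOp L R u c x i
      = ∑ α, L α (u x) i * dx u i x * dinv (tailDensity (R α) u c) x := rfl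

variable {A : Type} [Fintype A] {g : Fin 3 → State → ℝ}
  {b : Fin 3 → Fin 3 → Fin 3 → State → ℝ} {L R : A → State → State}

/-- The integrals `dinv` do not vanish far out; the tail does, because of the factor `u_x` in front
of them. -/
theorem genOp_mem_test (hg : ∀ i, ContDiffOn ℝ ∞ (g i) Ω)
    (hb : ∀ i j k, ContDiffOn ℝ ∞ (b i j k) Ω) (hL : ∀ α i, ContDiffOn ℝ ∞ (fun p => L α p i) Ω)
    (hR : ∀ α i, ContDiffOn ℝ ∞ (fun p => R α p i) Ω) {u c : ℝ → State} (hu : u ∈ Fields Ω)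
    (hc : c ∈ Test) : genOp g b L R u c ∈ Test := by
  refine ⟨contDiff_pi.2 fun i => ?_, ?_⟩
  · refine (((contDiff_comp_field (hg i) hu.1).mul
      (contDiff_infty_iff_deriv.1 (contDiff_apply_comp hc.1 i)).2).add
      (ContDiff.sum fun j _ => ContDiff.sum fun k _ =>
        ((contDiff_comp_field (hb i j k) hu.1).mul (contDiff_dx hu.1.1 k)).mul
          (contDiff_apply_comp hc.1 j))).add
      (ContDiff.sum fun α _ => ((contDiff_comp_field (hL α i) hu.1).mul
        (contDiff_dx hu.1.1 i)).mul (contDiff_tail (hR α) hu.1 hc))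
  · obtain ⟨R₁, hR₁, z₁⟩ := exists_zero_off hc.2
    obtain ⟨R₂, hR₂, z₂⟩ := exists_zero_off hu.2
    obtain ⟨R₃, hR₃, z₃⟩ := exists_zero_off hc.2.deriv
    refine HasCompactSupport.intro (isCompact_Icc (a := -max R₁ (max R₂ R₃))
      (b := max R₁ (max R₂ R₃))) fun x hx => ?_
    have hoff : ∀ r ≤ max R₁ (max R₂ R₃), x ∉ Icc (-r) r := fun r hr h =>
      hx ⟨by linarith [h.1], h.2.trans hr⟩
    have e1 : c x = 0 := z₁ x (hoff _ (le_max_left _ _))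
    have e2 : ∀ i, dx u i x = 0 := fun i => by
      rw [dx_eq hu.1.1, z₂ x (hoff _ ((le_max_left _ _).trans (le_max_right _ _)))]; rfl
    have e3 : ∀ i, deriv (fun y => c y i) x = 0 := fun i => by
      change dx c i x = 0
      rw [dx_eq hc.1, z₃ x (hoff _ ((le_max_right _ _).trans (le_max_right _ _)))]; rfl
    ext i
    simp [genOp, tailOp_eq, e1, e2, e3]

/-! ### The derivative of the bracket -/

/-- Derivative of `tailDensity` along `X`. -/
def tailDensityVar (w : State → State) (u X c : ℝ → State) (x : ℝ) : ℝ :=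
  ∑ j, ((∑ k, pd k (fun p => w p j) (u x) * X x k) * dx u j x + w (u x) j * dx X j x) * c x j

/-- The density of the derivative of the bracket along `X`. -/
def bracketVar (g : Fin 3 → State → ℝ) (b : Fin 3 → Fin 3 → Fin 3 → State → ℝ)
    (L R : A → State → State) (u X a c : ℝ → State) (x : ℝ) : ℝ :=
  ∑ i, a x i * ((∑ k, pd k (g i) (u x) * X x k) * dx c i x
    + (∑ j, ∑ k, ((∑ l, pd l (b i j k) (u x) * X x l) * dx u k x + b i j k (u x) * dx X k x)
        * c x j)
    + ∑ α, (((∑ k, pd k (fun p => L α p i) (u x) * X x k) * dx u i x + L α (u x) i * dx X i x)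
          * dinv (tailDensity (R α) u c) x
        + L α (u x) i * dx u i x * dinv (tailDensityVar (R α) u X c) x))

theorem expands_dx {u X : ℝ → State} (hu : u ∈ Fields Ω) (hX : X ∈ Test)
    (i : Fin 3) : Expands (fun ε => dx (u + ε • X) i) (dx X i) := by
  refine (Expands.affine (contDiff_dx hu.1.1 i).continuous (contDiff_dx hX.1 i).continuous
    (exists_bound_of_hasCompactSupport (contDiff_dx hu.1.1 i).continuous
      (hasCompactSupport_dx hu.1.1 hu.2 i))
    (exists_bound_of_hasCompactSupport (contDiff_dx hX.1 i).continuous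
      (hasCompactSupport_dx hX.1 hX.2.deriv i))).congr (Eventually.of_forall fun ε => ?_) rfl
  ext x
  exact (dx_add_smul hu.1.1 hX.1 ε i x).symm

theorem expands_const_test {c : ℝ → State} (hc : c ∈ Test) (i : Fin 3) :
    Expands (fun _ x => c x i) fun _ => 0 :=
  Expands.const (contDiff_apply_comp hc.1 i).continuous
    (exists_bound_of_hasCompactSupport (contDiff_apply_comp hc.1 i).continuous
      (hasCompactSupport_apply hc.2 i))

theorem expands_const_dx_test {c : ℝ → State} (hc : c ∈ Test) (i : Fin 3) :
    Expands (fun _ => dx c i) fun _ => 0 :=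
  Expands.const (contDiff_dx hc.1 i).continuous
    (exists_bound_of_hasCompactSupport (contDiff_dx hc.1 i).continuous
      (hasCompactSupport_dx hc.1 hc.2.deriv i))

theorem expands_tailDensity (hΩ : IsOpen Ω) {w : State → State}
    (hw : ∀ i, ContDiffOn ℝ ∞ (fun p => w p i) Ω) {u X c : ℝ → State} (hu : u ∈ Fields Ω)
    (hX : X ∈ Test) (hc : c ∈ Test) :
    Expands (fun ε => tailDensity w (u + ε • X) c) (tailDensityVar w u X c) := by
  refine (Expands.sum Finset.univ fun j _ => ((expands_comp hΩ (hw j) hu hX).mul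
    (expands_dx hu hX j)).mul (expands_const_test hc j)).congr
    (Eventually.of_forall fun ε => rfl) ?_
  ext x
  simp only [tailDensityVar, zero_smul, add_zero, mul_zero]

theorem commonSupport_tailDensity (w : State → State) (u X : ℝ → State) {c : ℝ → State}
    (hc : c ∈ Test) :
    CommonSupport (fun ε => tailDensity w (u + ε • X) c) (tailDensityVar w u X c) := by
  obtain ⟨r, hr, hz⟩ := exists_zero_off hc.2
  exact ⟨r, hr, fun ε x hx => tailDensity_eq_zero _ _ (hz x hx), fun x hx => by
    simp [tailDensityVar, hz x hx]⟩

/-- The common compact support needed to differentiate under the integral comes from the test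
covector `a` alone. -/
theorem hasDerivAt_bracket (hΩ : IsOpen Ω) (hg : ∀ i, ContDiffOn ℝ ∞ (g i) Ω)
    (hb : ∀ i j k, ContDiffOn ℝ ∞ (b i j k) Ω) (hL : ∀ α i, ContDiffOn ℝ ∞ (fun p => L α p i) Ω)
    (hR : ∀ α i, ContDiffOn ℝ ∞ (fun p => R α p i) Ω) {u X a c : ℝ → State} (hu : u ∈ Fields Ω)
    (hX : X ∈ Test) (ha : a ∈ Test) (hc : c ∈ Test) :
    (Continuous (bracketVar g b L R u X a c) ∧ HasCompactSupport (bracketVar g b L R u X a c)) ∧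
      HasDerivAt (fun ε : ℝ => bracket (genOp g b L R) (u + ε • X) a c)
        (∫ x, bracketVar g b L R u X a c x) 0 := by
  have hE : Expands (fun ε x => ∑ i, a x i * genOp g b L R (u + ε • X) c x i)
      (bracketVar g b L R u X a c) := by
    refine (Expands.sum Finset.univ fun i _ => (expands_const_test ha i).mul
      ((((expands_comp hΩ (hg i) hu hX).mul (expands_const_dx_test hc i)).add
        (Expands.sum Finset.univ fun j _ => Expands.sum Finset.univ fun k _ =>
          ((expands_comp hΩ (hb i j k) hu hX).mul (expands_dx hu hX k)).mul
            (expands_const_test hc j))).add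
        (Expands.sum Finset.univ fun α _ => ((expands_comp hΩ (hL α i) hu hX).mul
          (expands_dx hu hX i)).mul ((expands_tailDensity hΩ (hR α) hu hX hc).dinv
            (commonSupport_tailDensity _ _ _ hc))))).congr (Eventually.of_forall fun ε => rfl) ?_
    ext x
    simp only [bracketVar, zero_smul, add_zero, mul_zero, zero_mul, zero_add]
  obtain ⟨r, hr, hz⟩ := exists_zero_off ha.2
  have hz' : ∀ x, x ∉ Icc (-r) r → bracketVar g b L R u X a c x = 0 := fun x hx => by
    simp [bracketVar, hz x hx]
  refine ⟨⟨hE.1.2, hasCompactSupport_of_zero_off hz'⟩,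
    hE.hasDerivAt_integral ⟨r, hr, fun ε x hx => ?_, hz'⟩⟩
  simp [hz x hx]

end

/-! ### The algebraic form of the Jacobi identity -/

section

variable {A : Type} [Fintype A]

/-- The value of the operator in terms of jets. -/
def hamVec (g : Fin 3 → ℝ) (b : Fin 3 → Fin 3 → Fin 3 → ℝ) (w : A → Fin 3 → ℝ) (σ : A → A)
    (ξ c c' : Fin 3 → ℝ) (C : A → ℝ) (k : Fin 3) : ℝ :=
  g k * c' k + (∑ j, ∑ l, b k j l * ξ l * c j) + ∑ α, w (σ α) k * ξ k * C α

/-- The covector paired with the vector `J c` in the derivative of `{a, b}` along `J c`. -/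
def jacCovec (b : Fin 3 → Fin 3 → Fin 3 → ℝ) (db : Fin 3 → Fin 3 → Fin 3 → Fin 3 → ℝ)
    (w : A → Fin 3 → ℝ) (dw : A → Fin 3 → Fin 3 → ℝ) (σ : A → A) (ξ a a' c c' : Fin 3 → ℝ)
    (P Q : A → ℝ) (k : Fin 3) : ℝ :=
  (∑ i, ∑ j, b j i k * (a i * c' j - c i * a' j))
    + (∑ i, ∑ j, ∑ l, (db k i j l - db l i j k) * ξ l * a i * c j)
    + ∑ α, ((∑ i, (dw α k i * ξ i * (a i * Q (σ α) - c i * P (σ α))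
          - dw α i k * ξ i * (a k * Q (σ α) - c k * P (σ α))))
        - w α k * (a' k * Q (σ α) - c' k * P (σ α))
        - w α k * (a k * (∑ l, w (σ α) l * ξ l * c l) - c k * ∑ l, w (σ α) l * ξ l * a l))

variable {Ω : Set State} {g : Fin 3 → State → ℝ} {b : Fin 3 → Fin 3 → Fin 3 → State → ℝ}
  {w : A → State → State} {σ : A → A}

/-- `jacCovec` at the point `x` for fields and test functions. -/
def jacCovecAt (b : Fin 3 → Fin 3 → Fin 3 → State → ℝ) (w : A → State → State) (σ : A → A)
    (u a c : ℝ → State) (x : ℝ) : Fin 3 → ℝ :=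
  jacCovec (fun i j k => b i j k (u x)) (fun k i j l => pd k (b i j l) (u x))
    (fun α => w α (u x)) (fun α k i => pd k (fun p => w α p i) (u x)) σ (fun i => dx u i x)
    (a x) (fun i => dx a i x) (c x) (fun i => dx c i x) (fun α => dinv (tailDensity (w α) u a) x)
    (fun α => dinv (tailDensity (w α) u c) x)

/-- The primitive which reduces the derivative of the bracket to its algebraic form. -/
def jacPrimitive (b : Fin 3 → Fin 3 → Fin 3 → State → ℝ) (w : A → State → State) (σ : A → A)
    (u X a c : ℝ → State) (x : ℝ) : ℝ :=
  (∑ i, ∑ j, ∑ k, a x i * b i j k (u x) * X x k * c x j)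
    + ∑ α, ∑ i, w α (u x) i * X x i * (a x i * dinv (tailDensity (w (σ α)) u c) x
      - c x i * dinv (tailDensity (w (σ α)) u a) x)

/-- Its derivative. -/
def jacPrimitive' (b : Fin 3 → Fin 3 → Fin 3 → State → ℝ) (w : A → State → State) (σ : A → A)
    (u X a c : ℝ → State) (x : ℝ) : ℝ :=
  (∑ i, ∑ j, ∑ k, (((dx a i x * b i j k (u x) + a x i * ∑ l, pd l (b i j k) (u x) * dx u l x)
      * X x k + a x i * b i j k (u x) * dx X k x) * c x j
      + a x i * b i j k (u x) * X x k * dx c j x))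
    + ∑ α, ∑ i, (((∑ l, pd l (fun p => w α p i) (u x) * dx u l x) * X x i
        + w α (u x) i * dx X i x) * (a x i * dinv (tailDensity (w (σ α)) u c) x
      - c x i * dinv (tailDensity (w (σ α)) u a) x)
      + w α (u x) i * X x i * ((dx a i x * dinv (tailDensity (w (σ α)) u c) x
        + a x i * tailDensity (w (σ α)) u c x) - (dx c i x * dinv (tailDensity (w (σ α)) u a) x
        + c x i * tailDensity (w (σ α)) u a x)))

theorem jacPrimitive_hasDerivAt (hΩ : IsOpen Ω) (hb : ∀ i j k, ContDiffOn ℝ ∞ (b i j k) Ω)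
    (hw : ∀ α i, ContDiffOn ℝ ∞ (fun p => w α p i) Ω) {u X a c : ℝ → State}
    (hu : u ∈ SmoothFields Ω) (hX : X ∈ Test) (ha : a ∈ Test) (hc : c ∈ Test) (x : ℝ) :
    HasDerivAt (jacPrimitive b w σ u X a c) (jacPrimitive' b w σ u X a c x) x := by
  have hbd : ∀ i j k, DifferentiableAt ℝ (b i j k) (u x) := fun i j k =>
    ((hb i j k).differentiableOn (by simp)).differentiableAt (hΩ.mem_nhds (hu.2 x))
  have hwd : ∀ α i, DifferentiableAt ℝ (fun p => w α p i) (u x) := fun α i =>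
    ((hw α i).differentiableOn (by simp)).differentiableAt (hΩ.mem_nhds (hu.2 x))
  have hD : ∀ {c : ℝ → State} (_ : c ∈ Test) (α : A), HasDerivAt (dinv (tailDensity (w α) u c))
      (tailDensity (w α) u c x) x := fun hc α =>
    hasDerivAt_dinv (tailDensity_contDiff (hw α) hu hc).continuous
      (tailDensity_hasCompactSupport _ _ hc) x
  refine HasDerivAt.add (HasDerivAt.fun_sum fun i _ => HasDerivAt.fun_sum fun j _ =>
    HasDerivAt.fun_sum fun k _ => ?_) (HasDerivAt.fun_sum fun α _ => HasDerivAt.fun_sum fun i _ => ?_)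
  · exact (((hasDerivAt_apply ha.1 i x).mul (hasDerivAt_comp_field (hbd i j k) hu.1)).mul
      (hasDerivAt_apply hX.1 k x)).mul (hasDerivAt_apply hc.1 j x)
  · exact ((hasDerivAt_comp_field (hwd α i) hu.1).mul (hasDerivAt_apply hX.1 i x)).mul
      (((hasDerivAt_apply ha.1 i x).mul (hD hc (σ α))).sub
        ((hasDerivAt_apply hc.1 i x).mul (hD ha (σ α))))

/-- For diagonal `g`, metric compatibility says that `b^{ii}` is half the gradient of `g^i` and that
`b` is skew off the diagonal. In this form it can be substituted before `ring`. -/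
theorem compat_components {g' : Fin 3 → Fin 3 → ℝ} {b : Fin 3 → Fin 3 → Fin 3 → ℝ}
    (h : ∀ i j k, (if i = j then g' k i else 0) = b i j k + b j i k) :
    (∀ i k, g' k i = 2 * b i i k) ∧
      ∀ k, b 1 0 k = -b 0 1 k ∧ b 2 0 k = -b 0 2 k ∧ b 2 1 k = -b 1 2 k := by
  refine ⟨fun i k => by
    have := h i i k
    rw [if_pos rfl] at this
    rw [this]; ring, fun k => ?_⟩
  have e1 := h 1 0 k
  have e2 := h 2 0 k
  have e3 := h 2 1 k
  simp only [Fin.reduceEq, if_false] at e1 e2 e3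
  exact ⟨by linarith, by linarith, by linarith⟩

/-- Integration by parts at the level of jets: the last sum is the total derivative of `a_i b^{ij}_k
X^k c_j`, and what remains contains no derivative of `X`. -/
theorem bracketVar_local_eq {g' : Fin 3 → Fin 3 → ℝ} {b : Fin 3 → Fin 3 → Fin 3 → ℝ}
    (h : ∀ i j k, (if i = j then g' k i else 0) = b i j k + b j i k)
    (b' : Fin 3 → Fin 3 → Fin 3 → Fin 3 → ℝ) (X X' ξ a a' c c' : Fin 3 → ℝ) :
    (∑ i, a i * ((∑ k, g' k i * X k) * c' i
      + ∑ j, ∑ k, ((∑ l, b' l i j k * X l) * ξ k + b i j k * X' k) * c j)) =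
    (∑ k, X k * ((∑ i, ∑ j, b j i k * (a i * c' j - c i * a' j))
      + ∑ i, ∑ j, ∑ l, (b' k i j l - b' l i j k) * ξ l * a i * c j))
    + ∑ i, ∑ j, ∑ k, (((a' i * b i j k + a i * ∑ l, b' l i j k * ξ l)
      * X k + a i * b i j k * X' k) * c j + a i * b i j k * X k * c' j) := by
  obtain ⟨h1, h2⟩ := compat_components h
  simp only [h1, Fin.sum_univ_three, (h2 _).1, (h2 _).2.1, (h2 _).2.2]
  ring

/-- The same for one affinor: the last sum is the total derivative of `w^i X^i (a_i Q - c_i P)`,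
where `P` and `Q` have derivatives `κ` and `θ`, respectively written below as the tail densities of
`a` and `c` with the order used in the statement. -/
theorem bracketVar_tail_eq (w : Fin 3 → ℝ) (w' : Fin 3 → Fin 3 → ℝ) (X X' ξ a a' c c' : Fin 3 → ℝ)
    (P Q θ κ : ℝ) :
    (∑ j, ((∑ k, w' k j * X k) * ξ j + w j * X' j) * a j) * Q
      - P * (∑ j, ((∑ k, w' k j * X k) * ξ j + w j * X' j) * c j) =
    (∑ k, X k * ((∑ i, (w' k i * ξ i * (a i * Q - c i * P) - w' i k * ξ i * (a k * Q - c k * P)))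
        - w k * (a' k * Q - c' k * P) - w k * (a k * θ - c k * κ)))
    + ∑ i, (((∑ l, w' l i * ξ l) * X i + w i * X' i) * (a i * Q - c i * P)
      + w i * X i * ((a' i * Q + a i * θ) - (c' i * P + c i * κ))) := by
  simp only [Fin.sum_univ_three]
  ring

theorem sum_mul_add_sum (a E : Fin 3 → ℝ) (D l : A → Fin 3 → ℝ) (q r : A → ℝ) :
    ∑ i, a i * (E i + ∑ α, (D α i * q α + l α i * r α)) =
      (∑ i, a i * E i) + ∑ α, ((∑ i, D α i * a i) * q α + (∑ i, l α i * a i) * r α) := by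
  simp only [mul_add, Finset.sum_add_distrib, Finset.mul_sum, Finset.sum_mul]
  rw [Finset.sum_comm (f := fun i α => a i * (D α i * q α)),
    Finset.sum_comm (f := fun i α => a i * (l α i * r α))]
  simp only [mul_left_comm (a _), mul_comm (a _), mul_assoc]

theorem sum_mul_add_sum_comm (X L : Fin 3 → ℝ) (T : A → Fin 3 → ℝ) (K : ℝ) (S : A → ℝ) :
    (∑ k, X k * L k) + K + ∑ α, ((∑ k, X k * T α k) + S α) =
      (∑ k, X k * (L k + ∑ α, T α k)) + (K + ∑ α, S α) := by
  simp only [mul_add, Finset.sum_add_distrib, Finset.mul_sum]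
  rw [Finset.sum_comm (f := fun k α => X k * T α k)]
  ring

/-- Varying the right factor of the tail puts `X` under `dinv`. The last sum adds the term that
moves it out again; its integral is zero by skew-symmetry of `dinv`. -/
theorem bracketVar_eq (hσ : Function.Involutive σ)
    (hgb : ∀ p ∈ Ω, ∀ i j k, (if i = j then pd k (g i) p else 0) = b i j k p + b j i k p)
    {u : ℝ → State} (hu : u ∈ SmoothFields Ω) (X a c : ℝ → State) (x : ℝ) :
    bracketVar g b (fun α => w (σ α)) w u X a c x =
      (∑ k, X x k * jacCovecAt b w σ u a c x k) + jacPrimitive' b w σ u X a c x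
      + ∑ α, (tailDensity (w (σ α)) u a x * dinv (tailDensityVar (w α) u X c) x
        + dinv (tailDensity (w (σ α)) u a) x * tailDensityVar (w α) u X c x) := by
  have hloc := bracketVar_local_eq (hgb _ (hu.2 x)) (fun l i j k => pd l (b i j k) (u x)) (X x)
    (fun k => dx X k x) (fun k => dx u k x) (a x) (fun k => dx a k x) (c x) (fun k => dx c k x)
  have htail := fun α => bracketVar_tail_eq (w α (u x)) (fun k i => pd k (fun p => w α p i) (u x))
    (X x) (fun k => dx X k x) (fun k => dx u k x) (a x) (fun k => dx a k x) (c x)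
    (fun k => dx c k x) (dinv (tailDensity (w (σ α)) u a) x) (dinv (tailDensity (w (σ α)) u c) x)
    (tailDensity (w (σ α)) u c x) (tailDensity (w (σ α)) u a x)
  have hre : ∀ F : A → ℝ, ∑ α, F (σ α) = ∑ α, F α := fun F =>
    Equiv.sum_comp (Function.Involutive.toPerm σ hσ) F
  have hL : bracketVar g b (fun α => w (σ α)) w u X a c x =
      (∑ i, a x i * ((∑ k, pd k (g i) (u x) * X x k) * dx c i x
        + ∑ j, ∑ k, ((∑ l, pd l (b i j k) (u x) * X x l) * dx u k x
          + b i j k (u x) * dx X k x) * c x j))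
      + ∑ α, (tailDensityVar (w α) u X a x * dinv (tailDensity (w (σ α)) u c) x
        - dinv (tailDensity (w (σ α)) u a) x * tailDensityVar (w α) u X c x)
      + ∑ α, (tailDensity (w (σ α)) u a x * dinv (tailDensityVar (w α) u X c) x
        + dinv (tailDensity (w (σ α)) u a) x * tailDensityVar (w α) u X c x) := by
    -- Reindexing by `σ` puts the variations of left and right factors on the same affinor, so that
    -- they combine into a skew expression in `a` and `c`.
    have h1 : ∑ α, tailDensityVar (w (σ α)) u X a x * dinv (tailDensity (w α) u c) x
        = ∑ α, tailDensityVar (w α) u X a x * dinv (tailDensity (w (σ α)) u c) x := by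
      rw [← hre]
      simp only [hσ _]
    have h2 := sum_mul_add_sum (a x) (fun i => (∑ k, pd k (g i) (u x) * X x k) * dx c i x
        + ∑ j, ∑ k, ((∑ l, pd l (b i j k) (u x) * X x l) * dx u k x
          + b i j k (u x) * dx X k x) * c x j)
      (fun α i => (∑ k, pd k (fun p => w (σ α) p i) (u x) * X x k) * dx u i x
        + w (σ α) (u x) i * dx X i x) (fun α i => w (σ α) (u x) i * dx u i x)
      (fun α => dinv (tailDensity (w α) u c) x) (fun α => dinv (tailDensityVar (w α) u X c) x)
    refine Eq.trans h2 ?_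
    rw [Finset.sum_add_distrib, add_assoc]
    refine congrArg₂ _ rfl ?_
    refine (congrArg₂ (· + ·) h1 rfl).trans ?_
    rw [← Finset.sum_add_distrib, ← Finset.sum_add_distrib]
    refine Finset.sum_congr rfl fun α _ => ?_
    change _ + tailDensity (w (σ α)) u a x * _ = _
    ring
  have htail' : ∑ α, (tailDensityVar (w α) u X a x * dinv (tailDensity (w (σ α)) u c) x
        - dinv (tailDensity (w (σ α)) u a) x * tailDensityVar (w α) u X c x) = _ :=
    Finset.sum_congr rfl fun α _ => htail α
  rw [hL, hloc, htail']
  congr 1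
  exact sum_mul_add_sum_comm _ _ _ _ _

/-- After integration the total derivative `jacPrimitive'` and the `dinv` pairs drop out, leaving a
pairing with the undifferentiated vector `X`. -/
theorem hasDerivAt_bracket_jac (hΩ : IsOpen Ω) (hg : ∀ i, ContDiffOn ℝ ∞ (g i) Ω)
    (hb : ∀ i j k, ContDiffOn ℝ ∞ (b i j k) Ω) (hw : ∀ α i, ContDiffOn ℝ ∞ (fun p => w α p i) Ω)
    (hσ : Function.Involutive σ)
    (hgb : ∀ p ∈ Ω, ∀ i j k, (if i = j then pd k (g i) p else 0) = b i j k p + b j i k p)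
    {u X a c : ℝ → State} (hu : u ∈ Fields Ω) (hX : X ∈ Test) (ha : a ∈ Test) (hc : c ∈ Test) :
    Integrable (fun x => ∑ k, X x k * jacCovecAt b w σ u a c x k) ∧
      HasDerivAt (fun ε : ℝ => bracket (genOp g b (fun α => w (σ α)) w) (u + ε • X) a c)
        (∫ x, ∑ k, X x k * jacCovecAt b w σ u a c x k) 0 := by
  obtain ⟨⟨hc1, hs1⟩, hd⟩ := hasDerivAt_bracket hΩ hg hb (fun α => hw (σ α)) hw hu hX ha hc
  have iB := hc1.integrable_of_hasCompactSupport (μ := volume) hs1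
  have hK := jacPrimitive_hasDerivAt (σ := σ) hΩ hb hw hu.1 hX ha hc
  obtain ⟨r, hr, hz⟩ := exists_zero_off hX.2
  have hK0 : HasCompactSupport (jacPrimitive b w σ u X a c) :=
    hasCompactSupport_of_zero_off (R := r) fun x hx => by simp [jacPrimitive, hz x hx]
  have hKd : jacPrimitive' b w σ u X a c = deriv (jacPrimitive b w σ u X a c) :=
    funext fun x => (hK x).deriv.symm
  have hKc : Continuous (jacPrimitive' b w σ u X a c) := by
    rw [hKd]
    refine ContDiff.continuous_deriv (n := ∞) ?_ (by simp)
    refine ContDiff.add (ContDiff.sum fun i _ => ContDiff.sum fun j _ => ContDiff.sum fun k _ =>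
      (((contDiff_apply_comp ha.1 i).mul (contDiff_comp_field (hb i j k) hu.1)).mul
        (contDiff_apply_comp hX.1 k)).mul (contDiff_apply_comp hc.1 j))
      (ContDiff.sum fun α _ => ContDiff.sum fun i _ =>
        ((contDiff_comp_field (hw α i) hu.1).mul (contDiff_apply_comp hX.1 i)).mul
          (((contDiff_apply_comp ha.1 i).mul (contDiff_tail (hw (σ α)) hu.1 hc)).sub
            ((contDiff_apply_comp hc.1 i).mul (contDiff_tail (hw (σ α)) hu.1 ha))))
  have iK : Integrable (jacPrimitive' b w σ u X a c) :=
    hKc.integrable_of_hasCompactSupport (hKd ▸ hK0.deriv)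
  have hT : ∀ α, Integrable (fun x => tailDensity (w (σ α)) u a x
        * dinv (tailDensityVar (w α) u X c) x
      + dinv (tailDensity (w (σ α)) u a) x * tailDensityVar (w α) u X c x) ∧
      ∫ x, (tailDensity (w (σ α)) u a x * dinv (tailDensityVar (w α) u X c) x
      + dinv (tailDensity (w (σ α)) u a) x * tailDensityVar (w α) u X c x) = 0 := by
    intro α
    have c1 := (tailDensity_contDiff (hw (σ α)) hu.1 ha).continuous
    have s1 := tailDensity_hasCompactSupport (w (σ α)) u ha
    have c2 := (expands_tailDensity hΩ (hw α) hu hX hc).1.2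
    obtain ⟨r₂, -, -, z₂⟩ := commonSupport_tailDensity (w α) u X hc
    have s2 := hasCompactSupport_of_zero_off z₂
    have i1 : Integrable fun x => tailDensity (w (σ α)) u a x
        * dinv (tailDensityVar (w α) u X c) x :=
      (c1.mul (continuous_dinv c2 s2)).integrable_of_hasCompactSupport s1.mul_right
    have i2 : Integrable fun x => dinv (tailDensity (w (σ α)) u a) x
        * tailDensityVar (w α) u X c x :=
      ((continuous_dinv c1 s1).mul c2).integrable_of_hasCompactSupport s2.mul_left
    refine ⟨i1.add i2, ?_⟩
    rw [integral_add i1 i2, integral_mul_dinv c1 s1 c2 s2]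
    ring
  have iT := integrable_finsetSum Finset.univ fun α _ => (hT α).1
  have key : (fun x => ∑ k, X x k * jacCovecAt b w σ u a c x k) = fun x =>
      bracketVar g b (fun α => w (σ α)) w u X a c x - jacPrimitive' b w σ u X a c x
      - ∑ α, (tailDensity (w (σ α)) u a x * dinv (tailDensityVar (w α) u X c) x
        + dinv (tailDensity (w (σ α)) u a) x * tailDensityVar (w α) u X c x) := by
    ext x
    rw [bracketVar_eq hσ hgb hu.1]
    ring
  refine ⟨key ▸ (iB.sub iK).sub iT, ?_⟩
  convert hd using 1
  rw [key]
  refine (integral_sub (iB.sub iK) iT).trans ((congrArg₂ (· - ·) (integral_sub iB iK)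
    (integral_finsetSum _ fun α _ => (hT α).1)).trans ?_)
  rw [integral_hasDerivAt_eq_zero hK hKc hK0]
  simp [(hT _).2]

theorem bracket_genOp (hg : ∀ i, ContDiffOn ℝ ∞ (g i) Ω)
    (hb : ∀ i j k, ContDiffOn ℝ ∞ (b i j k) Ω) (hw : ∀ α i, ContDiffOn ℝ ∞ (fun p => w α p i) Ω)
    {u a c : ℝ → State} (hu : u ∈ Fields Ω) (ha : a ∈ Test) (hc : c ∈ Test) :
    Integrable (fun x => ∑ i, a x i * (g i (u x) * dx c i x
        + ∑ j, ∑ k, b i j k (u x) * dx u k x * c x j)) ∧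
    bracket (genOp g b (fun α => w (σ α)) w) u a c =
      (∫ x, ∑ i, a x i * (g i (u x) * dx c i x + ∑ j, ∑ k, b i j k (u x) * dx u k x * c x j))
      + ∑ α, ∫ x, tailDensity (w (σ α)) u a x * dinv (tailDensity (w α) u c) x := by
  have i1 : Integrable fun x => ∑ i, a x i * (g i (u x) * dx c i x
      + ∑ j, ∑ k, b i j k (u x) * dx u k x * c x j) := by
    refine integrable_finsetSum _ fun i _ => Continuous.integrable_of_hasCompactSupport ?_
      (hasCompactSupport_apply ha.2 i).mul_right
    exact (contDiff_apply_comp ha.1 i).continuous.mul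
      (((contDiff_comp_field (hg i) hu.1).mul (contDiff_dx hc.1 i)).add
      (ContDiff.sum fun j _ => ContDiff.sum fun k _ =>
        ((contDiff_comp_field (hb i j k) hu.1).mul (contDiff_dx hu.1.1 k)).mul
          (contDiff_apply_comp hc.1 j))).continuous
  have i2 : ∀ α, Integrable fun x => tailDensity (w (σ α)) u a x
      * dinv (tailDensity (w α) u c) x := fun α =>
    ((tailDensity_contDiff (hw (σ α)) hu.1 ha).mul
      (contDiff_tail (hw α) hu.1 hc)).continuous.integrable_of_hasCompactSupport
      (tailDensity_hasCompactSupport _ _ ha).mul_right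
  refine ⟨i1, ?_⟩
  rw [← integral_finsetSum _ fun α _ => i2 α, ← integral_add i1
    (integrable_finsetSum _ fun α _ => i2 α)]
  refine integral_congr_ae (Eventually.of_forall fun x => ?_)
  have h := sum_mul_add_sum (a x) (fun i => g i (u x) * dx c i x
    + ∑ j, ∑ k, b i j k (u x) * dx u k x * c x j) (fun _ _ => 0)
    (fun α i => w (σ α) (u x) i * dx u i x) (fun _ => 0)
    (fun α => dinv (tailDensity (w α) u c) x)
  simp only [mul_zero, zero_add] at h
  exact h

/-- The analytic content ends here. Since `hJ` is asked for arbitrary jets and arbitrary `P, Q, S`,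
the integrals `dinv` enter as independent variables and the Jacobi identity holds already for the
integrands. -/
theorem genOp_isHamiltonian (hΩ : IsOpen Ω) (hg : ∀ i, ContDiffOn ℝ ∞ (g i) Ω)
    (hb : ∀ i j k, ContDiffOn ℝ ∞ (b i j k) Ω) (hw : ∀ α i, ContDiffOn ℝ ∞ (fun p => w α p i) Ω)
    (hσ : Function.Involutive σ)
    (hgb : ∀ p ∈ Ω, ∀ i j k, (if i = j then pd k (g i) p else 0) = b i j k p + b j i k p)
    (hJ : ∀ p ∈ Ω, ∀ (ξ a a' c c' e e' : Fin 3 → ℝ) (P Q S : A → ℝ),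
      let J := hamVec (fun i => g i p) (fun i j k => b i j k p) (fun α => w α p) σ ξ
      let Z := jacCovec (fun i j k => b i j k p) (fun k i j l => pd k (b i j l) p)
        (fun α => w α p) (fun α k i => pd k (fun p => w α p i) p) σ ξ
      (∑ k, J e e' S k * Z a a' c c' P Q k) + (∑ k, J a a' P k * Z c c' e e' Q S k)
        + (∑ k, J c c' Q k * Z e e' a a' S P k) = 0) :
    IsHamiltonian Ω (genOp g b (fun α => w (σ α)) w) := by
  intro u hu
  have hT : ∀ c ∈ Test, genOp g b (fun α => w (σ α)) w u c ∈ Test := fun c hc =>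
    genOp_mem_test hg hb (fun α => hw (σ α)) hw hu hc
  refine ⟨hT, fun a ha c hc => ?_, fun a ha c hc e he => ?_⟩
  · obtain ⟨i1, e1⟩ := bracket_genOp (σ := σ) hg hb hw hu ha hc
    obtain ⟨i2, e2⟩ := bracket_genOp (σ := σ) hg hb hw hu hc ha
    -- Skew-symmetry of the tail: `dinv` gives the sign, and the involution exchanges left and right
    -- factors.
    have hre : ∑ α, ∫ x, tailDensity (w (σ α)) u a x * dinv (tailDensity (w α) u c) x
        = -∑ α, ∫ x, tailDensity (w (σ α)) u c x * dinv (tailDensity (w α) u a) x := by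
      rw [← Equiv.sum_comp (Function.Involutive.toPerm σ hσ), ← Finset.sum_neg_distrib]
      refine Finset.sum_congr rfl fun α _ => ?_
      simp only [Function.Involutive.coe_toPerm, hσ α]
      rw [integral_mul_dinv (tailDensity_contDiff (hw α) hu.1 ha).continuous
        (tailDensity_hasCompactSupport _ _ ha) (tailDensity_contDiff (hw (σ α)) hu.1 hc).continuous
        (tailDensity_hasCompactSupport _ _ hc)]
      simp only [mul_comm]
    -- Skew-symmetry of the local part: by `hgb` the symmetrized integrand is the derivative of `∑
    -- a_i g^i c_i`.
    have hd : ∀ x, HasDerivAt (fun x => ∑ i, a x i * g i (u x) * c x i)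
        ((∑ i, a x i * (g i (u x) * dx c i x + ∑ j, ∑ k, b i j k (u x) * dx u k x * c x j))
        + ∑ i, c x i * (g i (u x) * dx a i x + ∑ j, ∑ k, b i j k (u x) * dx u k x * a x j)) x := by
      intro x
      have hgd : ∀ i, DifferentiableAt ℝ (g i) (u x) := fun i =>
        ((hg i).differentiableOn (by simp)).differentiableAt (hΩ.mem_nhds (hu.1.2 x))
      have h := HasDerivAt.fun_sum (u := Finset.univ) fun i _ => ((hasDerivAt_apply ha.1 i x).mul
        (hasDerivAt_comp_field (hgd i) hu.1.1)).mul (hasDerivAt_apply hc.1 i x)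
      refine h.congr_deriv ?_
      have hgb' := hgb _ (hu.1.2 x)
      obtain ⟨h1, h2⟩ := compat_components (g' := fun k i => pd k (g i) (u x)) hgb'
      simp only [Pi.mul_apply, h1, Fin.sum_univ_three, (h2 _).1, (h2 _).2.1, (h2 _).2.2]
      ring
    have hz := integral_eq_zero_of_hasDerivAt_of_integrable hd (i1.add i2) ?_
    · rw [integral_add i1 i2] at hz
      rw [e1, e2, hre]
      linarith
    · refine integrable_finsetSum _ fun i _ => Continuous.integrable_of_hasCompactSupport ?_
        (hasCompactSupport_apply hc.2 i).mul_left
      exact (((contDiff_apply_comp ha.1 i).mul (contDiff_comp_field (hg i) hu.1)).mul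
        (contDiff_apply_comp hc.1 i)).continuous
  · obtain ⟨i1, d1⟩ := hasDerivAt_bracket_jac hΩ hg hb hw hσ hgb hu (hT e he) ha hc
    obtain ⟨i2, d2⟩ := hasDerivAt_bracket_jac hΩ hg hb hw hσ hgb hu (hT a ha) hc he
    obtain ⟨i3, d3⟩ := hasDerivAt_bracket_jac hΩ hg hb hw hσ hgb hu (hT c hc) he ha
    refine ⟨_, _, _, d1, d2, d3, ?_⟩
    rw [← integral_add i1 i2]
    refine (integral_add (i1.add i2) i3).symm.trans ?_
    refine (integral_congr_ae (Eventually.of_forall fun x => ?_)).trans (integral_zero ℝ ℝ)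
    exact hJ (u x) (hu.1.2 x) _ _ _ _ _ _ _ _ _ _

end

/-! ### The Jacobi identity from the Gauss and Codazzi equations -/

section

variable {A : Type} [Fintype A]

/-- The leading and the first nonlocal part of `jacCovec` in terms of the connection. -/
theorem jacCovec_eq {g : Fin 3 → ℝ} {b Γ : Fin 3 → Fin 3 → Fin 3 → ℝ}
    {db : Fin 3 → Fin 3 → Fin 3 → Fin 3 → ℝ} {w : A → Fin 3 → ℝ} {dw : A → Fin 3 → Fin 3 → ℝ}
    {σ : A → A} (hσ : Function.Involutive σ) (hb : ∀ i j k, b i j k = -(g i * Γ j i k))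
    (hG : ∀ k l i m, (∑ j, (b j i k * Γ m j l - b j m k * Γ i j l)) + db k i m l - db l i m k
      = ∑ α, w α k * w (σ α) l
        * ((if k = i ∧ l = m then 1 else 0) - (if k = m ∧ l = i then 1 else 0)))
    (hC : ∀ α k l i, (if i = l then dw α k i else 0) + Γ i k l * w α l
      = (if i = k then dw α l i else 0) + Γ i k l * w α k)
    (hsym : ∀ i j k, Γ i j k = Γ i k j)
    (ξ a a' c c' : Fin 3 → ℝ) (P Q : A → ℝ) (k : Fin 3) :
    jacCovec b db w dw σ ξ a a' c c' P Q k =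
      -(∑ i, ∑ j, Γ i j k * (a i * hamVec g b w σ ξ c c' Q j - c i * hamVec g b w σ ξ a a' P j))
      - ((a' k - ∑ i, ∑ l, Γ i k l * ξ l * a i) * ∑ α, w (σ α) k * Q α)
      + ((c' k - ∑ i, ∑ l, Γ i k l * ξ l * c i) * ∑ α, w (σ α) k * P α) := by
  have hre : ∀ F : A → ℝ, ∑ α, F (σ α) = ∑ α, F α := fun F =>
    Equiv.sum_comp (Function.Involutive.toPerm σ hσ) F
  -- The terms `g c'` and `g a'` are completed to the local part of the operator; the correction is
  -- exactly the Gauss expression.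
  have hloc : (∑ i, ∑ j, b j i k * (a i * c' j - c i * a' j))
      + (∑ i, ∑ j, ∑ l, (db k i j l - db l i j k) * ξ l * a i * c j)
      = -(∑ i, ∑ j, Γ i j k * (a i * (g j * c' j + ∑ n, ∑ l, b j n l * ξ l * c n)
        - c i * (g j * a' j + ∑ n, ∑ l, b j n l * ξ l * a n)))
      + ∑ i, ∑ m, ∑ l, ((∑ j, (b j i k * Γ m j l - b j m k * Γ i j l)) + db k i m l - db l i m k)
        * (ξ l * a i * c m) := by
    simp only [hb, Fin.sum_univ_three]
    ring
  have hcurv : ∑ i, ∑ m, ∑ l, ((∑ j, (b j i k * Γ m j l - b j m k * Γ i j l)) + db k i m l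
      - db l i m k) * (ξ l * a i * c m)
      = ∑ α, w α k * (a k * (∑ l, w (σ α) l * ξ l * c l) - c k * ∑ l, w (σ α) l * ξ l * a l) := by
    simp only [hG, Finset.sum_mul]
    rw [Finset.sum_congr rfl fun i _ => Finset.sum_congr rfl fun m _ => Finset.sum_comm,
      Finset.sum_congr rfl fun i _ => Finset.sum_comm, Finset.sum_comm]
    refine Finset.sum_congr rfl fun α _ => ?_
    simp only [Fin.sum_univ_three]
    fin_cases k <;> simp <;> ring
  have htail : ∀ α, (∑ i, (dw α k i * ξ i * (a i * Q (σ α) - c i * P (σ α))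
          - dw α i k * ξ i * (a k * Q (σ α) - c k * P (σ α))))
        - w α k * (a' k * Q (σ α) - c' k * P (σ α))
      = -(∑ i, ∑ j, Γ i j k * (a i * (w α j * ξ j * Q (σ α)) - c i * (w α j * ξ j * P (σ α))))
        - ((a' k - ∑ i, ∑ l, Γ i k l * ξ l * a i) * (w α k * Q (σ α)))
        + ((c' k - ∑ i, ∑ l, Γ i k l * ξ l * c i) * (w α k * P (σ α))) := by
    intro α
    have h1 : ∀ e : Fin 3 → ℝ, ∑ i, ∑ l, ((if i = l then dw α k i else 0) + Γ i k l * w α l)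
        * (ξ l * e i) = ∑ i, ∑ l, ((if i = k then dw α l i else 0) + Γ i k l * w α k)
        * (ξ l * e i) := fun e => by simp only [hC]
    -- The Codazzi equation, contracted with `ξ` and `e`, trades the derivatives of the affinor for
    -- connection terms.
    have h2 : ∀ e : Fin 3 → ℝ, (∑ i, (dw α k i * ξ i * e i - dw α i k * ξ i * e k))
        = ∑ i, ∑ l, Γ i k l * (w α k - w α l) * ξ l * e i := by
      intro e
      have := h1 e
      simp only [Fin.sum_univ_three] at this ⊢
      fin_cases k <;> simp at this ⊢ <;> linarith
    have ha := h2 a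
    have hc := h2 c
    simp only [hsym _ _ k]
    simp only [Fin.sum_univ_three] at ha hc ⊢
    linear_combination (Q (σ α)) * ha - P (σ α) * hc
  -- Covariant derivatives of `a` and `c` along `u_x`.
  set na := a' k - ∑ i, ∑ l, Γ i k l * ξ l * a i
  set nc := c' k - ∑ i, ∑ l, Γ i k l * ξ l * c i
  have hW : ∀ (Q : A → ℝ) j, ∑ α, w α j * Q (σ α) = ∑ α, w (σ α) j * Q α := fun Q j => by
    rw [← hre]
    simp only [hσ _]
  -- Each summand is linear in the numbers `w α j * Q (σ α)` and `w α j * P (σ α)` with coefficients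
  -- free of `α`, so the sum over `α` can be taken inside and reindexed by `σ`.
  have hlin : ∀ α, (∑ i, (dw α k i * ξ i * (a i * Q (σ α) - c i * P (σ α))
          - dw α i k * ξ i * (a k * Q (σ α) - c k * P (σ α))))
        - w α k * (a' k * Q (σ α) - c' k * P (σ α))
      = (∑ j, (-((∑ i, Γ i j k * a i) * ξ j) - if j = k then na else 0) * (w α j * Q (σ α)))
        + ∑ j, ((∑ i, Γ i j k * c i) * ξ j + if j = k then nc else 0) * (w α j * P (σ α)) := by
    intro α
    rw [htail α]
    clear_value na nc
    simp only [Fin.sum_univ_three]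
    fin_cases k <;> simp <;> ring
  have hsum : ∑ α, ((∑ i, (dw α k i * ξ i * (a i * Q (σ α) - c i * P (σ α))
          - dw α i k * ξ i * (a k * Q (σ α) - c k * P (σ α))))
        - w α k * (a' k * Q (σ α) - c' k * P (σ α)))
      = (∑ j, (-((∑ i, Γ i j k * a i) * ξ j) - if j = k then na else 0) * ∑ α, w (σ α) j * Q α)
        + ∑ j, ((∑ i, Γ i j k * c i) * ξ j + if j = k then nc else 0)
          * ∑ α, w (σ α) j * P α := by
    simp only [hlin, Finset.sum_add_distrib, ← hW, Finset.mul_sum]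
    rw [Finset.sum_comm, Finset.sum_comm (s := (Finset.univ : Finset A))]
  have hv : ∀ (a a' : Fin 3 → ℝ) (Q : A → ℝ) j, hamVec g b w σ ξ a a' Q j
      = (g j * a' j + ∑ n, ∑ l, b j n l * ξ l * a n) + ξ j * ∑ α, w (σ α) j * Q α := by
    intro a a' Q j
    rw [Finset.mul_sum]
    exact congrArg _ (Finset.sum_congr rfl fun α _ => by ring)
  unfold jacCovec
  rw [hloc, hcurv, Finset.sum_sub_distrib, hsum]
  simp only [hv]
  clear_value na nc
  clear hlin hsum htail hcurv hloc
  generalize hD : (fun j => g j * a' j + ∑ n, ∑ l, b j n l * ξ l * a n) = D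
  generalize hD' : (fun j => g j * c' j + ∑ n, ∑ l, b j n l * ξ l * c n) = D'
  simp only [fun j => congrFun hD j, fun j => congrFun hD' j]
  simp only [Fin.sum_univ_three]
  fin_cases k <;> simp <;> ring

/-- By `jacCovec_eq` the cyclic sum splits into connection terms and products of covariant
derivatives with nonlocal terms; each group vanishes separately. -/
theorem jacobi_of_connection {g : Fin 3 → ℝ} {b Γ : Fin 3 → Fin 3 → Fin 3 → ℝ}
    {db : Fin 3 → Fin 3 → Fin 3 → Fin 3 → ℝ} {w : A → Fin 3 → ℝ} {dw : A → Fin 3 → Fin 3 → ℝ}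
    {σ : A → A} (hσ : Function.Involutive σ) (hb : ∀ i j k, b i j k = -(g i * Γ j i k))
    (hG : ∀ k l i m, (∑ j, (b j i k * Γ m j l - b j m k * Γ i j l)) + db k i m l - db l i m k
      = ∑ α, w α k * w (σ α) l
        * ((if k = i ∧ l = m then 1 else 0) - (if k = m ∧ l = i then 1 else 0)))
    (hC : ∀ α k l i, (if i = l then dw α k i else 0) + Γ i k l * w α l
      = (if i = k then dw α l i else 0) + Γ i k l * w α k)
    (hsym : ∀ i j k, Γ i j k = Γ i k j)
    (ξ a a' c c' e e' : Fin 3 → ℝ) (P Q S : A → ℝ) :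
    (∑ k, hamVec g b w σ ξ e e' S k * jacCovec b db w dw σ ξ a a' c c' P Q k)
      + (∑ k, hamVec g b w σ ξ a a' P k * jacCovec b db w dw σ ξ c c' e e' Q S k)
      + (∑ k, hamVec g b w σ ξ c c' Q k * jacCovec b db w dw σ ξ e e' a a' S P k) = 0 := by
  have hX : ∀ (a a' : Fin 3 → ℝ) (P : A → ℝ) k, hamVec g b w σ ξ a a' P k
      = g k * (a' k - ∑ i, ∑ l, Γ i k l * ξ l * a i) + ξ k * ∑ α, w (σ α) k * P α := by
    intro a a' P k
    unfold hamVec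
    rw [Finset.mul_sum]
    congr 1
    · simp only [hb, Fin.sum_univ_three]; ring
    · exact Finset.sum_congr rfl fun α _ => by ring
  simp only [jacCovec_eq hσ hb hG hC hsym]
  -- Only the symmetry of the lower indices is used: each product occurs twice with opposite signs.
  have hΓ : ∀ X Y Z : Fin 3 → ℝ, (∑ k, X k * (∑ i, ∑ j, Γ i j k * (a i * Y j - c i * Z j)))
      + (∑ k, Z k * (∑ i, ∑ j, Γ i j k * (c i * X j - e i * Y j)))
      + (∑ k, Y k * (∑ i, ∑ j, Γ i j k * (e i * Z j - a i * X j))) = 0 := by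
    intro X Y Z
    simp only [Fin.sum_univ_three, hsym _ 1 0, hsym _ 2 0, hsym _ 2 1]
    ring
  have h := hΓ (hamVec g b w σ ξ e e' S) (hamVec g b w σ ξ c c' Q) (hamVec g b w σ ξ a a' P)
  -- For fixed `k` this is, up to sign, the determinant with columns `J`, covariant derivative,
  -- nonlocal sum. By `hX` the first column is a combination of the other two, with coefficients `g
  -- k` and `ξ k`.
  have ht : ∀ k, hamVec g b w σ ξ e e' S k *
      (-((a' k - ∑ i, ∑ l, Γ i k l * ξ l * a i) * ∑ α, w (σ α) k * Q α)
      + ((c' k - ∑ i, ∑ l, Γ i k l * ξ l * c i) * ∑ α, w (σ α) k * P α))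
      + hamVec g b w σ ξ a a' P k *
      (-((c' k - ∑ i, ∑ l, Γ i k l * ξ l * c i) * ∑ α, w (σ α) k * S α)
      + ((e' k - ∑ i, ∑ l, Γ i k l * ξ l * e i) * ∑ α, w (σ α) k * Q α))
      + hamVec g b w σ ξ c c' Q k *
      (-((e' k - ∑ i, ∑ l, Γ i k l * ξ l * e i) * ∑ α, w (σ α) k * P α)
      + ((a' k - ∑ i, ∑ l, Γ i k l * ξ l * a i) * ∑ α, w (σ α) k * S α)) = 0 := by
    intro k
    rw [hX, hX, hX]
    ring
  rw [← Finset.sum_add_distrib, ← Finset.sum_add_distrib]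
  rw [← Finset.sum_add_distrib, ← Finset.sum_add_distrib] at h
  rw [← neg_zero, ← h, ← Finset.sum_neg_distrib]
  refine Finset.sum_congr rfl fun k _ => ?_
  linear_combination ht k

end

/-! ### Jets of the transformed operator -/

theorem prodDiff_zero (p : State) : prodDiff p 0 = (p 0 - p 1) * (p 0 - p 2) := rfl
theorem prodDiff_one (p : State) : prodDiff p 1 = (p 1 - p 2) * (p 1 - p 0) := rfl
theorem prodDiff_two (p : State) : prodDiff p 2 = (p 2 - p 0) * (p 2 - p 1) := rfl
theorem eta_zero (p : State) : eta p 0 = p 1 + p 2 := rfl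
theorem eta_one (p : State) : eta p 1 = p 2 + p 0 := rfl
theorem eta_two (p : State) : eta p 2 = p 0 + p 1 := rfl

/-- Kronecker's symbol. -/
def kron (i j : Fin 3) : ℝ := if i = j then 1 else 0

/-- The coefficients `b^{ij}_k` for the values `φ`, `φ₁` of the functions and their derivatives. -/
def jetB (p φ φ₁ : State) (i j k : Fin 3) : ℝ :=
  if i = j then prodDiff p i ^ 2 * ((1 / 2) * φ₁ i * kron k i
    + φ i * ((kron k i - kron k (i + 1)) / (p i - p (i + 1))
      + (kron k i - kron k (i + 2)) / (p i - p (i + 2))))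
  else (kron k i * (prodDiff p j ^ 2 * φ j) + kron k j * (prodDiff p i ^ 2 * φ i)) / (p i - p j)

/-- `∂_k b^{ij}_l`, up to terms symmetric in `k`, `l`. -/
def jetDB (p φ φ₁ : State) (k i j l : Fin 3) : ℝ :=
  if i = j then 0
  else (kron l i * (2 * jetB p φ φ₁ j j k) + kron l j * (2 * jetB p φ φ₁ i i k)) / (p i - p j)
    - (kron l i * (prodDiff p j ^ 2 * φ j) + kron l j * (prodDiff p i ^ 2 * φ i))
      * (kron k i - kron k j) / (p i - p j) ^ 2

def jetMu (p φ φ₁ Φ : State) : State := fun i =>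
  -(1 / 2) * prodDiff p i * φ₁ i - eta p i * ((1 / 2) * ∑ j, φ j) - ∑ j, (-(p j * φ j) + Φ j)

def jetLam (p φ φ₁ Φ : State) : State := fun i =>
  prodDiff p i * (2 * φ i + p i * φ₁ i) - eta p i * (∑ j, (-(p j * φ j) - Φ j))
    - 2 * ∑ j, p j ^ 2 * φ j

/-- The four affinors `1, η, μ, λ`. -/
def jetW (p φ φ₁ Φ : State) : Fin 4 → State :=
  ![fun _ => 1, eta p, jetMu p φ φ₁ Φ, jetLam p φ φ₁ Φ]

/-- `∂_k w^i` for `k ≠ i`. -/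
def jetDW (p φ φ₁ Φ : State) (α : Fin 4) (k i : Fin 3) : ℝ :=
  (jetW p φ φ₁ Φ α k - jetW p φ φ₁ Φ α i) / (p i - p k)

/-- Christoffel symbols `Γ^j_{ik}` of the transformed metric. -/
def jetGamma (p φ φ₁ : State) (j i k : Fin 3) : ℝ :=
  -(jetB p φ φ₁ i j k / (prodDiff p i ^ 2 * φ i))

variable {p φ φ₁ : State}

theorem sub_ne_zero_of_injective (hp : Function.Injective p) {i j : Fin 3} (h : i ≠ j) :
    p i - p j ≠ 0 := sub_ne_zero.2 fun e => h (hp e)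

theorem prodDiff_ne_zero (hp : Function.Injective p) (i : Fin 3) : prodDiff p i ≠ 0 :=
  mul_ne_zero (sub_ne_zero_of_injective hp (by fin_cases i <;> decide))
    (sub_ne_zero_of_injective hp (by fin_cases i <;> decide))

theorem jetB_eq (hp : Function.Injective p) (hφ : ∀ i, φ i ≠ 0) (i j k : Fin 3) :
    jetB p φ φ₁ i j k = -((prodDiff p i ^ 2 * φ i) * jetGamma p φ φ₁ j i k) := by
  have := prodDiff_ne_zero hp i
  have := hφ i
  unfold jetGamma
  field_simp

theorem jetGamma_symm (hp : Function.Injective p) (hφ : ∀ i, φ i ≠ 0) (j i k : Fin 3) :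
    jetGamma p φ φ₁ j i k = jetGamma p φ φ₁ j k i := by
  have h01 : p 0 - p 1 ≠ 0 := sub_ne_zero_of_injective hp (by decide)
  have h02 : p 0 - p 2 ≠ 0 := sub_ne_zero_of_injective hp (by decide)
  have h12 : p 1 - p 2 ≠ 0 := sub_ne_zero_of_injective hp (by decide)
  have h10 : p 1 - p 0 ≠ 0 := sub_ne_zero_of_injective hp (by decide)
  have h20 : p 2 - p 0 ≠ 0 := sub_ne_zero_of_injective hp (by decide)
  have h21 : p 2 - p 1 ≠ 0 := sub_ne_zero_of_injective hp (by decide)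
  have f0 := hφ 0
  have f1 := hφ 1
  have f2 := hφ 2
  fin_cases i <;> fin_cases j <;> fin_cases k <;>
    simp [jetGamma, jetB, kron, prodDiff_zero, prodDiff_one, prodDiff_two] <;>
    field_simp <;> ring

/-- Off the diagonal `Γ^i_{ik} = 1/(p_i - p_k)`, so the equation is the very form of `jetDW`. The
particular affinor is irrelevant and is generalized away. -/
theorem jet_codazzi (hp : Function.Injective p) (hφ : ∀ i, φ i ≠ 0) (Φ : State) (α : Fin 4)
    (k l i : Fin 3) :
    (if i = l then jetDW p φ φ₁ Φ α k i else 0) + jetGamma p φ φ₁ i k l * jetW p φ φ₁ Φ α l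
      = (if i = k then jetDW p φ φ₁ Φ α l i else 0)
        + jetGamma p φ φ₁ i k l * jetW p φ φ₁ Φ α k := by
  have h01 : p 0 - p 1 ≠ 0 := sub_ne_zero_of_injective hp (by decide)
  have h02 : p 0 - p 2 ≠ 0 := sub_ne_zero_of_injective hp (by decide)
  have h12 : p 1 - p 2 ≠ 0 := sub_ne_zero_of_injective hp (by decide)
  have h10 : p 1 - p 0 ≠ 0 := sub_ne_zero_of_injective hp (by decide)
  have h20 : p 2 - p 0 ≠ 0 := sub_ne_zero_of_injective hp (by decide)
  have h21 : p 2 - p 1 ≠ 0 := sub_ne_zero_of_injective hp (by decide)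
  have f0 := hφ 0
  have f1 := hφ 1
  have f2 := hφ 2
  unfold jetDW
  generalize jetW p φ φ₁ Φ α = w
  fin_cases i <;> fin_cases l <;> fin_cases k <;>
    simp [jetGamma, jetB, kron, prodDiff_zero, prodDiff_one, prodDiff_two] <;>
    field_simp <;> ring

/-- Both sides are skew in `(k, l)` and in `(i, m)`, so nine ordered cases suffice; each is a
rational identity. -/
theorem jet_gauss_aux (hp : Function.Injective p) (hφ : ∀ i, φ i ≠ 0) (Φ : State)
    {k l i m : Fin 3} (hkl : k < l) (him : i < m) :
    (∑ j, (jetB p φ φ₁ j i k * jetGamma p φ φ₁ m j l - jetB p φ φ₁ j m k * jetGamma p φ φ₁ i j l))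
        + jetDB p φ φ₁ k i m l - jetDB p φ φ₁ l i m k
      = ∑ α, jetW p φ φ₁ Φ α k * jetW p φ φ₁ Φ (Fin.rev α) l
        * ((if k = i ∧ l = m then 1 else 0) - (if k = m ∧ l = i then 1 else 0)) := by
  have h01 : p 0 - p 1 ≠ 0 := sub_ne_zero_of_injective hp (by decide)
  have h02 : p 0 - p 2 ≠ 0 := sub_ne_zero_of_injective hp (by decide)
  have h12 : p 1 - p 2 ≠ 0 := sub_ne_zero_of_injective hp (by decide)
  have h10 : p 1 - p 0 ≠ 0 := sub_ne_zero_of_injective hp (by decide)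
  have h20 : p 2 - p 0 ≠ 0 := sub_ne_zero_of_injective hp (by decide)
  have h21 : p 2 - p 1 ≠ 0 := sub_ne_zero_of_injective hp (by decide)
  have f0 := hφ 0
  have f1 := hφ 1
  have f2 := hφ 2
  have hlt : ∀ {k l : Fin 3}, k < l → (k = 0 ∧ l = 1) ∨ (k = 0 ∧ l = 2) ∨ (k = 1 ∧ l = 2) := by
    decide
  rcases hlt hkl with ⟨rfl, rfl⟩ | ⟨rfl, rfl⟩ | ⟨rfl, rfl⟩ <;>
    rcases hlt him with ⟨rfl, rfl⟩ | ⟨rfl, rfl⟩ | ⟨rfl, rfl⟩ <;>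
    simp [jetGamma, jetB, jetDB, kron, prodDiff_zero, prodDiff_one, prodDiff_two,
      Fin.sum_univ_three, Fin.sum_univ_four, jetW, jetMu, jetLam, eta_zero, eta_one, eta_two,
      Fin.rev] <;>
    field_simp <;> ring

theorem jet_gauss (hp : Function.Injective p) (hφ : ∀ i, φ i ≠ 0) (Φ : State) (k l i m : Fin 3) :
    (∑ j, (jetB p φ φ₁ j i k * jetGamma p φ φ₁ m j l - jetB p φ φ₁ j m k * jetGamma p φ φ₁ i j l))
        + jetDB p φ φ₁ k i m l - jetDB p φ φ₁ l i m k
      = ∑ α, jetW p φ φ₁ Φ α k * jetW p φ φ₁ Φ (Fin.rev α) l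
        * ((if k = i ∧ l = m then 1 else 0) - (if k = m ∧ l = i then 1 else 0)) := by
  have hre : ∀ k l (t : ℝ), ∑ α, jetW p φ φ₁ Φ α k * jetW p φ φ₁ Φ (Fin.rev α) l * t
      = ∑ α, jetW p φ φ₁ Φ α l * jetW p φ φ₁ Φ (Fin.rev α) k * t := fun k l t => by
    rw [← Equiv.sum_comp Fin.revPerm]
    exact Finset.sum_congr rfl fun α _ => by simp only [Fin.revPerm_apply, Fin.rev_rev]; ring
  -- Exchange of `k` and `l`: the right side is handled by reindexing with `Fin.rev`, the quadratic
  -- terms by writing `b` as `-gΓ`.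
  have hflip : ∀ {k l i m : Fin 3}, ((∑ j, (jetB p φ φ₁ j i k * jetGamma p φ φ₁ m j l
        - jetB p φ φ₁ j m k * jetGamma p φ φ₁ i j l))
        + jetDB p φ φ₁ k i m l - jetDB p φ φ₁ l i m k
      = ∑ α, jetW p φ φ₁ Φ α k * jetW p φ φ₁ Φ (Fin.rev α) l
        * ((if k = i ∧ l = m then 1 else 0) - (if k = m ∧ l = i then 1 else 0))) →
      ((∑ j, (jetB p φ φ₁ j i l * jetGamma p φ φ₁ m j k
        - jetB p φ φ₁ j m l * jetGamma p φ φ₁ i j k))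
        + jetDB p φ φ₁ l i m k - jetDB p φ φ₁ k i m l
      = ∑ α, jetW p φ φ₁ Φ α l * jetW p φ φ₁ Φ (Fin.rev α) k
        * ((if l = i ∧ k = m then 1 else 0) - (if l = m ∧ k = i then 1 else 0))) := by
    intro k l i m h
    rw [hre l k, if_congr (Q := k = m ∧ l = i) and_comm rfl rfl,
      if_congr (P := l = m ∧ k = i) (Q := k = i ∧ l = m) and_comm rfl rfl]
    rw [← neg_inj, ← Finset.sum_neg_distrib] at h
    simp only [← mul_neg, neg_sub] at h
    rw [← h]
    simp only [jetB_eq hp hφ, Fin.sum_univ_three]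
    ring
  have hdb : ∀ k i m l, jetDB p φ φ₁ k m i l = -jetDB p φ φ₁ k i m l := by
    intro k i m l
    unfold jetDB
    rcases eq_or_ne i m with rfl | him
    · simp
    · have h1 := sub_ne_zero_of_injective hp him
      have h2 := sub_ne_zero_of_injective hp him.symm
      rw [if_neg him, if_neg him.symm, ← neg_sub (p i) (p m)]
      field_simp
      ring
  -- Exchange of `i` and `m`, using the skewness `hdb` of the derivative terms.
  have hflip' : ∀ {k l i m : Fin 3}, ((∑ j, (jetB p φ φ₁ j i k * jetGamma p φ φ₁ m j l
        - jetB p φ φ₁ j m k * jetGamma p φ φ₁ i j l))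
        + jetDB p φ φ₁ k i m l - jetDB p φ φ₁ l i m k
      = ∑ α, jetW p φ φ₁ Φ α k * jetW p φ φ₁ Φ (Fin.rev α) l
        * ((if k = i ∧ l = m then 1 else 0) - (if k = m ∧ l = i then 1 else 0))) →
      ((∑ j, (jetB p φ φ₁ j m k * jetGamma p φ φ₁ i j l
        - jetB p φ φ₁ j i k * jetGamma p φ φ₁ m j l))
        + jetDB p φ φ₁ k m i l - jetDB p φ φ₁ l m i k
      = ∑ α, jetW p φ φ₁ Φ α k * jetW p φ φ₁ Φ (Fin.rev α) l
        * ((if k = m ∧ l = i then 1 else 0) - (if k = i ∧ l = m then 1 else 0))) := by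
    intro k l i m h
    rw [← neg_inj, ← Finset.sum_neg_distrib] at h
    simp only [← mul_neg, neg_sub] at h
    rw [← h, hdb k i m l, hdb l i m k]
    simp only [Fin.sum_univ_three]
    ring
  have hdiag : ∀ {k l : Fin 3}, k = l → ∀ i m, (∑ j, (jetB p φ φ₁ j i k * jetGamma p φ φ₁ m j l
        - jetB p φ φ₁ j m k * jetGamma p φ φ₁ i j l))
        + jetDB p φ φ₁ k i m l - jetDB p φ φ₁ l i m k
      = ∑ α, jetW p φ φ₁ Φ α k * jetW p φ φ₁ Φ (Fin.rev α) l
        * ((if k = i ∧ l = m then 1 else 0) - (if k = m ∧ l = i then 1 else 0)) := by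
    rintro k _ rfl i m
    rw [if_congr (Q := k = m ∧ k = i) and_comm rfl rfl]
    simp only [jetB_eq hp hφ, Fin.sum_univ_three]
    simp
    ring
  rcases lt_trichotomy i m with him | rfl | him
  · rcases lt_trichotomy k l with hkl | hkl | hkl
    · exact jet_gauss_aux hp hφ Φ hkl him
    · exact hdiag hkl i m
    · exact hflip (jet_gauss_aux hp hφ Φ hkl him)
  · simp [jetDB]
  · rcases lt_trichotomy k l with hkl | hkl | hkl
    · exact hflip' (jet_gauss_aux hp hφ Φ hkl him)
    · exact hdiag hkl i m
    · exact hflip' (hflip (jet_gauss_aux hp hφ Φ hkl him))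

/-- The algebraic Jacobi identity for arbitrary values of the functions. -/
theorem jet_jacobi (hp : Function.Injective p) (φ φ₁ Φ : State)
    (ξ a a' c c' e e' : Fin 3 → ℝ) (P Q S : Fin 4 → ℝ) :
    let J := hamVec (fun i => prodDiff p i ^ 2 * φ i) (jetB p φ φ₁) (jetW p φ φ₁ Φ) Fin.rev ξ
    let Z := jacCovec (jetB p φ φ₁) (jetDB p φ φ₁) (jetW p φ φ₁ Φ) (jetDW p φ φ₁ Φ) Fin.rev ξ
    (∑ k, J e e' S k * Z a a' c c' P Q k) + (∑ k, J a a' P k * Z c c' e e' Q S k)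
      + (∑ k, J c c' Q k * Z e e' a a' S P k) = 0 := by
  -- For non-zero values the connection exists and the Gauss and Codazzi equations apply.
  have hnd : ∀ φ : State, (∀ i, φ i ≠ 0) →
      let J := hamVec (fun i => prodDiff p i ^ 2 * φ i) (jetB p φ φ₁) (jetW p φ φ₁ Φ) Fin.rev ξ
      let Z := jacCovec (jetB p φ φ₁) (jetDB p φ φ₁) (jetW p φ φ₁ Φ) (jetDW p φ φ₁ Φ) Fin.rev ξ
      (∑ k, J e e' S k * Z a a' c c' P Q k) + (∑ k, J a a' P k * Z c c' e e' Q S k)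
        + (∑ k, J c c' Q k * Z e e' a a' S P k) = 0 := fun φ hφ =>
    jacobi_of_connection (σ := Fin.rev) Fin.rev_rev (jetB_eq hp hφ) (jet_gauss hp hφ Φ)
      (fun α k l i => jet_codazzi hp hφ Φ α k l i) (jetGamma_symm hp hφ) ξ a a' c c' e e' P Q S
  have hW : ∀ α i, Continuous fun s : ℝ => jetW p (fun i => φ i + s) φ₁ Φ α i := by
    intro α i
    fin_cases α
    · exact continuous_const
    · exact continuous_const
    · change Continuous fun s : ℝ => jetMu p (fun i => φ i + s) φ₁ Φ i
      unfold jetMu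
      fun_prop
    · change Continuous fun s : ℝ => jetLam p (fun i => φ i + s) φ₁ Φ i
      unfold jetLam
      fun_prop
  have hDW : ∀ α k i, Continuous fun s : ℝ => jetDW p (fun i => φ i + s) φ₁ Φ α k i := fun α k i =>
    ((hW α k).sub (hW α i)).div_const _
  have hB : ∀ i j k, Continuous fun s : ℝ => jetB p (fun i => φ i + s) φ₁ i j k := by
    intro i j k
    unfold jetB
    split_ifs <;> fun_prop
  have hDB : ∀ k i j l, Continuous fun s : ℝ => jetDB p (fun i => φ i + s) φ₁ k i j l := by
    intro k i j l
    unfold jetDB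
    split_ifs
    · exact continuous_const
    · have h1 := hB i i k
      have h2 := hB j j k
      fun_prop
  have hH : ∀ (a a' : Fin 3 → ℝ) (P : Fin 4 → ℝ) k, Continuous fun s : ℝ =>
      hamVec (fun i => prodDiff p i ^ 2 * (φ i + s)) (jetB p (fun i => φ i + s) φ₁)
        (jetW p (fun i => φ i + s) φ₁ Φ) Fin.rev ξ a a' P k := by
    intro a a' P k
    unfold hamVec
    fun_prop
  have hZ : ∀ (a a' c c' : Fin 3 → ℝ) (P Q : Fin 4 → ℝ) k, Continuous fun s : ℝ =>
      jacCovec (jetB p (fun i => φ i + s) φ₁) (jetDB p (fun i => φ i + s) φ₁)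
        (jetW p (fun i => φ i + s) φ₁ Φ) (jetDW p (fun i => φ i + s) φ₁ Φ) Fin.rev ξ a a' c c' P Q
        k := by
    intro a a' c c' P Q k
    unfold jacCovec
    fun_prop
  have hE : Continuous fun s : ℝ =>
      let J := hamVec (fun i => prodDiff p i ^ 2 * (φ i + s)) (jetB p (fun i => φ i + s) φ₁)
        (jetW p (fun i => φ i + s) φ₁ Φ) Fin.rev ξ
      let Z := jacCovec (jetB p (fun i => φ i + s) φ₁) (jetDB p (fun i => φ i + s) φ₁)
        (jetW p (fun i => φ i + s) φ₁ Φ) (jetDW p (fun i => φ i + s) φ₁ Φ) Fin.rev ξ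
      (∑ k, J e e' S k * Z a a' c c' P Q k) + (∑ k, J a a' P k * Z c c' e e' Q S k)
        + (∑ k, J c c' Q k * Z e e' a a' S P k) :=
    ((continuous_finsetSum _ fun k _ => (hH _ _ _ k).mul (hZ _ _ _ _ _ _ k)).add
      (continuous_finsetSum _ fun k _ => (hH _ _ _ k).mul (hZ _ _ _ _ _ _ k))).add
      (continuous_finsetSum _ fun k _ => (hH _ _ _ k).mul (hZ _ _ _ _ _ _ k))
  -- The shift `φ + s` has no zero entries for small `s ≠ 0`. No expression in the identity divides
  -- by `φ`, so it is continuous in `s` and passes to the limit.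
  have hev : ∀ᶠ s in 𝓝[≠] (0 : ℝ), ∀ i, φ i + s ≠ 0 := by
    rw [eventually_all]
    intro i
    rcases eq_or_ne (φ i) 0 with h | h
    · filter_upwards [self_mem_nhdsWithin] with s hs
      simpa [h] using hs
    · exact nhdsWithin_le_nhds ((continuous_const.add continuous_id).continuousAt.eventually_ne
        (by simpa using h))
  have h1 := (hE.tendsto 0).mono_left (nhdsWithin_le_nhds (s := {0}ᶜ))
  have h2 : Tendsto (fun _ : ℝ => (0 : ℝ)) (𝓝[≠] 0) (𝓝 0) := tendsto_const_nhds
  have h3 := tendsto_nhds_unique (h1.congr' (hev.mono fun s hs => hnd _ hs)) h2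
  simpa using h3

/-! ### Gradients -/

/-- `g` is differentiable at `p` with partial derivatives `d k`. -/
def HasGrad (g : State → ℝ) (d : Fin 3 → ℝ) (p : State) : Prop :=
  DifferentiableAt ℝ g p ∧ ∀ k, pd k g p = d k

section

variable {g h : State → ℝ} {d e : Fin 3 → ℝ} {p : State}

theorem HasGrad.add (hg : HasGrad g d p) (hh : HasGrad h e p) :
    HasGrad (fun q => g q + h q) (fun k => d k + e k) p :=
  ⟨hg.1.add hh.1, fun k => by
    beta_reduce
    rw [← hg.2 k, ← hh.2 k]
    exact congrArg (· (Pi.single k 1)) (fderiv_fun_add hg.1 hh.1)⟩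

theorem HasGrad.sub (hg : HasGrad g d p) (hh : HasGrad h e p) :
    HasGrad (fun q => g q - h q) (fun k => d k - e k) p :=
  ⟨hg.1.sub hh.1, fun k => by
    beta_reduce
    rw [← hg.2 k, ← hh.2 k]
    exact congrArg (· (Pi.single k 1)) (fderiv_fun_sub hg.1 hh.1)⟩

theorem HasGrad.mul (hg : HasGrad g d p) (hh : HasGrad h e p) :
    HasGrad (fun q => g q * h q) (fun k => d k * h p + g p * e k) p :=
  ⟨hg.1.mul hh.1, fun k => by
    beta_reduce
    rw [← hg.2 k, ← hh.2 k]
    refine (congrArg (· (Pi.single k 1)) (fderiv_fun_mul hg.1 hh.1)).trans ?_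
    simp only [add_apply, smul_apply, smul_eq_mul, pd]
    ring⟩

theorem HasGrad.neg (hg : HasGrad g d p) : HasGrad (fun q => -g q) (fun k => -d k) p :=
  ⟨hg.1.neg, fun k => by
    beta_reduce
    rw [← hg.2 k]
    exact congrArg (fun L : State →L[ℝ] ℝ => L (Pi.single k 1)) fderiv_fun_neg⟩

theorem HasGrad.const (c : ℝ) (p : State) : HasGrad (fun _ => c) (fun _ => 0) p :=
  ⟨differentiableAt_const c, fun k => by simp [pd]⟩

theorem HasGrad.const_mul (c : ℝ) (hg : HasGrad g d p) :
    HasGrad (fun q => c * g q) (fun k => c * d k) p := by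
  simpa using (HasGrad.const c p).mul hg

theorem HasGrad.comp_real {φ : ℝ → ℝ} {φ' : ℝ} (hg : HasGrad g d p)
    (hφ : HasDerivAt φ φ' (g p)) : HasGrad (fun q => φ (g q)) (fun k => φ' * d k) p :=
  ⟨hφ.differentiableAt.comp p hg.1, fun k => by
    beta_reduce
    rw [← hg.2 k]
    refine (congrArg (· (Pi.single k 1)) (hφ.comp_hasFDerivAt p hg.1.hasFDerivAt).fderiv).trans ?_
    simp [pd]⟩

theorem HasGrad.pow (hg : HasGrad g d p) (n : ℕ) :
    HasGrad (fun q => g q ^ n) (fun k => n * g p ^ (n - 1) * d k) p :=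
  hg.comp_real (hasDerivAt_pow n (g p))

theorem HasGrad.div (hg : HasGrad g d p) (hh : HasGrad h e p) (h0 : h p ≠ 0) :
    HasGrad (fun q => g q / h q) (fun k => d k / h p - g p * e k / h p ^ 2) p := by
  have := hg.mul (hh.comp_real (hasDerivAt_inv h0))
  simp only [← div_eq_mul_inv] at this
  refine ⟨this.1, fun k => (this.2 k).trans ?_⟩
  field_simp
  ring

theorem HasGrad.coord (i : Fin 3) (p : State) : HasGrad (fun q => q i) (fun k => kron k i) p :=
  ⟨(hasFDerivAt_apply i p).differentiableAt, fun k => by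
    unfold pd
    rw [(hasFDerivAt_apply i p).fderiv]
    simp [kron, Pi.single_apply, eq_comm]⟩

theorem HasGrad.comp_coord {φ : ℝ → ℝ} {φ' : ℝ} {i : Fin 3} (hφ : HasDerivAt φ φ' (p i)) :
    HasGrad (fun q => φ (q i)) (fun k => φ' * kron k i) p :=
  (HasGrad.coord i p).comp_real hφ

theorem HasGrad.sum {ι : Type*} (s : Finset ι) {g : ι → State → ℝ} {d : ι → Fin 3 → ℝ}
    (hg : ∀ i ∈ s, HasGrad (g i) (d i) p) :
    HasGrad (fun q => ∑ i ∈ s, g i q) (fun k => ∑ i ∈ s, d i k) p := by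
  classical
  induction s using Finset.induction_on with
  | empty => simpa using HasGrad.const 0 p
  | insert i s hi ih =>
    simp only [Finset.sum_insert hi]
    exact (hg i (Finset.mem_insert_self _ _)).add
      (ih fun j hj => hg j (Finset.mem_insert_of_mem hj))

theorem HasGrad.congr_grad (hg : HasGrad g d p) (hde : ∀ k, d k = e k) : HasGrad g e p :=
  ⟨hg.1, fun k => (hg.2 k).trans (hde k)⟩

theorem pd_congr {m : ℕ} {Ω : Set (Fin m → ℝ)} (hΩ : IsOpen Ω) {g h : (Fin m → ℝ) → ℝ}
    (hgh : EqOn g h Ω) {p : Fin m → ℝ} (hp : p ∈ Ω) (k : Fin m) : pd k g p = pd k h p := by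
  unfold pd
  rw [(hgh.eventuallyEq_of_mem (hΩ.mem_nhds hp)).fderiv_eq]

theorem ContDiffOn.hasGrad {Ω : Set State} (hΩ : IsOpen Ω) (hg : ContDiffOn ℝ ∞ g Ω)
    (hp : p ∈ Ω) : HasGrad g (fun k => pd k g p) p :=
  ⟨(hg.differentiableOn (by simp)).differentiableAt (hΩ.mem_nhds hp), fun _ => rfl⟩

theorem pd_comm {Ω : Set State} (hΩ : IsOpen Ω) (hg : ContDiffOn ℝ ∞ g Ω) (hp : p ∈ Ω)
    (k l : Fin 3) : pd k (pd l g) p = pd l (pd k g) p := by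
  have hd : DifferentiableAt ℝ (fderiv ℝ g) p :=
    ((hg.fderiv_of_isOpen (m := ∞) hΩ (by simp)).differentiableOn (by simp)).differentiableAt
      (hΩ.mem_nhds hp)
  have h1 : ∀ k l : Fin 3, pd k (pd l g) p
      = fderiv ℝ (fderiv ℝ g) p (Pi.single k 1) (Pi.single l 1) := by
    intro k l
    have : HasFDerivAt (pd l g) _ p :=
      hd.hasFDerivAt.clm_apply (hasFDerivAt_const (Pi.single l (1 : ℝ) : State) p)
    unfold pd at this ⊢
    rw [this.fderiv]
    simp
  rw [h1, h1]
  exact ((hg.contDiffAt (hΩ.mem_nhds hp)).isSymmSndFDerivAt (by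
    simp only [minSmoothness_of_isRCLikeNormedField]
    exact WithTop.coe_le_coe.2 (le_top : (2 : ℕ∞) ≤ ⊤))) _ _

end

/-! ### The domain -/

variable {I : Fin 3 → Set ℝ}

theorem isOpen_box (hI : ∀ i, IsOpen (I i)) : IsOpen (Box I) := by
  have : Box I = ⋂ i, (fun p : State => p i) ⁻¹' I i := by ext; simp [Box]
  rw [this]
  exact isOpen_iInter_of_finite fun i => (hI i).preimage (continuous_apply i)

theorem injective_state_iff {p : State} :
    Function.Injective p ↔ p 0 ≠ p 1 ∧ p 0 ≠ p 2 ∧ p 1 ≠ p 2 := by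
  constructor
  · intro h
    exact ⟨h.ne (by decide), h.ne (by decide), h.ne (by decide)⟩
  · rintro ⟨h1, h2, h3⟩ i j hij
    fin_cases i <;> fin_cases j <;> simp_all

theorem isOpen_dom (hI : ∀ i, IsOpen (I i)) : IsOpen (Dom I) := by
  have : Dom I = Box I ∩ {p | p 0 ≠ p 1 ∧ p 0 ≠ p 2 ∧ p 1 ≠ p 2} := by
    ext p; simp [Dom, Box, injective_state_iff]
  rw [this]
  exact (isOpen_box hI).inter (((isOpen_ne_fun (continuous_apply 0) (continuous_apply 1)).inter
    ((isOpen_ne_fun (continuous_apply 0) (continuous_apply 2)).inter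
      (isOpen_ne_fun (continuous_apply 1) (continuous_apply 2)))))

theorem dom_subset_box : Dom I ⊆ Box I := fun _ hp => hp.1

/-- Smooth functions with antiderivatives; zeros are allowed. -/
def SmoothPrimitive (I : Fin 3 → Set ℝ) (f F : Fin 3 → ℝ → ℝ) : Prop :=
  ∀ i, ContDiffOn ℝ ∞ (f i) (I i) ∧ ∀ s ∈ I i, HasDerivAt (F i) (f i s) s

variable {f F : Fin 3 → ℝ → ℝ}

theorem Admissible.smoothPrimitive (h : Admissible I f F) : SmoothPrimitive I f F :=
  fun i => ⟨(h i).1, fun s hs => ((h i).2 s hs).2⟩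

theorem contDiffOn_comp_coord {φ : ℝ → ℝ} {i : Fin 3} (h : ContDiffOn ℝ ∞ φ (I i)) :
    ContDiffOn ℝ ∞ (fun p : State => φ (p i)) (Box I) :=
  h.comp (contDiff_apply ℝ ℝ i).contDiffOn fun _ hp => hp i

namespace SmoothPrimitive

theorem contDiffOn_deriv (hI : ∀ i, IsOpen (I i)) (h : SmoothPrimitive I f F)
    (i : Fin 3) : ContDiffOn ℝ ∞ (deriv (f i)) (I i) :=
  ((contDiffOn_infty_iff_deriv_of_isOpen (hI i)).1 (h i).1).2

theorem contDiffOn_primitive (hI : ∀ i, IsOpen (I i)) (h : SmoothPrimitive I f F)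
    (i : Fin 3) : ContDiffOn ℝ ∞ (F i) (I i) :=
  (contDiffOn_infty_iff_deriv_of_isOpen (hI i)).2
    ⟨fun s hs => ((h i).2 s hs).differentiableAt.differentiableWithinAt,
      (h i).1.congr fun s hs => ((h i).2 s hs).deriv⟩

theorem hasDerivAt (hI : ∀ i, IsOpen (I i)) (h : SmoothPrimitive I f F)
    {i : Fin 3} {s : ℝ} (hs : s ∈ I i) : HasDerivAt (f i) (deriv (f i) s) s :=
  (((h i).1.differentiableOn (by simp)).differentiableAt ((hI i).mem_nhds hs)).hasDerivAt

theorem hasDerivAt_deriv (hI : ∀ i, IsOpen (I i)) (h : SmoothPrimitive I f F)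
    {i : Fin 3} {s : ℝ} (hs : s ∈ I i) :
    HasDerivAt (deriv (f i)) (deriv (deriv (f i)) s) s :=
  (((h.contDiffOn_deriv hI i).differentiableOn (by simp)).differentiableAt
    ((hI i).mem_nhds hs)).hasDerivAt

end SmoothPrimitive

/-! ### Regularity and derivatives of the metric, the fluxes and the affinors -/

theorem hasGrad_prodDiff (i : Fin 3) (p : State) : HasGrad (fun q => prodDiff q i)
    (fun k => (kron k i - kron k (i + 1)) * (p i - p (i + 2))
      + (p i - p (i + 1)) * (kron k i - kron k (i + 2))) p :=
  ((HasGrad.coord i p).sub (HasGrad.coord (i + 1) p)).mul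
    ((HasGrad.coord i p).sub (HasGrad.coord (i + 2) p))

theorem contDiff_prodDiff (i : Fin 3) : ContDiff ℝ ∞ fun p : State => prodDiff p i := by
  unfold prodDiff
  fun_prop

theorem contDiff_eta (i : Fin 3) : ContDiff ℝ ∞ fun p : State => eta p i := by
  unfold eta
  fun_prop

/-- `jetB` for functions. -/
def funB (f : Fin 3 → ℝ → ℝ) (i j k : Fin 3) (p : State) : ℝ :=
  jetB p (fun i => f i (p i)) (fun i => deriv (f i) (p i)) i j k

theorem tailR_eq_jetW (α : Fin 4) (p : State) : tailR f F α p
    = jetW p (fun i => f i (p i)) (fun i => deriv (f i) (p i)) (fun i => F i (p i)) α := by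
  fin_cases α <;> rfl

theorem tailL_eq (α : Fin 4) : tailL f F α = tailR f F (Fin.rev α) := by
  fin_cases α <;> rfl

theorem contDiffOn_gUp (h : SmoothPrimitive I f F)
    (i : Fin 3) : ContDiffOn ℝ ∞ (fun p => gUp f p i) (Box I) :=
  ((contDiff_prodDiff i).contDiffOn.pow 2).mul (contDiffOn_comp_coord (h i).1)

theorem contDiffOn_funB (hI : ∀ i, IsOpen (I i)) (h : SmoothPrimitive I f F)
    (i j k : Fin 3) : ContDiffOn ℝ ∞ (funB f i j k) (Dom I) := by
  have hg := fun i => (contDiffOn_gUp h i).mono dom_subset_box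
  have hf := fun i => (contDiffOn_comp_coord (h i).1).mono dom_subset_box
  have hf' := fun i => (contDiffOn_comp_coord (h.contDiffOn_deriv hI i)).mono dom_subset_box
  have hsub : ∀ i j : Fin 3, ContDiffOn ℝ ∞ (fun p : State => p i - p j) (Dom I) := fun i j =>
    ((contDiff_apply ℝ ℝ i).sub (contDiff_apply ℝ ℝ j)).contDiffOn
  unfold funB jetB
  split_ifs with hij
  · refine ((contDiff_prodDiff i).contDiffOn.pow 2).mul
      (((contDiffOn_const.mul (hf' i)).mul contDiffOn_const).add ((hf i).mul
      ((contDiffOn_const.div (hsub _ _) fun p hp => ?_).add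
        (contDiffOn_const.div (hsub _ _) fun p hp => ?_)))) <;>
    exact sub_ne_zero_of_injective hp.2 (by fin_cases i <;> decide)
  · exact ((contDiffOn_const.mul (hg j)).add (contDiffOn_const.mul (hg i))).div (hsub i j)
      fun p hp => sub_ne_zero_of_injective hp.2 hij

theorem contDiffOn_fluxes (hI : ∀ i, IsOpen (I i)) (h : SmoothPrimitive I f F)
    : ContDiffOn ℝ ∞ (fluxQ f) (Box I) ∧ ContDiffOn ℝ ∞ (fluxR f) (Box I) ∧
    ContDiffOn ℝ ∞ (fluxP f F) (Box I) ∧ ContDiffOn ℝ ∞ (fluxS f F) (Box I) := by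
  have hf := fun i => contDiffOn_comp_coord (h i).1
  have hF := fun i => contDiffOn_comp_coord (h.contDiffOn_primitive hI i)
  have hc : ∀ i : Fin 3, ContDiffOn ℝ ∞ (fun p : State => p i) (Box I) := fun i =>
    (contDiff_apply ℝ ℝ i).contDiffOn
  exact ⟨contDiffOn_const.mul (ContDiffOn.sum fun i _ => ((hc i).pow 2).mul (hf i)),
    contDiffOn_const.mul (ContDiffOn.sum fun i _ => hf i),
    ContDiffOn.sum fun i _ => ((hc i).mul (hf i)).neg.add (hF i),
    ContDiffOn.sum fun i _ => ((hc i).mul (hf i)).neg.sub (hF i)⟩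

theorem contDiffOn_mu (hI : ∀ i, IsOpen (I i)) (h : SmoothPrimitive I f F)
    (i : Fin 3) : ContDiffOn ℝ ∞ (fun p => mu f F p i) (Box I) := by
  obtain ⟨-, hR, hP, -⟩ := contDiffOn_fluxes hI h
  exact (((contDiffOn_const.mul (contDiff_prodDiff i).contDiffOn).mul
    (contDiffOn_comp_coord (h.contDiffOn_deriv hI i))).sub
    ((contDiff_eta i).contDiffOn.mul hR)).sub hP

theorem contDiffOn_lam (hI : ∀ i, IsOpen (I i)) (h : SmoothPrimitive I f F)
    (i : Fin 3) : ContDiffOn ℝ ∞ (fun p => lam f F p i) (Box I) := by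
  obtain ⟨hQ, -, -, hS⟩ := contDiffOn_fluxes hI h
  exact (((contDiff_prodDiff i).contDiffOn.mul ((contDiffOn_const.mul
    (contDiffOn_comp_coord (h i).1)).add ((contDiff_apply ℝ ℝ i).contDiffOn.mul
    (contDiffOn_comp_coord (h.contDiffOn_deriv hI i))))).sub
    ((contDiff_eta i).contDiffOn.mul hS)).sub hQ

theorem contDiffOn_tailR (hI : ∀ i, IsOpen (I i)) (h : SmoothPrimitive I f F)
    (α : Fin 4) (i : Fin 3) :
    ContDiffOn ℝ ∞ (fun p => tailR f F α p i) (Box I) := by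
  fin_cases α
  · exact contDiffOn_const
  · exact (contDiff_eta i).contDiffOn
  · exact contDiffOn_mu hI h i
  · exact contDiffOn_lam hI h i

theorem hasGrad_gUp (hI : ∀ i, IsOpen (I i)) (h : SmoothPrimitive I f F)
    {p : State} (hp : p ∈ Dom I) (i : Fin 3) :
    HasGrad (fun q => gUp f q i) (fun k => 2 * funB f i i k p) p := by
  refine (((hasGrad_prodDiff i p).pow 2).mul
    (HasGrad.comp_coord (h.hasDerivAt hI (hp.1 i)))).congr_grad fun k => ?_
  have h1 : p i - p (i + 1) ≠ 0 := sub_ne_zero_of_injective hp.2 (by fin_cases i <;> decide)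
  have h2 : p i - p (i + 2) ≠ 0 := sub_ne_zero_of_injective hp.2 (by fin_cases i <;> decide)
  simp only [funB, jetB, if_true, prodDiff, Nat.cast_ofNat]
  field_simp
  ring

/-- For `i = j` the coefficients form half a gradient, so the skew part vanishes by symmetry of
second derivatives. This justifies the value `0` in `jetDB`, and no second derivative of `f` is
needed. -/
theorem pd_funB (hI : ∀ i, IsOpen (I i)) (h : SmoothPrimitive I f F)
    {p : State} (hp : p ∈ Dom I) (k i j l : Fin 3) :
    pd k (funB f i j l) p - pd l (funB f i j k) p =
      jetDB p (fun i => f i (p i)) (fun i => deriv (f i) (p i)) k i j l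
      - jetDB p (fun i => f i (p i)) (fun i => deriv (f i) (p i)) l i j k := by
  have hΩ := isOpen_dom hI
  rcases eq_or_ne i j with rfl | hij
  · have hb : ∀ l, EqOn (funB f i i l) (fun q => (1 / 2) * pd l (fun q => gUp f q i) q) (Dom I) :=
      fun l q hq => by
        simp only [(hasGrad_gUp hI h hq i).2 l]
        ring
    have hg := (contDiffOn_gUp h i).mono (dom_subset_box (I := I))
    have h2 : ∀ k l, pd k (funB f i i l) p = (1 / 2) * pd k (pd l fun q => gUp f q i) p := by
      intro k l
      rw [pd_congr hΩ (hb l) hp]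
      exact ((ContDiffOn.hasGrad hΩ (contDiffOn_pd hΩ hg l) hp).const_mul (1 / 2)).2 k
    rw [h2, h2, pd_comm hΩ hg hp k l]
    simp [jetDB]
  · have h1 : p i - p j ≠ 0 := sub_ne_zero_of_injective hp.2 hij
    have hgr : ∀ k l, pd k (funB f i j l) p
        = jetDB p (fun i => f i (p i)) (fun i => deriv (f i) (p i)) k i j l := by
      intro k l
      have hb : EqOn (funB f i j l) (fun q => (kron l i * gUp f q j + kron l j * gUp f q i)
          / (q i - q j)) (Dom I) := fun q hq => by simp [funB, jetB, hij, gUp]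
      rw [pd_congr hΩ hb hp]
      refine (((((hasGrad_gUp hI h hp j).const_mul _).add
        ((hasGrad_gUp hI h hp i).const_mul _)).div
        ((HasGrad.coord i p).sub (HasGrad.coord j p)) h1).2 k).trans ?_
      simp [jetDB, hij, gUp, funB]
    rw [hgr, hgr]

theorem hasGrad_fluxes (hI : ∀ i, IsOpen (I i)) (h : SmoothPrimitive I f F)
    {p : State} (hp : p ∈ Box I) :
    HasGrad (fluxQ f) (fun k => 2 * (2 * p k * f k (p k) + p k ^ 2 * deriv (f k) (p k))) p ∧
    HasGrad (fluxR f) (fun k => (1 / 2) * deriv (f k) (p k)) p ∧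
    HasGrad (fluxP f F) (fun k => -(p k * deriv (f k) (p k))) p ∧
    HasGrad (fluxS f F) (fun k => -(p k * deriv (f k) (p k)) - 2 * f k (p k)) p := by
  have hf := fun i => HasGrad.comp_coord (h.hasDerivAt hI (hp i))
  have hF := fun i => HasGrad.comp_coord ((h i).2 _ (hp i))
  have hc := fun i => HasGrad.coord i p
  refine ⟨((HasGrad.sum Finset.univ fun i _ => ((hc i).pow 2).mul (hf i)).const_mul
      2).congr_grad fun k => ?_,
    ((HasGrad.sum Finset.univ fun i _ => hf i).const_mul (1 / 2)).congr_grad fun k => ?_,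
    (HasGrad.sum Finset.univ fun i _ => ((hc i).mul (hf i)).neg.add (hF i)).congr_grad
      fun k => ?_,
    (HasGrad.sum Finset.univ fun i _ => ((hc i).mul (hf i)).neg.sub (hF i)).congr_grad
      fun k => ?_⟩ <;>
  · simp only [Fin.sum_univ_three]
    fin_cases k <;> simp [kron] <;> ring

theorem hasGrad_mu (hI : ∀ i, IsOpen (I i)) (h : SmoothPrimitive I f F)
    {p : State} (hp : p ∈ Box I) (i : Fin 3) : HasGrad (fun q => mu f F q i)
    (fun k => -(1 / 2) * (((kron k i - kron k (i + 1)) * (p i - p (i + 2))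
      + (p i - p (i + 1)) * (kron k i - kron k (i + 2))) * deriv (f i) (p i)
      + prodDiff p i * (deriv (deriv (f i)) (p i) * kron k i))
      - ((kron k (i + 1) + kron k (i + 2)) * fluxR f p + eta p i * ((1 / 2) * deriv (f k) (p k)))
      + p k * deriv (f k) (p k)) p := by
  obtain ⟨-, hR, hP, -⟩ := hasGrad_fluxes hI h hp
  refine (((((hasGrad_prodDiff i p).const_mul (-(1 / 2))).mul
    (HasGrad.comp_coord (h.hasDerivAt_deriv hI (hp i)))).sub
    (((HasGrad.coord (i + 1) p).add (HasGrad.coord (i + 2) p)).mul hR)).sub hP).congr_grad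
    fun k => ?_
  simp only [eta]
  ring

theorem hasGrad_lam (hI : ∀ i, IsOpen (I i)) (h : SmoothPrimitive I f F)
    {p : State} (hp : p ∈ Box I) (i : Fin 3) : HasGrad (fun q => lam f F q i)
    (fun k => ((kron k i - kron k (i + 1)) * (p i - p (i + 2))
      + (p i - p (i + 1)) * (kron k i - kron k (i + 2))) * (2 * f i (p i) + p i * deriv (f i) (p i))
      + prodDiff p i * (kron k i * (3 * deriv (f i) (p i) + p i * deriv (deriv (f i)) (p i)))
      - ((kron k (i + 1) + kron k (i + 2)) * fluxS f F p
        + eta p i * (-(p k * deriv (f k) (p k)) - 2 * f k (p k)))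
      - 2 * (2 * p k * f k (p k) + p k ^ 2 * deriv (f k) (p k))) p := by
  obtain ⟨hQ, -, -, hS⟩ := hasGrad_fluxes hI h hp
  refine ((((hasGrad_prodDiff i p).mul (((HasGrad.comp_coord (h.hasDerivAt hI (hp i))).const_mul
    2).add ((HasGrad.coord i p).mul (HasGrad.comp_coord (h.hasDerivAt_deriv hI (hp i)))))).sub
    (((HasGrad.coord (i + 1) p).add (HasGrad.coord (i + 2) p)).mul hS)).sub hQ).congr_grad
    fun k => ?_
  simp only [eta]
  ring

/-- All four affinors solve one linear system, that of the speeds of flows commuting with `η`. It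
yields both the Codazzi equation and the commutation with the transformed system. -/
theorem pd_tailR (hI : ∀ i, IsOpen (I i)) (h : SmoothPrimitive I f F)
    {p : State} (hp : p ∈ Dom I) (α : Fin 4) {k i : Fin 3} (hki : k ≠ i) :
    pd k (fun q => tailR f F α q i) p = (tailR f F α p k - tailR f F α p i) / (p i - p k) := by
  have h1 : p i - p k ≠ 0 := sub_ne_zero_of_injective hp.2 hki.symm
  rw [eq_div_iff h1]
  fin_cases α
  · simp [tailR, pd]
  · change pd k (fun q => eta q i) p * _ = eta p k - eta p i
    have := ((HasGrad.coord (i + 1) p).add (HasGrad.coord (i + 2) p)).2 k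
    unfold eta at this ⊢
    rw [this]
    fin_cases i <;> fin_cases k <;> simp [kron] at hki ⊢ <;> ring
  · change pd k (fun q => mu f F q i) p * _ = mu f F p k - mu f F p i
    rw [(hasGrad_mu hI h hp.1 i).2 k]
    unfold mu
    generalize fluxP f F p = P'
    simp only [fluxR, Fin.sum_univ_three]
    fin_cases i <;> fin_cases k <;> simp [kron, prodDiff, eta] at hki ⊢ <;> ring
  · change pd k (fun q => lam f F q i) p * _ = lam f F p k - lam f F p i
    rw [(hasGrad_lam hI h hp.1 i).2 k]
    unfold lam
    simp only [fluxS, fluxQ, Fin.sum_univ_three]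
    fin_cases i <;> fin_cases k <;> simp [kron, prodDiff, eta] at hki ⊢ <;> ring

/-! ### The transformed operator is Hamiltonian -/

section

variable {A : Type} [Fintype A] {I : Fin 3 → Set ℝ} {f F : Fin 3 → ℝ → ℝ}

/-- The algebraic identity sees only the skew part of `db` and the off-diagonal part of `dw`; the
diagonal derivatives of the affinors, which contain `f''`, cancel. -/
theorem jacCovec_congr {b : Fin 3 → Fin 3 → Fin 3 → ℝ} {db db' : Fin 3 → Fin 3 → Fin 3 → Fin 3 → ℝ}
    {w : A → Fin 3 → ℝ} {dw dw' : A → Fin 3 → Fin 3 → ℝ}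
    (hdb : ∀ k i j l, db k i j l - db l i j k = db' k i j l - db' l i j k)
    (hdw : ∀ α k i, k ≠ i → dw α k i = dw' α k i) (σ : A → A) (ξ a a' c c' : Fin 3 → ℝ)
    (P Q : A → ℝ) (k : Fin 3) :
    jacCovec b db w dw σ ξ a a' c c' P Q k = jacCovec b db' w dw' σ ξ a a' c c' P Q k := by
  unfold jacCovec
  simp only [hdb]
  congr 1
  refine Finset.sum_congr rfl fun α _ => ?_
  congr 2
  refine Finset.sum_congr rfl fun i _ => ?_
  rcases eq_or_ne k i with rfl | hki
  · ring
  · rw [hdw α k i hki, hdw α i k hki.symm]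

/-- The transformed operator in a form which makes sense for functions with zeros. -/
def polyOp (f F : Fin 3 → ℝ → ℝ) : Op :=
  genOp (fun i p => gUp f p i) (funB f) (tailL f F) (tailR f F)

theorem polyOp_isHamiltonian (hI : ∀ i, IsOpen (I i)) (h : SmoothPrimitive I f F) :
    IsHamiltonian (Dom I) (polyOp f F) := by
  have hL : tailL f F = fun α => tailR f F (Fin.rev α) := funext tailL_eq
  unfold polyOp
  rw [hL]
  refine genOp_isHamiltonian (isOpen_dom hI)
    (fun i => (contDiffOn_gUp h i).mono dom_subset_box) (contDiffOn_funB hI h)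
    (fun α i => (contDiffOn_tailR hI h α i).mono dom_subset_box) Fin.rev_rev ?_ ?_
  · intro p hp i j k
    rcases eq_or_ne i j with rfl | hij
    · rw [if_pos rfl, (hasGrad_gUp hI h hp i).2 k]
      ring
    · have h1 := sub_ne_zero_of_injective hp.2 hij
      rw [if_neg hij]
      simp only [funB, jetB, if_neg hij, if_neg hij.symm, ← neg_sub (p i) (p j)]
      field_simp
      ring
  · intro p hp ξ a a' c c' e e' P Q S
    have hj := jet_jacobi hp.2 (fun i => f i (p i)) (fun i => deriv (f i) (p i))
      (fun i => F i (p i)) ξ a a' c c' e e' P Q S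
    have hw : (fun α => tailR f F α p) = jetW p (fun i => f i (p i))
        (fun i => deriv (f i) (p i)) (fun i => F i (p i)) := funext fun α => tailR_eq_jetW α p
    dsimp only at hj ⊢
    simp only [← hw] at hj
    have hc := fun a a' c c' P Q k => jacCovec_congr (b := fun i j k => funB f i j k p)
      (w := fun α => tailR f F α p) (σ := Fin.rev) (ξ := ξ) (pd_funB hI h hp)
      (dw := fun α k i => pd k (fun p => tailR f F α p i) p)
      (dw' := jetDW p (fun i => f i (p i)) (fun i => deriv (f i) (p i)) (fun i => F i (p i)))
      (fun α k i hki => by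
        rw [pd_tailR hI h hp α hki, tailR_eq_jetW]; rfl) a a' c c' P Q k
    simp only [hc]
    exact hj

/-- Derivatives at `ε = 0` only see small `ε`, and for those the perturbed field still has values in
the open set `Ω`. -/
theorem IsHamiltonian.congr {Ω : Set State} (hΩ : IsOpen Ω) {J J' : Op}
    (hJ : IsHamiltonian Ω J) (e : ∀ u ∈ Fields Ω, ∀ c ∈ Test, J' u c = J u c) :
    IsHamiltonian Ω J' := by
  have hb : ∀ u ∈ Fields Ω, ∀ a, ∀ b ∈ Test, bracket J' u a b = bracket J u a b :=
    fun u hu a b hb => by unfold bracket; rw [e u hu b hb]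
  intro u hu
  obtain ⟨h1, h2, h3⟩ := hJ u hu
  refine ⟨fun b hb => e u hu b hb ▸ h1 b hb, fun a ha b hb' => ?_, fun a ha b hb' c hc => ?_⟩
  · rw [hb u hu a b hb', hb u hu b a ha]
    exact h2 a ha b hb'
  · obtain ⟨d₁, d₂, d₃, e1, e2, e3, hd⟩ := h3 a ha b hb' c hc
    have key : ∀ a, ∀ b ∈ Test, ∀ c ∈ Test, ∀ d : ℝ,
        HasDerivAt (fun ε : ℝ => bracket J (u + ε • J u c) a b) d 0 →
        HasDerivAt (fun ε : ℝ => bracket J' (u + ε • J' u c) a b) d 0 := by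
      intro a b hb' c hc d hd
      refine hd.congr_of_eventuallyEq ?_
      filter_upwards [add_smul_mem_fields hΩ hu (h1 c hc)] with ε hε
      rw [e u hu c hc, hb _ hε a b hb']
    exact ⟨d₁, d₂, d₃, key a b hb' c hc _ e1, key b c hc a ha _ e2, key c a ha b hb' _ e3, hd⟩

/-- The denominator in `f'/(2f)` cancels against the factor `f` of the metric; this is what makes
sense of the operator at zeros of `f`. -/
theorem tMat_eq {p : State} (hp : Function.Injective p) (hf : ∀ i, f i (p i) ≠ 0) (ξ : State)
    (i j : Fin 3) : tMat f p ξ i j = ∑ k, funB f i j k p * ξ k := by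
  have h01 : p 0 - p 1 ≠ 0 := sub_ne_zero_of_injective hp (by decide)
  have h02 : p 0 - p 2 ≠ 0 := sub_ne_zero_of_injective hp (by decide)
  have h12 : p 1 - p 2 ≠ 0 := sub_ne_zero_of_injective hp (by decide)
  have h10 : p 1 - p 0 ≠ 0 := sub_ne_zero_of_injective hp (by decide)
  have h20 : p 2 - p 0 ≠ 0 := sub_ne_zero_of_injective hp (by decide)
  have h21 : p 2 - p 1 ≠ 0 := sub_ne_zero_of_injective hp (by decide)
  have f0 := hf 0
  have f1 := hf 1
  have f2 := hf 2
  simp only [Fin.sum_univ_three]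
  fin_cases i <;> fin_cases j <;> simp [tMat, funB, jetB, kron, gUp] <;> field_simp <;> ring

theorem tLocal_eq {u : ℝ → State} {x : ℝ} (hp : Function.Injective (u x))
    (hf : ∀ i, f i (u x i) ≠ 0) (c : ℝ → State) (i : Fin 3) :
    tLocal f u c x i = gUp f (u x) i * deriv (fun y => c y i) x
      + ∑ j, ∑ k, funB f i j k (u x) * dx u k x * c x j := by
  unfold tLocal
  simp only [tMat_eq hp hf, Finset.sum_mul]

theorem tOp_eq_polyOp {u : ℝ → State} (hu : ∀ x, u x ∈ Dom I)
    (hf : ∀ i, ∀ s ∈ I i, f i s ≠ 0) (c : ℝ → State) : tOp f F u c = polyOp f F u c := by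
  ext x i
  simp only [tOp, polyOp, genOp, Pi.add_apply,
    tLocal_eq (hu x).2 (fun i => hf i _ ((hu x).1 i))]

theorem tOp_isHamiltonian (hI : ∀ i, IsOpen (I i)) (h : Admissible I f F) :
    IsHamiltonian (Dom I) (tOp f F) :=
  (polyOp_isHamiltonian hI h.smoothPrimitive).congr (isOpen_dom hI) fun _ hu c _ =>
    tOp_eq_polyOp hu.1.2 (fun i s hs => ((h i).2 s hs).1) c

/-! ### Linear dependence on the functions -/

variable {f₁ F₁ f₂ F₂ : Fin 3 → ℝ → ℝ}

theorem SmoothPrimitive.linComb (h₁ : SmoothPrimitive I f₁ F₁) (h₂ : SmoothPrimitive I f₂ F₂)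
    (c₁ c₂ : ℝ) : SmoothPrimitive I (fun i s => c₁ * f₁ i s + c₂ * f₂ i s)
      (fun i s => c₁ * F₁ i s + c₂ * F₂ i s) := fun i =>
  ⟨(contDiffOn_const.mul (h₁ i).1).add (contDiffOn_const.mul (h₂ i).1), fun s hs =>
    (((h₁ i).2 s hs).const_mul c₁).add (((h₂ i).2 s hs).const_mul c₂)⟩

/-- Each tail term has one factor from `λ, μ`, linear in the data, and one from `1, η`, independent
of them. So the tail is linear and not quadratic. -/
theorem polyOp_linComb (hI : ∀ i, IsOpen (I i)) (h₁ : SmoothPrimitive I f₁ F₁)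
    (h₂ : SmoothPrimitive I f₂ F₂) (c₁ c₂ : ℝ) {u c : ℝ → State} (hu : u ∈ Fields (Dom I))
    (hc : c ∈ Test) (x : ℝ) :
    polyOp (fun i s => c₁ * f₁ i s + c₂ * f₂ i s) (fun i s => c₁ * F₁ i s + c₂ * F₂ i s) u c x
      = c₁ • polyOp f₁ F₁ u c x + c₂ • polyOp f₂ F₂ u c x := by
  set f := fun i s => c₁ * f₁ i s + c₂ * f₂ i s with hf
  set F := fun i s => c₁ * F₁ i s + c₂ * F₂ i s with hF
  have hd : ∀ p ∈ Dom I, ∀ i, deriv (f i) (p i)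
      = c₁ * deriv (f₁ i) (p i) + c₂ * deriv (f₂ i) (p i) := fun p hp i =>
    (((h₁.hasDerivAt hI (hp.1 i)).const_mul c₁).add
      ((h₂.hasDerivAt hI (hp.1 i)).const_mul c₂)).deriv
  have hg : ∀ p i, gUp f p i = c₁ * gUp f₁ p i + c₂ * gUp f₂ p i := fun p i => by
    simp only [gUp, hf]; ring
  have hb : ∀ p ∈ Dom I, ∀ i j k, funB f i j k p = c₁ * funB f₁ i j k p + c₂ * funB f₂ i j k p := by
    intro p hp i j k
    simp only [funB, jetB, hd p hp]
    split_ifs <;> simp only [hf] <;> ring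
  have hmu : ∀ p ∈ Dom I, ∀ i, mu f F p i = c₁ * mu f₁ F₁ p i + c₂ * mu f₂ F₂ p i := by
    intro p hp i
    simp only [mu, hd p hp, fluxR, fluxP, Fin.sum_univ_three]
    simp only [hf, hF]
    ring
  have hlam : ∀ p ∈ Dom I, ∀ i, lam f F p i = c₁ * lam f₁ F₁ p i + c₂ * lam f₂ F₂ p i := by
    intro p hp i
    simp only [lam, hd p hp, fluxS, fluxQ, Fin.sum_univ_three]
    simp only [hf, hF]
    ring
  have htail : ∀ (w w₁ w₂ : State → State) (_ : ∀ i, ContDiffOn ℝ ∞ (fun p => w₁ p i) (Box I))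
      (_ : ∀ i, ContDiffOn ℝ ∞ (fun p => w₂ p i) (Box I))
      (_ : ∀ p ∈ Dom I, ∀ i, w p i = c₁ * w₁ p i + c₂ * w₂ p i),
      dinv (tailDensity w u c) x = c₁ * dinv (tailDensity w₁ u c) x
        + c₂ * dinv (tailDensity w₂ u c) x := by
    intro w w₁ w₂ k₁ k₂ hw
    have i₁ := (tailDensity_contDiff (fun i => (k₁ i).mono dom_subset_box)
      hu.1 hc).continuous.integrable_of_hasCompactSupport (μ := volume)
      (tailDensity_hasCompactSupport w₁ u hc)
    have i₂ := (tailDensity_contDiff (fun i => (k₂ i).mono dom_subset_box)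
      hu.1 hc).continuous.integrable_of_hasCompactSupport (μ := volume)
      (tailDensity_hasCompactSupport w₂ u hc)
    rw [← dinv_add_mul i₁ i₂]
    congr 1
    ext y
    simp only [tailDensity, hw _ (hu.1.2 y), Fin.sum_univ_three]
    ring
  have t1 := htail (mu f F) (mu f₁ F₁) (mu f₂ F₂) (contDiffOn_mu hI h₁) (contDiffOn_mu hI h₂) hmu
  have t2 := htail (lam f F) (lam f₁ F₁) (lam f₂ F₂) (contDiffOn_lam hI h₁)
    (contDiffOn_lam hI h₂) hlam
  ext i
  simp only [polyOp, genOp, tailOp_eq, Fin.sum_univ_four, tailL, tailR, Matrix.cons_val,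
    Pi.add_apply, Pi.smul_apply, smul_eq_mul, t1, t2, hg, hb _ (hu.1.2 x), hmu _ (hu.1.2 x),
    hlam _ (hu.1.2 x), Fin.sum_univ_three]
  ring

/-- A combination of the functions may vanish somewhere, which `polyOp` allows; even `c₁ = c₂ = 0`
is covered. -/
theorem tOp_compatible (hI : ∀ i, IsOpen (I i)) (h₁ : Admissible I f₁ F₁)
    (h₂ : Admissible I f₂ F₂) : Compatible (Dom I) (tOp f₁ F₁) (tOp f₂ F₂) := by
  intro c₁ c₂
  refine (polyOp_isHamiltonian hI (h₁.smoothPrimitive.linComb h₂.smoothPrimitive c₁ c₂)).congr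
    (isOpen_dom hI) fun u hu c hc => ?_
  ext1 x
  rw [polyOp_linComb hI h₁.smoothPrimitive h₂.smoothPrimitive c₁ c₂ hu hc,
    tOp_eq_polyOp hu.1.2 (fun i s hs => ((h₁ i).2 s hs).1),
    tOp_eq_polyOp hu.1.2 (fun i s hs => ((h₂ i).2 s hs).1)]

theorem tOp_linComb (hI : ∀ i, IsOpen (I i)) (h₁ : Admissible I f₁ F₁) (h₂ : Admissible I f₂ F₂)
    {c₁ c₂ : ℝ} (h0 : ∀ i, ∀ s ∈ I i, c₁ * f₁ i s + c₂ * f₂ i s ≠ 0) {u c : ℝ → State}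
    (hu : u ∈ Fields (Dom I)) (hc : c ∈ Test) (x : ℝ) :
    tOp (fun i s => c₁ * f₁ i s + c₂ * f₂ i s) (fun i s => c₁ * F₁ i s + c₂ * F₂ i s) u c x
      = c₁ • tOp f₁ F₁ u c x + c₂ • tOp f₂ F₂ u c x := by
  rw [tOp_eq_polyOp hu.1.2 h0, tOp_eq_polyOp hu.1.2 (fun i s hs => ((h₁ i).2 s hs).1),
    tOp_eq_polyOp hu.1.2 (fun i s hs => ((h₂ i).2 s hs).1)]
  exact polyOp_linComb hI h₁.smoothPrimitive h₂.smoothPrimitive c₁ c₂ hu hc x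

end

/-! ### Diagonal metrics -/

section

theorem inv_diagonal_one_div {G : Fin 3 → ℝ} (h0 : ∀ i, G i ≠ 0) :
    (Matrix.diagonal fun i => 1 / G i)⁻¹ = Matrix.diagonal G := by
  refine Matrix.inv_eq_right_inv ?_
  rw [Matrix.diagonal_mul_diagonal, ← Matrix.diagonal_one]
  congr 1
  funext i
  exact one_div_mul_cancel (h0 i)

theorem christoffel_diagonal {G : State → Fin 3 → ℝ} {dG : Fin 3 → Fin 3 → ℝ} {p : State}
    (hG : ∀ i, HasGrad (fun q => G q i) (dG i) p) (h0 : ∀ i, G p i ≠ 0) (i s k : Fin 3) :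
    christoffel (fun q => Matrix.diagonal fun i => 1 / G q i) i s k p =
      (1 / 2) * (kron s k * dG s i * G p i / G p s ^ 2
        - kron i k * dG i s / G p i - kron i s * dG i k / G p i) := by
  have hg : ∀ a b c, pd a (fun q => (Matrix.diagonal fun i => 1 / G q i : Matrix _ _ ℝ) b c) p
      = -(kron b c * dG b a / G p b ^ 2) := by
    intro a b c
    rcases eq_or_ne b c with rfl | hbc
    · simp only [Matrix.diagonal_apply_eq]
      rw [((HasGrad.const 1 p).div (hG b) (h0 b)).2 a]
      simp [kron]
    · simp [kron, hbc, pd]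
  unfold christoffel
  simp only [hg, inv_diagonal_one_div h0]
  rw [Finset.sum_eq_single i (fun m _ hm => by rw [Matrix.diagonal_apply_ne _ hm.symm, zero_mul])
    (by simp), Matrix.diagonal_apply_eq]
  have := h0 i
  have := h0 s
  field_simp
  ring

theorem curvature_diagonal {G : State → Fin 3 → ℝ} {p : State} (h0 : ∀ i, G p i ≠ 0)
    (i j k l : Fin 3) : curvature (fun q => Matrix.diagonal fun i => 1 / G q i) i j k l p
      = G p j * riemann (fun q => Matrix.diagonal fun i => 1 / G q i) i j k l p := by
  unfold curvature
  rw [inv_diagonal_one_div h0, Finset.sum_eq_single j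
    (fun m _ hm => by rw [Matrix.diagonal_apply_ne _ hm.symm, zero_mul]) (by simp),
    Matrix.diagonal_apply_eq]

theorem dnOp_diagonal {G : State → Fin 3 → ℝ} {u : ℝ → State} {x : ℝ}
    (h0 : ∀ i, G (u x) i ≠ 0) (c : ℝ → State) (i : Fin 3) :
    dnOp (fun q => Matrix.diagonal fun i => 1 / G q i) u c x i
      = G (u x) i * deriv (fun y => c y i) x
        + ∑ j, ∑ k, -(G (u x) i * christoffel (fun q => Matrix.diagonal fun i => 1 / G q i)
          j i k (u x)) * dx u k x * c x j := by
  unfold dnOp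
  rw [inv_diagonal_one_div h0]
  simp only [Matrix.diagonal_apply, ite_mul, zero_mul, Finset.sum_sub_distrib, Finset.sum_ite_eq,
    Finset.mem_univ, if_true]
  rw [sub_eq_add_neg, ← Finset.sum_neg_distrib]
  congr 1
  refine Finset.sum_congr rfl fun j _ => ?_
  rw [Finset.sum_eq_single i (fun m _ hm => by simp [hm.symm]) (by simp), ← Finset.sum_neg_distrib]
  refine Finset.sum_congr rfl fun k _ => ?_
  rw [if_pos rfl]
  ring

end

section

variable {I : Fin 3 → Set ℝ} {f F : Fin 3 → ℝ → ℝ}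

/-! ### The transformed metric -/

theorem gUp_ne_zero {p : State} (hp : Function.Injective p) (hf : ∀ i, f i (p i) ≠ 0)
    (i : Fin 3) : gUp f p i ≠ 0 :=
  mul_ne_zero (pow_ne_zero 2 (prodDiff_ne_zero hp i)) (hf i)

theorem christoffel_tMetric (hI : ∀ i, IsOpen (I i)) (h : Admissible I f F) {p : State}
    (hp : p ∈ Dom I) (j i k : Fin 3) : christoffel (tMetric f) j i k p
      = jetGamma p (fun i => f i (p i)) (fun i => deriv (f i) (p i)) j i k := by
  have hf : ∀ i, f i (p i) ≠ 0 := fun i => ((h i).2 _ (hp.1 i)).1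
  refine (christoffel_diagonal (hasGrad_gUp hI h.smoothPrimitive hp)
    (gUp_ne_zero hp.2 hf) j i k).trans ?_
  have h01 : p 0 - p 1 ≠ 0 := sub_ne_zero_of_injective hp.2 (by decide)
  have h02 : p 0 - p 2 ≠ 0 := sub_ne_zero_of_injective hp.2 (by decide)
  have h12 : p 1 - p 2 ≠ 0 := sub_ne_zero_of_injective hp.2 (by decide)
  have h10 : p 1 - p 0 ≠ 0 := sub_ne_zero_of_injective hp.2 (by decide)
  have h20 : p 2 - p 0 ≠ 0 := sub_ne_zero_of_injective hp.2 (by decide)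
  have h21 : p 2 - p 1 ≠ 0 := sub_ne_zero_of_injective hp.2 (by decide)
  have f0 := hf 0
  have f1 := hf 1
  have f2 := hf 2
  fin_cases i <;> fin_cases j <;> fin_cases k <;>
    simp [jetGamma, funB, jetB, gUp, kron, prodDiff_zero, prodDiff_one, prodDiff_two] <;>
    field_simp <;> ring

theorem tLocal_eq_dnOp (hI : ∀ i, IsOpen (I i)) (h : Admissible I f F) {u : ℝ → State} {x : ℝ}
    (hu : u x ∈ Dom I) (c : ℝ → State) : tLocal f u c x = dnOp (tMetric f) u c x := by
  have hf : ∀ i, f i (u x i) ≠ 0 := fun i => ((h i).2 _ (hu.1 i)).1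
  ext i
  rw [tLocal_eq hu.2 hf]
  refine Eq.trans ?_ (dnOp_diagonal (gUp_ne_zero hu.2 hf) c i).symm
  congr 1
  refine Finset.sum_congr rfl fun j _ => Finset.sum_congr rfl fun k _ => ?_
  have := christoffel_tMetric hI h hu j i k
  unfold tMetric at this
  rw [this]
  unfold funB
  rw [jetB_eq hu.2 hf]
  rfl

/-- Writing `Γ^i_{lj} = -b^{ji}_l / g^j` turns the curvature into minus the Gauss expression for the
index pairs `(k, l)` and `(j, i)`. -/
theorem curvature_tMetric (hI : ∀ i, IsOpen (I i)) (h : Admissible I f F) {p : State}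
    (hp : p ∈ Dom I) (i j k l : Fin 3) : curvature (tMetric f) i j k l p =
      (lam f F p i + lam f F p j + mu f F p i * eta p j + mu f F p j * eta p i)
        * ((if i = k ∧ j = l then 1 else 0) - (if i = l ∧ j = k then 1 else 0)) := by
  have hf : ∀ q ∈ Dom I, ∀ i, f i (q i) ≠ 0 := fun q hq i => ((h i).2 _ (hq.1 i)).1
  have hg0 := gUp_ne_zero hp.2 (hf p hp)
  refine (curvature_diagonal hg0 i j k l).trans ?_
  change gUp f p j * riemann (tMetric f) i j k l p = _
  have hΓ : ∀ i s l, EqOn (christoffel (tMetric f) i l s)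
      (fun q => -(funB f s i l q / gUp f q s)) (Dom I) := fun i s l q hq => by
    rw [christoffel_tMetric hI h hq, jetGamma_symm hq.2 (hf q hq)]
    rfl
  have hd : ∀ k l, pd k (christoffel (tMetric f) i l j) p
      = -(pd k (funB f j i l) p / gUp f p j
        - funB f j i l p * (2 * funB f j j k p) / gUp f p j ^ 2) := fun k l => by
    rw [pd_congr (isOpen_dom hI) (hΓ i j l) hp]
    exact ((ContDiffOn.hasGrad (isOpen_dom hI) (contDiffOn_funB hI h.smoothPrimitive j i l) hp).div
      (hasGrad_gUp hI h.smoothPrimitive hp j) (hg0 j)).neg.2 k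
  unfold riemann
  rw [hd, hd]
  have hG := jet_gauss (φ₁ := fun i => deriv (f i) (p i)) hp.2 (hf p hp) (fun i => F i (p i))
    k l j i
  have hD := pd_funB hI h.smoothPrimitive hp k j i l
  have hC : ∀ j i k, jetGamma p (fun i => f i (p i)) (fun i => deriv (f i) (p i)) j i k
      = christoffel (tMetric f) j i k p := fun j i k => (christoffel_tMetric hI h hp j i k).symm
  have hS : ∀ j i k, christoffel (tMetric f) j i k p = christoffel (tMetric f) j k i p :=
    fun j i k => by simp only [← hC]; exact jetGamma_symm hp.2 (hf p hp) j i k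
  have hB : ∀ i j k, jetB p (fun i => f i (p i)) (fun i => deriv (f i) (p i)) i j k
      = -(gUp f p i * christoffel (tMetric f) j i k p) := fun i j k => by
    rw [← hC]; exact jetB_eq hp.2 (hf p hp) i j k
  -- Compatibility of the connection with the metric: `b` is skew off the diagonal.
  have hsym : ∀ n j k, gUp f p n * christoffel (tMetric f) j n k p
      = -(gUp f p j * christoffel (tMetric f) n j k p)
        + (if n = j then 2 * (gUp f p j * christoffel (tMetric f) j j k p) else 0) := by
    intro n j k
    split_ifs with hnj
    · subst hnj; ring
    · rw [add_zero, ← neg_inj, ← hB, neg_neg, ← neg_neg (gUp f p j * _), ← hB]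
      have h1 := sub_ne_zero_of_injective hp.2 hnj
      simp only [jetB, if_neg hnj, if_neg (Ne.symm hnj), ← neg_sub (p n) (p j)]
      field_simp
      ring
  have hw : ∑ α, jetW p (fun i => f i (p i)) (fun i => deriv (f i) (p i)) (fun i => F i (p i)) α k
      * jetW p (fun i => f i (p i)) (fun i => deriv (f i) (p i)) (fun i => F i (p i)) (Fin.rev α) l
      * ((if k = j ∧ l = i then 1 else 0) - (if k = i ∧ l = j then 1 else 0))
      = (lam f F p l + eta p k * mu f F p l + mu f F p k * eta p l + lam f F p k)
      * ((if k = j ∧ l = i then 1 else 0) - (if k = i ∧ l = j then 1 else 0)) := by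
    rw [← Finset.sum_mul]
    congr 1
    simp only [← tailR_eq_jetW, ← tailL_eq]
    simp [Fin.sum_univ_four, tailL, tailR]
  rw [hw] at hG
  -- The deltas vanish unless `{i, j} = {k, l}`, so the symmetric factor may be evaluated at either
  -- pair.
  have hR : (lam f F p i + lam f F p j + mu f F p i * eta p j + mu f F p j * eta p i)
        * ((if i = k ∧ j = l then 1 else 0) - (if i = l ∧ j = k then 1 else 0))
      = -((lam f F p l + eta p k * mu f F p l + mu f F p k * eta p l + lam f F p k)
      * ((if k = j ∧ l = i then 1 else 0) - (if k = i ∧ l = j then 1 else 0))) := by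
    by_cases h1 : i = k ∧ j = l
    · obtain ⟨rfl, rfl⟩ := h1
      by_cases h2 : i = j
      · subst h2; simp
      · simp [h2, Ne.symm h2]; ring
    · by_cases h2 : i = l ∧ j = k
      · obtain ⟨rfl, rfl⟩ := h2
        have h3 : ¬ i = j := fun e => h1 ⟨e, e.symm⟩
        simp [h3, Ne.symm h3]; ring
      · have h3 : ¬ (k = j ∧ l = i) := fun e => h2 ⟨e.2.symm, e.1.symm⟩
        have h4 : ¬ (k = i ∧ l = j) := fun e => h1 ⟨e.1.symm, e.2.symm⟩
        simp [h1, h2, h3, h4]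
  rw [hR, ← hG]
  have hDk := hD
  simp only [hB, hC, funB] at hG hD ⊢
  rw [add_sub_assoc, ← hDk]
  have e1 : gUp f p j * (-(pd k (funB f j i l) p / gUp f p j
        - -(gUp f p j * christoffel (tMetric f) i j l p)
          * (2 * -(gUp f p j * christoffel (tMetric f) j j k p)) / gUp f p j ^ 2)
      - -(pd l (funB f j i k) p / gUp f p j
        - -(gUp f p j * christoffel (tMetric f) i j k p)
          * (2 * -(gUp f p j * christoffel (tMetric f) j j l p)) / gUp f p j ^ 2))
      = -(pd k (funB f j i l) p - pd l (funB f j i k) p)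
        + 2 * gUp f p j * (christoffel (tMetric f) i j l p * christoffel (tMetric f) j j k p
          - christoffel (tMetric f) i j k p * christoffel (tMetric f) j j l p) := by
    have := hg0 j
    field_simp
    ring
  have e2 : ∀ k l, ∑ n, -(gUp f p n * christoffel (tMetric f) j n k p)
        * christoffel (tMetric f) i n l p
      = gUp f p j * (∑ n, christoffel (tMetric f) i l n p * christoffel (tMetric f) n k j p)
        - 2 * gUp f p j * christoffel (tMetric f) j j k p * christoffel (tMetric f) i j l p := by
    intro k l
    rw [Finset.sum_congr rfl fun n _ => congrArg (fun t => -t * _) (hsym n j k)]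
    simp only [neg_add, add_mul, Finset.sum_add_distrib, neg_neg, ite_mul, zero_mul,
      Finset.mul_sum, neg_mul, Finset.sum_neg_distrib, Finset.sum_ite_eq', Finset.mem_univ, if_true]
    rw [sub_eq_add_neg]
    congr 1
    · exact Finset.sum_congr rfl fun n _ => by rw [hS i l n, hS n k j]; ring
    · ring
  have e3 : ∑ n, -(gUp f p n * christoffel (tMetric f) i n k p)
        * christoffel (tMetric f) j n l p
      = ∑ n, -(gUp f p n * christoffel (tMetric f) j n l p) * christoffel (tMetric f) i n k p :=
    Finset.sum_congr rfl fun n _ => by ring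
  rw [mul_add, e1, Finset.sum_sub_distrib, Finset.sum_sub_distrib, e3, e2 k l, e2 l k]
  ring

theorem dB_mul_dM_sub (p : State) :
    dB p * dM p - dA p * dN p = 2 * ((p 0 - p 1) * (p 2 - p 0) * (p 2 - p 1)) := by
  simp only [dB, dM, dA, dN]
  ring

theorem dB_mul_dM_sub_ne_zero {p : State} (hp : Function.Injective p) :
    dB p * dM p - dA p * dN p ≠ 0 := by
  rw [dB_mul_dM_sub]
  exact mul_ne_zero two_ne_zero (mul_ne_zero (mul_ne_zero
    (sub_ne_zero_of_injective hp (by decide)) (sub_ne_zero_of_injective hp (by decide)))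
    (sub_ne_zero_of_injective hp (by decide)))

theorem tMetric_eq {p : State} (hp : Function.Injective p) (hf : ∀ i, f i (p i) ≠ 0)
    (i j : Fin 3) : tMetric f p i j = (dM p - dN p * linSpeed p i) * (dM p - dN p * linSpeed p j)
      / (dB p * dM p - dA p * dN p) ^ 2 * linMetric f p i j := by
  have h01 : p 0 - p 1 ≠ 0 := sub_ne_zero_of_injective hp (by decide)
  have h02 : p 0 - p 2 ≠ 0 := sub_ne_zero_of_injective hp (by decide)
  have h12 : p 1 - p 2 ≠ 0 := sub_ne_zero_of_injective hp (by decide)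
  have h10 : p 1 - p 0 ≠ 0 := sub_ne_zero_of_injective hp (by decide)
  have h20 : p 2 - p 0 ≠ 0 := sub_ne_zero_of_injective hp (by decide)
  have h21 : p 2 - p 1 ≠ 0 := sub_ne_zero_of_injective hp (by decide)
  have f0 := hf 0
  have f1 := hf 1
  have f2 := hf 2
  rw [dB_mul_dM_sub]
  fin_cases i <;> fin_cases j <;>
    simp [tMetric, linMetric, gUp, linSpeed, kap, dM, dN, prodDiff_zero, prodDiff_one,
      prodDiff_two] <;> field_simp <;> ring

/-! ### The metric of the linear system -/

theorem kap_ne_zero (i : Fin 3) : kap i ≠ 0 := by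
  fin_cases i <;> norm_num [kap]

theorem hasGrad_kap_mul (hI : ∀ i, IsOpen (I i)) (h : SmoothPrimitive I f F) {p : State}
    (hp : p ∈ Box I) (i : Fin 3) : HasGrad (fun q => kap i * f i (q i))
      (fun k => kap i * (deriv (f i) (p i) * kron k i)) p :=
  (HasGrad.comp_coord (h.hasDerivAt hI (hp i))).const_mul (kap i)

theorem christoffel_linMetric (hI : ∀ i, IsOpen (I i)) (h : Admissible I f F) {p : State}
    (hp : p ∈ Box I) (i s k : Fin 3) : christoffel (linMetric f) i s k p
      = kron i s * kron i k * (-(1 / 2) * (deriv (f i) (p i) / f i (p i))) := by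
  have hf : ∀ i, f i (p i) ≠ 0 := fun i => ((h i).2 _ (hp i)).1
  refine (christoffel_diagonal (hasGrad_kap_mul hI h.smoothPrimitive hp)
    (fun i => mul_ne_zero (kap_ne_zero i) (hf i)) i s k).trans ?_
  have := hf i
  have := hf s
  have := kap_ne_zero i
  have := kap_ne_zero s
  by_cases h1 : i = s
  · subst h1
    by_cases h2 : i = k
    · subst h2
      simp only [kron, if_true]
      field_simp
      ring
    · simp [kron, h2]
      simp [Ne.symm h2]
  · by_cases h2 : i = k
    · subst h2
      simp [kron, h1, Ne.symm h1]
    · simp [kron, h1, h2]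

/-- The only Christoffel symbols are `Γ^i_{ii}`, and they depend on `u^i` alone, so no curvature can
arise. -/
theorem linMetric_flat (hI : ∀ i, IsOpen (I i)) (h : Admissible I f F) :
    FlatOn (Box I) (linMetric f) := by
  intro p hp i j k l
  have hf : ∀ i, f i (p i) ≠ 0 := fun i => ((h i).2 _ (hp i)).1
  refine (curvature_diagonal (fun i => mul_ne_zero (kap_ne_zero i) (hf i)) i j k l).trans ?_
  change _ * riemann (linMetric f) i j k l p = 0
  have hd : ∀ k l, pd k (christoffel (linMetric f) i l j) p
      = kron i l * kron i j * (deriv (fun s => -(1 / 2) * (deriv (f i) s / f i s)) (p i)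
        * kron k i) := by
    intro k l
    rw [pd_congr (isOpen_box hI) (fun q hq => christoffel_linMetric hI h hq i l j) hp]
    refine ((HasGrad.comp_coord (φ := fun s => -(1 / 2) * (deriv (f i) s / f i s))
      (DifferentiableAt.hasDerivAt ?_)).const_mul _).2 k
    exact ((h.smoothPrimitive.hasDerivAt_deriv hI (hp i)).differentiableAt.div
      (h.smoothPrimitive.hasDerivAt hI (hp i)).differentiableAt (hf i)).const_mul _
  unfold riemann
  simp only [hd, christoffel_linMetric hI h hp]
  refine mul_eq_zero_of_right _ ?_
  have e1 : ∀ k l, ∑ m, kron i k * kron i m * (-(1 / 2) * (deriv (f i) (p i) / f i (p i)))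
      * (kron m l * kron m j * (-(1 / 2) * (deriv (f m) (p m) / f m (p m))))
      = kron i k * kron i l * kron i j * (-(1 / 2) * (deriv (f i) (p i) / f i (p i))) ^ 2 := by
    intro k l
    rw [Finset.sum_eq_single i (fun m _ hm => by simp [kron, hm.symm]) (by simp)]
    simp only [kron, if_true]
    ring
  have e2 : ∀ k, kron k i = kron i k := fun k => by simp [kron, eq_comm]
  rw [Finset.sum_sub_distrib, e1, e1, e2, e2]
  ring

/-- Coefficients `b^{ij}_k` of the operator of the linear system. -/
def linB (f : Fin 3 → ℝ → ℝ) (i j k : Fin 3) (p : State) : ℝ :=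
  kron i j * kron i k * ((1 / 2) * (kap i * deriv (f i) (p i)))

theorem linOp_eq_dnOp (hI : ∀ i, IsOpen (I i)) (h : Admissible I f F) {u : ℝ → State} {x : ℝ}
    (hu : u x ∈ Box I) (c : ℝ → State) : linOp f u c x = dnOp (linMetric f) u c x := by
  have hf : ∀ i, f i (u x i) ≠ 0 := fun i => ((h i).2 _ (hu i)).1
  ext i
  refine Eq.trans ?_ (dnOp_diagonal (fun i => mul_ne_zero (kap_ne_zero i) (hf i)) c i).symm
  have hc := fun j k => christoffel_linMetric hI h hu j i k
  unfold linMetric at hc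
  simp only [hc, linOp]
  congr 1
  rw [Finset.sum_eq_single i (fun m _ hm => by simp [kron, hm]) (by simp),
    Finset.sum_eq_single i (fun m _ hm => by simp [kron, hm.symm]) (by simp)]
  have := hf i
  simp only [kron, if_true]
  field_simp

/-- An empty index type for the tail brings the local operator under the general criterion. -/
theorem linOp_eq_genOp (f : Fin 3 → ℝ → ℝ) (u c : ℝ → State) :
    linOp f u c = genOp (A := Empty) (fun i p => kap i * f i (p i)) (linB f)
      (fun α => α.elim) (fun α => α.elim) u c := by
  ext x i
  simp only [linOp, genOp, tailOp, linB, Finset.univ_eq_empty, Finset.sum_empty, add_zero]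
  congr 1
  rw [Finset.sum_eq_single i (fun m _ hm => by simp [kron, hm.symm]) (by simp),
    Finset.sum_eq_single i (fun m _ hm => by simp [kron, hm.symm]) (by simp)]
  simp only [kron, if_true]
  ring

theorem linOp_isHamiltonian (hI : ∀ i, IsOpen (I i)) (h : Admissible I f F) :
    IsHamiltonian (Box I) (linOp f) := by
  have hs := h.smoothPrimitive
  have hcoord : ∀ i, ContDiffOn ℝ ∞ (fun p : State => kap i * f i (p i)) (Box I) := fun i =>
    contDiffOn_const.mul (contDiffOn_comp_coord (hs i).1)
  have hB : ∀ i j k, ContDiffOn ℝ ∞ (linB f i j k) (Box I) := fun i j k =>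
    contDiffOn_const.mul (contDiffOn_const.mul (contDiffOn_const.mul
      (contDiffOn_comp_coord (hs.contDiffOn_deriv hI i))))
  refine IsHamiltonian.congr (isOpen_box hI) ?_ fun u _ c _ => linOp_eq_genOp f u c
  refine genOp_isHamiltonian (A := Empty) (w := fun α => α.elim) (σ := id) (isOpen_box hI) hcoord
    hB (fun α => α.elim) (fun _ => rfl) ?_ ?_
  · intro p hp i j k
    rcases eq_or_ne i j with rfl | hij
    · rw [if_pos rfl, (hasGrad_kap_mul hI hs hp i).2 k]
      rcases eq_or_ne i k with rfl | hik
      · simp [linB, kron]; ring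
      · simp [linB, kron, hik, Ne.symm hik]
    · simp [linB, kron, hij, Ne.symm hij]
  · intro p hp ξ a a' c c' e e' P Q S
    have hf : ∀ i, f i (p i) ≠ 0 := fun i => ((h i).2 _ (hp i)).1
    have hd : ∀ k i m l, pd k (linB f i m l) p = kron i m * kron i l *
        ((1 / 2) * (kap i * (deriv (deriv (f i)) (p i) * kron k i))) := fun k i m l =>
      ((((HasGrad.comp_coord (hs.hasDerivAt_deriv hI (hp i))).const_mul _).const_mul _).const_mul
        _).2 k
    refine jacobi_of_connection (Γ := fun j i k => kron i j * kron i k *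
      (-(1 / 2) * (deriv (f i) (p i) / f i (p i)))) (fun _ => rfl) ?_ ?_ ?_ ?_ ξ a a' c c' e e' P Q S
    · intro i j k
      have := hf i
      have := hf j
      simp only [linB]
      rcases eq_or_ne i j with rfl | hij
      · field_simp
      · simp [kron, hij]
    · intro k l i m
      simp only [hd, Finset.univ_eq_empty, Finset.sum_empty, linB, Fin.sum_univ_three]
      fin_cases k <;> fin_cases l <;> fin_cases i <;> fin_cases m <;> simp [kron]
    · exact fun α => α.elim
    · intro i j k
      fin_cases i <;> fin_cases j <;> fin_cases k <;> simp [kron]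

end

section

variable {I : Fin 3 → Set ℝ} {f F f₁ F₁ f₂ F₂ : Fin 3 → ℝ → ℝ}

/-! ### Coincidence of the transformed operators -/

theorem SmoothPrimitive.exists_eq_add_const (hI : ∀ i, IsOpen (I i) ∧ (I i).OrdConnected)
    (h₁ : SmoothPrimitive I f₁ F₁) (h₂ : SmoothPrimitive I f₂ F₂)
    (he : ∀ i, EqOn (f₁ i) (f₂ i) (I i)) :
    ∃ κ : Fin 3 → ℝ, ∀ i, ∀ s ∈ I i, F₂ i s = F₁ i s + κ i := by
  have key : ∀ i, ∃ κ : ℝ, ∀ s ∈ I i, F₂ i s = F₁ i s + κ := fun i => by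
    obtain ⟨κ, hκ⟩ := (hI i).1.exists_eq_add_of_deriv_eq (hI i).2.isPreconnected
      (fun s hs => ((h₂ i).2 s hs).differentiableAt.differentiableWithinAt)
      (fun s hs => ((h₁ i).2 s hs).differentiableAt.differentiableWithinAt)
      (fun s hs => by rw [((h₂ i).2 s hs).deriv, ((h₁ i).2 s hs).deriv, he i hs])
    exact ⟨κ, hκ⟩
  choose κ hκ using key
  exact ⟨κ, hκ⟩

/-- Antiderivatives on an interval differ by constants. With `K` their sum, `μ` changes by `-K` and
`λ` by `K η`, so the tail gains `K η⊗1 - K 1⊗η - K η⊗1 + K 1⊗η = 0`. -/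
theorem tOp_eq_of_eqOn (hI : ∀ i, IsOpen (I i) ∧ (I i).OrdConnected)
    (h₁ : SmoothPrimitive I f₁ F₁) (h₂ : SmoothPrimitive I f₂ F₂)
    (he : ∀ i, EqOn (f₁ i) (f₂ i) (I i)) {u c : ℝ → State} (hu : u ∈ Fields (Dom I))
    (hc : c ∈ Test) (x : ℝ) : tOp f₁ F₁ u c x = tOp f₂ F₂ u c x := by
  have hIo := fun i => (hI i).1
  obtain ⟨κ, hκ⟩ := h₁.exists_eq_add_const hI h₂ he
  have hd : ∀ p ∈ Dom I, ∀ i, deriv (f₂ i) (p i) = deriv (f₁ i) (p i) := fun p hp i =>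
    ((he i).eventuallyEq_of_mem ((hIo i).mem_nhds (hp.1 i))).symm.deriv_eq
  have hf : ∀ p ∈ Dom I, ∀ i, f₂ i (p i) = f₁ i (p i) := fun p hp i => (he i (hp.1 i)).symm
  have hF : ∀ p ∈ Dom I, ∀ i, F₂ i (p i) = F₁ i (p i) + κ i := fun p hp i => hκ i _ (hp.1 i)
  have hmu : ∀ p ∈ Dom I, ∀ i, mu f₂ F₂ p i = mu f₁ F₁ p i - ∑ i, κ i := by
    intro p hp i
    simp only [mu, fluxR, fluxP, hd p hp, hf p hp, hF p hp, Fin.sum_univ_three]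
    ring
  have hlam : ∀ p ∈ Dom I, ∀ i, lam f₂ F₂ p i = lam f₁ F₁ p i + (∑ i, κ i) * eta p i := by
    intro p hp i
    simp only [lam, fluxQ, fluxS, hd p hp, hf p hp, hF p hp, Fin.sum_univ_three]
    ring
  have hint : ∀ w : State → State, (∀ i, ContDiffOn ℝ ∞ (fun p => w p i) (Box I)) →
      Integrable (tailDensity w u c) := fun w hw =>
    (tailDensity_contDiff (fun i => (hw i).mono dom_subset_box)
      hu.1 hc).continuous.integrable_of_hasCompactSupport (tailDensity_hasCompactSupport w u hc)
  have t1 : dinv (tailDensity (mu f₂ F₂) u c) x = 1 * dinv (tailDensity (mu f₁ F₁) u c) x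
      + -(∑ i, κ i) * dinv (tailDensity (fun _ _ => 1) u c) x := by
    rw [← dinv_add_mul (hint _ (contDiffOn_mu hIo h₁)) (hint _ fun i => contDiffOn_const)]
    congr 1
    ext y
    simp only [tailDensity, hmu _ (hu.1.2 y)]
    simp only [Fin.sum_univ_three]
    ring
  have t2 : dinv (tailDensity (lam f₂ F₂) u c) x = 1 * dinv (tailDensity (lam f₁ F₁) u c) x
      + (∑ i, κ i) * dinv (tailDensity eta u c) x := by
    rw [← dinv_add_mul (hint _ (contDiffOn_lam hIo h₁))
      (hint _ fun i => (contDiff_eta i).contDiffOn)]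
    congr 1
    ext y
    simp only [tailDensity, hlam _ (hu.1.2 y)]
    simp only [Fin.sum_univ_three]
    ring
  have hp := hu.1.2 x
  ext i
  simp only [tOp, tailOp_eq, Fin.sum_univ_four, tailL, tailR, Matrix.cons_val, Pi.add_apply, t1, t2,
    hmu _ hp, hlam _ hp, tLocal, tMat, gUp, hf _ hp, hd _ hp]
  ring

/-- Non-empty open sets of reals are infinite, so the two other coordinates can avoid finitely many
values. -/
theorem exists_mem_dom (hI : ∀ i, IsOpen (I i) ∧ (I i).OrdConnected ∧ (I i).Nonempty) (i : Fin 3)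
    {s : ℝ} (hs : s ∈ I i) : ∃ p ∈ Dom I, p i = s := by
  have hinf : ∀ j, (I j).Infinite := fun j => by
    obtain ⟨t, ht⟩ := (hI j).2.2
    exact infinite_of_mem_nhds t ((hI j).1.mem_nhds ht)
  obtain ⟨t, ht, hts⟩ := (hinf (i + 1)).exists_notMem_finset {s}
  obtain ⟨r, hr, hrs⟩ := (hinf (i + 2)).exists_notMem_finset {s, t}
  simp only [Finset.mem_singleton, Finset.mem_insert, not_or] at hts hrs
  refine ⟨fun j => if j = i then s else if j = i + 1 then t else r, ⟨fun j => ?_, ?_⟩, by simp⟩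
  · fin_cases i <;> fin_cases j <;> simpa using by assumption
  · rw [injective_state_iff]
    fin_cases i <;> simp <;> tauto

theorem exists_test_deriv_ne_zero (i : Fin 3) :
    ∃ c ∈ Test, ∃ x, deriv (fun y => c y i) x ≠ 0 := by
  let φ : ContDiffBump (0 : ℝ) := ⟨1, 2, one_pos, one_lt_two⟩
  refine ⟨fun y => Pi.single i (φ y), ⟨?_, ?_⟩, ?_⟩
  · rw [contDiff_pi]
    intro j
    rcases eq_or_ne j i with rfl | hj
    · simpa using φ.contDiff
    · simpa [hj] using contDiff_const
  · exact φ.hasCompactSupport.comp_left (g := fun t : ℝ => (Pi.single i t : State))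
      (Pi.single_zero i)
  · by_contra! hz
    simp only [Pi.single_eq_same] at hz
    have h1 := is_const_of_deriv_eq_zero (φ.contDiff (n := 1)).differentiable_one hz 0 2
    have h2 : φ 2 = 0 := φ.zero_of_le_dist (by norm_num [φ])
    have h3 : φ 0 = 1 := φ.one_of_mem_closedBall (by simp [φ])
    rw [h2, h3] at h1
    exact one_ne_zero h1

/-- Every term except `g d/dx` contains a factor `u_x`. -/
theorem tOp_const_field (p : State) (c : ℝ → State) (x : ℝ) (i : Fin 3) :
    tOp f F (fun _ => p) c x i = gUp f p i * deriv (fun y => c y i) x := by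
  have h0 : ∀ k y, dx (fun _ => p) k y = 0 := fun k y => by simp [dx]
  simp only [tOp, tailOp, tLocal, Pi.add_apply, h0, mul_zero, zero_mul, Finset.sum_const_zero,
    add_zero]
  simp [tMat]

theorem tOp_eq_iff (hI : ∀ i, IsOpen (I i) ∧ (I i).OrdConnected ∧ (I i).Nonempty)
    (h₁ : SmoothPrimitive I f₁ F₁) (h₂ : SmoothPrimitive I f₂ F₂) :
    (∀ u ∈ Fields (Dom I), ∀ c ∈ Test, ∀ x, tOp f₁ F₁ u c x = tOp f₂ F₂ u c x) ↔
      ∀ i, EqOn (f₁ i) (f₂ i) (I i) := by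
  refine ⟨fun h i s hs => ?_, fun h u hu c hc x =>
    tOp_eq_of_eqOn (fun i => ⟨(hI i).1, (hI i).2.1⟩) h₁ h₂ h hu hc x⟩
  obtain ⟨p, hp, rfl⟩ := exists_mem_dom hI i hs
  obtain ⟨c, hc, x, hx⟩ := exists_test_deriv_ne_zero i
  have hu : (fun _ : ℝ => p) ∈ Fields (Dom I) := by
    refine ⟨⟨contDiff_const, fun _ => hp⟩, ?_⟩
    rw [deriv_const']
    exact HasCompactSupport.zero
  have e := congrFun (h _ hu c hc x) i
  rw [tOp_const_field, tOp_const_field] at e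
  exact mul_left_cancel₀ (pow_ne_zero 2 (prodDiff_ne_zero hp.2 i)) (mul_right_cancel₀ hx e)

/-! ### Constant functions -/

variable {a : Fin 3 → ℝ}

theorem lam_const (a : Fin 3 → ℝ) (p : State) (i : Fin 3) :
    lam (fun i _ => a i) (fun i s => a i * s) p i
      = 2 * (p (i + 1) * p (i + 2)) * (a 0 + a 1 + a 2) := by
  simp only [lam, prodDiff, eta, fluxS, fluxQ, deriv_const, Fin.sum_univ_three]
  fin_cases i <;> simp <;> ring

theorem mu_const (a : Fin 3 → ℝ) (p : State) (i : Fin 3) :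
    mu (fun i _ => a i) (fun i s => a i * s) p i = -(1 / 2) * eta p i * (a 0 + a 1 + a 2) := by
  simp only [mu, fluxR, fluxP, deriv_const, Fin.sum_univ_three]
  ring

theorem admissible_const (ha : ∀ i, a i ≠ 0) :
    Admissible I (fun i _ => a i) (fun i s => a i * s) := fun i =>
  ⟨contDiffOn_const, fun s _ => ⟨ha i, by simpa using (hasDerivAt_id s).const_mul (a i)⟩⟩

theorem sum_eq_zero_of_flat (hI : ∀ i, IsOpen (I i) ∧ (I i).OrdConnected ∧ (I i).Nonempty)
    (ha : ∀ i, a i ≠ 0) (hflat : FlatOn (Dom I) (tMetric fun i _ => a i)) :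
    a 0 + a 1 + a 2 = 0 := by
  obtain ⟨s, hs⟩ := (hI 0).2.2
  obtain ⟨p, hp, -⟩ := exists_mem_dom hI 0 hs
  have h := hflat p hp 0 1 0 1
  rw [curvature_tMetric (fun i => (hI i).1) (admissible_const ha) hp] at h
  simp only [lam_const, mu_const, eta_zero, eta_one] at h
  simp at h
  have h20 : p 2 - p 0 ≠ 0 := sub_ne_zero_of_injective hp.2 (by decide)
  have h21 : p 2 - p 1 ≠ 0 := sub_ne_zero_of_injective hp.2 (by decide)
  -- Up to sign, the sectional component `R^{01}_{01}` is this product, whose first factor is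
  -- non-zero on the domain.
  refine (mul_eq_zero.1 (?_ : ((p 2 - p 0) * (p 2 - p 1)) * (a 0 + a 1 + a 2) = 0)).resolve_left
    (mul_ne_zero h20 h21)
  linear_combination -h

theorem tMetric_const_flat (hI : ∀ i, IsOpen (I i)) (ha : ∀ i, a i ≠ 0)
    (h0 : a 0 + a 1 + a 2 = 0) : FlatOn (Dom I) (tMetric fun i _ => a i) := by
  intro p hp i j k l
  rw [curvature_tMetric hI (admissible_const ha) hp]
  simp only [lam_const, mu_const, h0]
  ring

/-- Independence of the antiderivatives allows linear ones, for which `λ` and `μ` vanish and the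
tail disappears. -/
theorem tOp_const_eq_dnOp (hI : ∀ i, IsOpen (I i) ∧ (I i).OrdConnected) (ha : ∀ i, a i ≠ 0)
    (h0 : a 0 + a 1 + a 2 = 0) (hF : Admissible I (fun i _ => a i) F) {u c : ℝ → State}
    (hu : u ∈ Fields (Dom I)) (hc : c ∈ Test) (x : ℝ) :
    tOp (fun i _ => a i) F u c x = dnOp (tMetric fun i _ => a i) u c x := by
  rw [tOp_eq_of_eqOn hI hF.smoothPrimitive (admissible_const ha).smoothPrimitive
    (fun i => eqOn_refl _ _) hu hc, ← tLocal_eq_dnOp (fun i => (hI i).1) hF (hu.1.2 x)]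
  ext i
  simp [tOp, tailOp, Fin.sum_univ_four, tailL, tailR, lam_const, mu_const, h0, dinv]

end

section

variable {Ω : Set State} {I : Fin 3 → Set ℝ} {f F : Fin 3 → ℝ → ℝ}

/-! ### Commuting flows -/

theorem contDiff_flow {z : State → State} (hz : ∀ i, ContDiffOn ℝ ∞ (fun p => z p i) Ω)
    {u : ℝ → State} (hu : u ∈ SmoothFields Ω) : ContDiff ℝ ∞ (flow z u) :=
  contDiff_pi.2 fun i => (contDiff_comp_field (hz i) hu).mul (contDiff_dx hu.1 i)

theorem hasDerivAt_flow_add_smul (hΩ : IsOpen Ω) {v z : State → State}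
    (hv : ∀ i, ContDiffOn ℝ ∞ (fun p => v p i) Ω) (hz : ∀ i, ContDiffOn ℝ ∞ (fun p => z p i) Ω)
    {u : ℝ → State} (hu : u ∈ SmoothFields Ω) (x : ℝ) (i : Fin 3) :
    HasDerivAt (fun ε : ℝ => flow v (u + ε • flow z u) x i)
      ((∑ k, pd k (fun p => v p i) (u x) * (z (u x) k * dx u k x)) * dx u i x
        + v (u x) i * ((∑ k, pd k (fun p => z p i) (u x) * dx u k x) * dx u i x
          + z (u x) i * deriv (dx u i) x)) 0 := by
  have hX := contDiff_flow hz hu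
  have hd : ∀ {g : State → ℝ}, ContDiffOn ℝ ∞ g Ω → DifferentiableAt ℝ g (u x) := fun hg =>
    (hg.differentiableOn (by simp)).differentiableAt (hΩ.mem_nhds (hu.2 x))
  have h1 : HasDerivAt (fun ε : ℝ => (u + ε • flow z u) x) (flow z u x) 0 := by
    simpa using (((hasDerivAt_id (0 : ℝ)).smul_const (flow z u x)).const_add (u x))
  have h0 : (u + (0 : ℝ) • flow z u) x = u x := by simp
  have h2 : HasDerivAt (fun ε : ℝ => v ((u + ε • flow z u) x) i)
      (∑ k, pd k (fun p => v p i) (u x) * (z (u x) k * dx u k x)) 0 := by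
    have := (h0.symm ▸ (hd (hv i)).hasFDerivAt : HasFDerivAt (fun p => v p i)
      (fderiv ℝ (fun p => v p i) (u x)) ((u + (0 : ℝ) • flow z u) x)).comp_hasDerivAt 0 h1
    rw [fderiv_eq_sum_pd] at this
    exact this
  have h3 : HasDerivAt (fun ε : ℝ => dx (u + ε • flow z u) i x) (dx (flow z u) i x) 0 := by
    simp only [dx_add_smul hu.1 hX]
    simpa using ((hasDerivAt_id (0 : ℝ)).mul_const (dx (flow z u) i x)).const_add (dx u i x)
  have h4 : dx (flow z u) i x = (∑ k, pd k (fun p => z p i) (u x) * dx u k x) * dx u i x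
      + z (u x) i * deriv (dx u i) x :=
    ((hasDerivAt_comp_field (hd (hz i)) hu.1).mul
      ((contDiff_dx hu.1 i).differentiable (by simp) x).hasDerivAt).deriv
  have h5 := h2.mul h3
  rw [h4] at h5
  simp only [zero_smul, add_zero] at h5
  exact h5

/-- The terms with `u_xx` and the diagonal derivatives agree for both orders; the hypothesis
compares the coefficients of `u^k_x u^i_x` with `k ≠ i`. -/
theorem flowsCommute_of_pd (hΩ : IsOpen Ω) {v z : State → State}
    (hv : ∀ i, ContDiffOn ℝ ∞ (fun p => v p i) Ω) (hz : ∀ i, ContDiffOn ℝ ∞ (fun p => z p i) Ω)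
    (h : ∀ p ∈ Ω, ∀ k i, k ≠ i → pd k (fun p => v p i) p * (z p k - z p i)
      = pd k (fun p => z p i) p * (v p k - v p i)) : FlowsCommute Ω v z := by
  intro u hu x i
  refine ⟨_, hasDerivAt_flow_add_smul hΩ hv hz hu x i, ?_⟩
  convert hasDerivAt_flow_add_smul hΩ hz hv hu x i using 1
  have hk : ∀ k, pd k (fun p => v p i) (u x) * (z (u x) k - z (u x) i)
      = pd k (fun p => z p i) (u x) * (v (u x) k - v (u x) i) := by
    intro k
    rcases eq_or_ne k i with rfl | hki
    · simp
    · exact h _ (hu.2 x) k i hki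
  simp only [Fin.sum_univ_three]
  linear_combination dx u i x * (dx u 0 x * hk 0 + dx u 1 x * hk 1 + dx u 2 x * hk 2)

theorem contDiffOn_nSpeed (hI : ∀ i, IsOpen (I i)) (h : SmoothPrimitive I f F) (i : Fin 3) :
    ContDiffOn ℝ ∞ (fun p => nSpeed f p i) (Box I) := by
  have hd := fun i => contDiffOn_comp_coord (h.contDiffOn_deriv hI i)
  fin_cases i <;> exact contDiffOn_const.mul (hd _)

theorem contDiffOn_bSpeed (hI : ∀ i, IsOpen (I i)) (h : SmoothPrimitive I f F) (i : Fin 3) :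
    ContDiffOn ℝ ∞ (fun p => bSpeed f p i) (Box I) := by
  have hf := fun i => contDiffOn_comp_coord (h i).1
  have hd := fun i => contDiffOn_comp_coord (h.contDiffOn_deriv hI i)
  have hc : ∀ i : Fin 3, ContDiffOn ℝ ∞ (fun p : State => p i) (Box I) := fun i =>
    (contDiff_apply ℝ ℝ i).contDiffOn
  fin_cases i
  · exact ((contDiffOn_const.mul (hf 0)).add ((hc 0).mul (hd 0))).neg
  · exact ((contDiffOn_const.mul (hf 1)).add ((hc 1).mul (hd 1))).neg
  · exact (hf 2).add ((contDiffOn_const.mul (hc 2)).mul (hd 2))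

theorem pd_nSpeed (hI : ∀ i, IsOpen (I i)) (h : SmoothPrimitive I f F) {p : State}
    (hp : p ∈ Box I) {k i : Fin 3} (hki : k ≠ i) : pd k (fun p => nSpeed f p i) p = 0 := by
  have hd := fun i => HasGrad.comp_coord (h.hasDerivAt_deriv hI (hp i))
  have key : ∃ c, pd k (fun p => nSpeed f p i) p = c * kron k i := by
    fin_cases i
    · exact ⟨_, (((hd 0).const_mul (1 / 2)).2 k).trans (mul_assoc _ _ _).symm⟩
    · exact ⟨_, (((hd 1).const_mul (1 / 2)).2 k).trans (mul_assoc _ _ _).symm⟩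
    · exact ⟨_, (((hd 2).const_mul (-(1 / 4))).2 k).trans (mul_assoc _ _ _).symm⟩
  obtain ⟨c, hc⟩ := key
  rw [hc, kron, if_neg hki, mul_zero]

theorem pd_bSpeed (hI : ∀ i, IsOpen (I i)) (h : SmoothPrimitive I f F) {p : State}
    (hp : p ∈ Box I) {k i : Fin 3} (hki : k ≠ i) : pd k (fun p => bSpeed f p i) p = 0 := by
  have hf := fun i => HasGrad.comp_coord (h.hasDerivAt hI (hp i))
  have hd := fun i => HasGrad.comp_coord (h.hasDerivAt_deriv hI (hp i))
  have hc := fun i => HasGrad.coord i p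
  have h0 : kron k i = 0 := if_neg hki
  fin_cases i
  · refine ((((hf 0).const_mul 2).add ((hc 0).mul (hd 0))).neg.2 k).trans ?_
    simp_all
  · refine ((((hf 1).const_mul 2).add ((hc 1).mul (hd 1))).neg.2 k).trans ?_
    simp_all
  · refine (((hf 2).add (((hc 2).const_mul (1 / 2)).mul (hd 2))).2 k).trans ?_
    simp_all

theorem flowsCommute_linSpeed (hΩ : IsOpen Ω) {z : State → State}
    (hz : ∀ i, ContDiffOn ℝ ∞ (fun p => z p i) Ω)
    (h : ∀ p ∈ Ω, ∀ k i, k ≠ i → pd k (fun p => z p i) p = 0) : FlowsCommute Ω linSpeed z :=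
  flowsCommute_of_pd hΩ (fun _ => contDiffOn_const) hz fun p hp k i hki => by
    rw [h p hp k i hki]
    simp [linSpeed, pd]

theorem flowsCommute_eta (hI : ∀ i, IsOpen (I i)) (h : SmoothPrimitive I f F) (α : Fin 4) :
    FlowsCommute (Dom I) eta (tailR f F α) :=
  flowsCommute_of_pd (isOpen_dom hI) (fun i => (contDiff_eta i).contDiffOn)
    (fun i => (contDiffOn_tailR hI h α i).mono dom_subset_box) fun p hp k i hki => by
      rw [pd_tailR hI h hp α hki]
      have := pd_tailR hI h hp 1 hki
      change pd k (fun p => eta p i) p = (eta p k - eta p i) / _ at this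
      rw [this]
      ring

/-! ### Conservation laws -/

theorem pd_comp {n m : ℕ} {g : (Fin m → ℝ) → ℝ} {u : (Fin n → ℝ) → Fin m → ℝ} {y : Fin n → ℝ}
    (hg : DifferentiableAt ℝ g (u y)) (hu : DifferentiableAt ℝ u y) (j : Fin n) :
    pd j (fun z => g (u z)) y = ∑ i, pd i g (u y) * pd j (fun z => u z i) y := by
  have h1 : ∀ i, pd j (fun z => u z i) y = fderiv ℝ u y (Pi.single j 1) i := fun i => by
    have : HasFDerivAt (fun z => u z i) _ y := (hasFDerivAt_pi'.1 hu.hasFDerivAt) i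
    unfold pd
    rw [this.fderiv]
    rfl
  have h2 : HasFDerivAt (fun z => g (u z)) _ y := hg.hasFDerivAt.comp y hu.hasFDerivAt
  simp only [h1, ← fderiv_eq_sum_pd]
  unfold pd
  rw [h2.fderiv]
  rfl

/-- With speeds `W`, both mixed derivatives equal `∑ W_j W_k ∂θ_0/∂u ∂_0 u`, which is symmetric in
`j` and `k`. -/
theorem closedByVirtue_of_pd {m : ℕ} {V : Fin m → State → State} {θ : Fin (m + 1) → State → ℝ}
    (hθ : ∀ k, ∀ p ∈ Ω, DifferentiableAt ℝ (θ k) p)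
    (h : ∀ k i, ∀ p ∈ Ω, pd i (θ k.succ) p = V k p i * pd i (θ 0) p) :
    ClosedByVirtue Ω V θ := by
  intro D u hD hu huΩ hs y hy j k
  have hud := (hu.differentiableOn (by simp)).differentiableAt (hD.mem_nhds hy)
  have hW : ∃ W : Fin (m + 1) → Fin 3 → ℝ, ∀ k i, pd i (θ k) (u y) = W k i * pd i (θ 0) (u y) ∧
      pd k (fun z => u z i) y = W k i * pd 0 (fun z => u z i) y :=
    -- Giving the space variable itself the speed `1` treats all variables alike.
    ⟨Fin.cons (fun _ => 1) fun k => V k (u y), fun k i => by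
      refine Fin.cases ?_ (fun k => ?_) k
      · simp
      · simpa using ⟨h k i _ (huΩ hy), hs y hy k i⟩⟩
  obtain ⟨W, hW⟩ := hW
  rw [pd_comp (hθ k _ (huΩ hy)) hud, pd_comp (hθ j _ (huΩ hy)) hud]
  refine Finset.sum_congr rfl fun i _ => ?_
  rw [(hW k i).1, (hW j i).1, (hW k i).2, (hW j i).2]
  ring

theorem hasGrad_densities (p : State) :
    HasGrad dB ![-2 * p 0, -2 * p 1, 4 * p 2] p ∧ HasGrad dA ![-2 * p 0, 2 * p 1, 0] p ∧
    HasGrad dN ![1, 1, -2] p ∧ HasGrad dM ![1, -1, 0] p := by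
  have c := fun i => HasGrad.coord i p
  refine ⟨(((((c 2).pow 2).const_mul 2).sub ((c 0).pow 2)).sub ((c 1).pow 2)).congr_grad fun k => ?_,
    (((c 1).pow 2).sub ((c 0).pow 2)).congr_grad fun k => ?_,
    (((c 0).add (c 1)).sub ((c 2).const_mul 2)).congr_grad fun k => ?_,
    ((c 0).sub (c 1)).congr_grad fun k => ?_⟩ <;>
  fin_cases k <;> simp [kron]
  ring

theorem contDiff_densities : ContDiff ℝ ∞ dB ∧ ContDiff ℝ ∞ dA ∧ ContDiff ℝ ∞ dN ∧
    ContDiff ℝ ∞ dM := by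
  have c : ∀ i : Fin 3, ContDiff ℝ ∞ fun p : State => p i := fun i => contDiff_apply ℝ ℝ i
  exact ⟨((contDiff_const.mul ((c 2).pow 2)).sub ((c 0).pow 2)).sub ((c 1).pow 2),
    ((c 1).pow 2).sub ((c 0).pow 2), ((c 0).add (c 1)).sub (contDiff_const.mul (c 2)),
    (c 0).sub (c 1)⟩

theorem pd_dA (p : State) (i : Fin 3) : pd i dA p = linSpeed p i * pd i dB p := by
  obtain ⟨hB, hA, -, -⟩ := hasGrad_densities p
  rw [hB.2, hA.2]
  fin_cases i <;> simp [linSpeed]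

theorem pd_dM (p : State) (i : Fin 3) : pd i dM p = linSpeed p i * pd i dN p := by
  obtain ⟨-, -, hN, hM⟩ := hasGrad_densities p
  rw [hN.2, hM.2]
  fin_cases i <;> simp [linSpeed]

theorem pd_fluxes (hI : ∀ i, IsOpen (I i)) (h : SmoothPrimitive I f F) {p : State}
    (hp : p ∈ Box I) (i : Fin 3) :
    pd i (fluxP f F) p = nSpeed f p i * pd i dB p ∧ pd i (fluxQ f) p = bSpeed f p i * pd i dB p ∧
    pd i (fluxR f) p = nSpeed f p i * pd i dN p ∧ pd i (fluxS f F) p = bSpeed f p i * pd i dN p := by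
  obtain ⟨hB, -, hN, -⟩ := hasGrad_densities p
  obtain ⟨hQ, hR, hP, hS⟩ := hasGrad_fluxes hI h hp
  rw [hB.2, hN.2, hQ.2, hR.2, hP.2, hS.2]
  refine ⟨?_, ?_, ?_, ?_⟩ <;> fin_cases i <;> simp [nSpeed, bSpeed] <;> ring

theorem closedByVirtue_dB : ClosedByVirtue (Box I) ![linSpeed] ![dB, dA] := by
  refine closedByVirtue_of_pd (fun k p _ => ?_) fun k i p _ => ?_
  · obtain ⟨hB, hA, -, -⟩ := hasGrad_densities p
    fin_cases k
    exacts [hB.1, hA.1]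
  · fin_cases k
    exact pd_dA p i

theorem closedByVirtue_dN : ClosedByVirtue (Box I) ![linSpeed] ![dN, dM] := by
  refine closedByVirtue_of_pd (fun k p _ => ?_) fun k i p _ => ?_
  · obtain ⟨-, -, hN, hM⟩ := hasGrad_densities p
    fin_cases k
    exacts [hN.1, hM.1]
  · fin_cases k
    exact pd_dM p i

theorem closedByVirtue_extended_dB (hI : ∀ i, IsOpen (I i)) (h : SmoothPrimitive I f F) :
    ClosedByVirtue (Box I) ![linSpeed, nSpeed f, bSpeed f] ![dB, dA, fluxP f F, fluxQ f] := by
  refine closedByVirtue_of_pd (fun k p hp => ?_) fun k i p hp => ?_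
  · obtain ⟨hB, hA, -, -⟩ := hasGrad_densities p
    obtain ⟨hQ, -, hP, -⟩ := hasGrad_fluxes hI h hp
    fin_cases k
    exacts [hB.1, hA.1, hP.1, hQ.1]
  · obtain ⟨hP, hQ, -, -⟩ := pd_fluxes hI h hp i
    fin_cases k
    exacts [pd_dA p i, hP, hQ]

theorem closedByVirtue_extended_dN (hI : ∀ i, IsOpen (I i)) (h : SmoothPrimitive I f F) :
    ClosedByVirtue (Box I) ![linSpeed, nSpeed f, bSpeed f] ![dN, dM, fluxR f, fluxS f F] := by
  refine closedByVirtue_of_pd (fun k p hp => ?_) fun k i p hp => ?_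
  · obtain ⟨-, -, hN, hM⟩ := hasGrad_densities p
    obtain ⟨-, hR, -, hS⟩ := hasGrad_fluxes hI h hp
    fin_cases k
    exacts [hN.1, hM.1, hR.1, hS.1]
  · obtain ⟨-, -, hR, hS⟩ := pd_fluxes hI h hp i
    fin_cases k
    exacts [pd_dM p i, hR, hS]

theorem isLocalHamiltonianFlow_dN (Ω : Set State) (f : Fin 3 → ℝ → ℝ) :
    IsLocalHamiltonianFlow Ω (linOp f) dN (nSpeed f) := by
  intro u _ x i
  have hN : ∀ p, grad dN p = ![1, 1, -2] := fun p => funext (hasGrad_densities p).2.2.1.2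
  simp only [linOp, hN, deriv_const]
  fin_cases i <;> simp [nSpeed, kap] <;> ring

theorem isLocalHamiltonianFlow_dB (Ω : Set State) (f : Fin 3 → ℝ → ℝ) :
    IsLocalHamiltonianFlow Ω (linOp f) dB (bSpeed f) := by
  intro u hu x i
  have hB : ∀ p, grad dB p = ![-2 * p 0, -2 * p 1, 4 * p 2] := fun p =>
    funext (hasGrad_densities p).1.2
  have hd : ∀ (j : Fin 3) (c : ℝ), deriv (fun y => c * u y j) x = c * dx u j x := fun j c =>
    ((hasDerivAt_apply hu.1 j x).const_mul c).deriv
  simp only [linOp, hB]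
  fin_cases i
  · change kap 0 * _ * deriv (fun y => -2 * u y 0) x + _ = _
    rw [hd]
    simp [bSpeed, kap]
    ring
  · change kap 1 * _ * deriv (fun y => -2 * u y 1) x + _ = _
    rw [hd]
    simp [bSpeed, kap]
    ring
  · change kap 2 * _ * deriv (fun y => 4 * u y 2) x + _ = _
    rw [hd]
    simp [bSpeed, kap]
    ring

theorem flux_identities (f F : Fin 3 → ℝ → ℝ) (p : State) :
    fluxQ f p = (1 / 2) * ∑ i, kap i * f i (p i) * pd i dB p ^ 2 ∧
    fluxR f p = (1 / 2) * ∑ i, kap i * f i (p i) * pd i dN p ^ 2 ∧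
    fluxP f F p + fluxS f F p = ∑ i, kap i * f i (p i) * pd i dB p * pd i dN p := by
  obtain ⟨hB, -, hN, -⟩ := hasGrad_densities p
  simp only [hB.2, hN.2, fluxQ, fluxR, fluxP, fluxS, Fin.sum_univ_three]
  simp [kap]
  refine ⟨?_, ?_, ?_⟩ <;> ring

end

/-! ### Reciprocal transformations -/

section

theorem contDiffOn_of_pd {n : ℕ} {D : Set (Fin n → ℝ)} (hD : IsOpen D) {g : (Fin n → ℝ) → ℝ}
    (hg : DifferentiableOn ℝ g D) (h : ∀ k, ContDiffOn ℝ ∞ (pd k g) D) : ContDiffOn ℝ ∞ g D := by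
  refine (contDiffOn_infty_iff_fderiv_of_isOpen hD).2 ⟨hg, ?_⟩
  have : fderiv ℝ g = fun z => ∑ k, pd k g z • (ContinuousLinearMap.proj k : (Fin n → ℝ) →L[ℝ] ℝ) := by
    funext z
    ext v
    simp [fderiv_eq_sum_pd]
  rw [this]
  exact ContDiffOn.sum fun k _ => (h k).smul contDiffOn_const

/-- The Poincaré lemma for one-forms, in terms of partial derivatives. -/
theorem exists_potential {n : ℕ} {s : Set (Fin n → ℝ)} (hs : Convex ℝ s) (hso : IsOpen s)
    {g : Fin n → (Fin n → ℝ) → ℝ} (hg : ∀ k, DifferentiableOn ℝ (g k) s)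
    (hsym : ∀ z ∈ s, ∀ j k, pd j (g k) z = pd k (g j) z) :
    ∃ X : (Fin n → ℝ) → ℝ, ∀ z ∈ s, DifferentiableAt ℝ X z ∧ ∀ k, pd k X z = g k z := by
  have hd : ∀ z ∈ s, HasFDerivAt
      (fun z => ∑ k, g k z • (ContinuousLinearMap.proj k : (Fin n → ℝ) →L[ℝ] ℝ))
      (∑ k, (fderiv ℝ (g k) z).smulRight (ContinuousLinearMap.proj k : (Fin n → ℝ) →L[ℝ] ℝ)) z :=
    fun z hz => HasFDerivAt.fun_sum fun k _ =>
      ((hg k).differentiableAt (hso.mem_nhds hz)).hasFDerivAt.smul_const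
        (ContinuousLinearMap.proj k : (Fin n → ℝ) →L[ℝ] ℝ)
  obtain ⟨X, hX⟩ := hs.exists_forall_hasFDerivAt_of_fderiv_symmetric hso
    (fun z hz => (hd z hz).differentiableAt.differentiableWithinAt) (fun z hz x y => by
      rw [(hd z hz).fderiv]
      simp only [sum_apply, ContinuousLinearMap.smulRight_apply, smul_apply,
        ContinuousLinearMap.proj_apply, smul_eq_mul, fderiv_eq_sum_pd, Finset.sum_mul]
      rw [Finset.sum_comm]
      refine Finset.sum_congr rfl fun j _ => Finset.sum_congr rfl fun k _ => ?_
      rw [hsym z hz j k]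
      ring)
  refine ⟨X, fun z hz => ⟨(hX z hz).differentiableAt, fun k => ?_⟩⟩
  unfold pd
  rw [(hX z hz).fderiv]
  simp [Pi.single_apply]

variable {m : ℕ} {Ω : Set State} {θ σ : Fin (m + 2) → State → ℝ}
  {D : Set (Fin (m + 2) → ℝ)} {u : (Fin (m + 2) → ℝ) → State}
  {X : (Fin (m + 2) → ℝ) → (Fin (m + 2) → ℝ)}

theorem contDiffOn_comp {n : ℕ} {D : Set (Fin n → ℝ)} {u : (Fin n → ℝ) → State} {g : State → ℝ}
    (hg : ContDiffOn ℝ ∞ g Ω) (hu : ContDiffOn ℝ ∞ u D) (huΩ : MapsTo u D Ω) :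
    ContDiffOn ℝ ∞ (fun z => g (u z)) D := hg.comp hu huΩ

theorem IsReciprocal.pd_rest (hD : IsOpen D) (hX : IsReciprocal θ σ D u X) {y : Fin (m + 2) → ℝ}
    (hy : y ∈ D) (l : Fin m) (k : Fin (m + 2)) :
    pd k (fun z => X z l.succ.succ) y = if l.succ.succ = k then 1 else 0 := by
  rw [pd_congr hD (fun z hz => (hX.2 z hz).2.2 l) hy]
  unfold pd
  rw [(hasFDerivAt_apply l.succ.succ y).fderiv]
  simp [Pi.single_apply]

/-- New variables are only assumed differentiable, but their partial derivatives are prescribed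
smooth functions. -/
theorem IsReciprocal.contDiffOn (hD : IsOpen D) (hθ : ∀ k, ContDiffOn ℝ ∞ (θ k) Ω)
    (hσ : ∀ k, ContDiffOn ℝ ∞ (σ k) Ω) (hu : ContDiffOn ℝ ∞ u D) (huΩ : MapsTo u D Ω)
    (hX : IsReciprocal θ σ D u X) : ContDiffOn ℝ ∞ X D := by
  refine contDiffOn_pi.2 fun l => ?_
  refine contDiffOn_of_pd hD (differentiableOn_pi.1 hX.1 l) fun k => ?_
  refine Fin.cases ?_ (fun l => Fin.cases ?_ (fun l => ?_) l) l
  · exact (contDiffOn_comp (hθ k) hu huΩ).congr fun y hy => (hX.2 y hy).1 k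
  · exact (contDiffOn_comp (hσ k) hu huΩ).congr fun y hy => (hX.2 y hy).2.1 k
  · exact contDiffOn_const.congr fun y hy => hX.pd_rest hD hy l k

/-- The derivative of new variables is invertible. -/
theorem IsReciprocal.exists_equiv (hD : IsOpen D)
    (hdet : ∀ p ∈ Ω, θ 0 p * σ 1 p - θ 1 p * σ 0 p ≠ 0) (huΩ : MapsTo u D Ω)
    (hX : IsReciprocal θ σ D u X) {y : Fin (m + 2) → ℝ} (hy : y ∈ D) :
    ∃ L : (Fin (m + 2) → ℝ) ≃L[ℝ] (Fin (m + 2) → ℝ), HasFDerivAt X (L : _ →L[ℝ] _) y := by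
  have hd : DifferentiableAt ℝ X y := hX.1.differentiableAt (hD.mem_nhds hy)
  have hcomp : ∀ v l, fderiv ℝ X y v l = ∑ k, pd k (fun z => X z l) y * v k := fun v l => by
    have : HasFDerivAt (fun z => X z l) _ y := (hasFDerivAt_pi'.1 hd.hasFDerivAt) l
    rw [← fderiv_eq_sum_pd, this.fderiv]
    rfl
  have hinj : Function.Injective (fderiv ℝ X y).toLinearMap := by
    rw [← LinearMap.ker_eq_bot, LinearMap.ker_eq_bot']
    intro v hv
    have hv' : ∀ l, ∑ k, pd k (fun z => X z l) y * v k = 0 := fun l => by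
      rw [← hcomp]
      exact congrFun hv l
    -- The later variables are unchanged, so the kernel lies in the first two coordinates, where the
    -- determinant is non-zero.
    have hr : ∀ l : Fin m, v l.succ.succ = 0 := fun l => by
      have := hv' l.succ.succ
      simpa [hX.pd_rest hD hy] using this
    have h0 := hv' 0
    have h1 := hv' 1
    simp only [(hX.2 y hy).1, (hX.2 y hy).2.1, Fin.sum_univ_succ, hr, mul_zero,
      Finset.sum_const_zero, add_zero, Fin.succ_zero_eq_one] at h0 h1
    have hdt := hdet _ (huΩ hy)
    funext l
    refine Fin.cases ?_ (fun l => Fin.cases ?_ (fun l => hr l) l) l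
    · refine (mul_eq_zero.1 (?_ : _ * v 0 = 0)).resolve_left hdt
      linear_combination σ 1 (u y) * h0 - θ 1 (u y) * h1
    · refine (mul_eq_zero.1 (?_ : _ * v 1 = 0)).resolve_left hdt
      linear_combination θ 0 (u y) * h1 - σ 0 (u y) * h0
  refine ⟨(LinearEquiv.ofInjectiveEndo _ hinj).toContinuousLinearEquiv, ?_⟩
  convert hd.hasFDerivAt using 1
  ext v
  rfl

theorem IsReciprocal.pd_eq (hD : IsOpen D) (hX : IsReciprocal θ σ D u X)
    {u' : (Fin (m + 2) → ℝ) → State} (hu' : ∀ z ∈ D, u' (X z) = u z) {y : Fin (m + 2) → ℝ}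
    (hy : y ∈ D) (hd : DifferentiableAt ℝ u' (X y)) (i : Fin 3) :
    pd 0 (fun z => u z i) y = pd 0 (fun z => u' z i) (X y) * θ 0 (u y)
        + pd 1 (fun z => u' z i) (X y) * σ 0 (u y) ∧
    pd 1 (fun z => u z i) y = pd 0 (fun z => u' z i) (X y) * θ 1 (u y)
        + pd 1 (fun z => u' z i) (X y) * σ 1 (u y) ∧
    ∀ l : Fin m, pd l.succ.succ (fun z => u z i) y = pd 0 (fun z => u' z i) (X y) * θ l.succ.succ (u y)
        + pd 1 (fun z => u' z i) (X y) * σ l.succ.succ (u y)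
        + pd l.succ.succ (fun z => u' z i) (X y) := by
  have h : ∀ k, pd k (fun z => u z i) y = pd 0 (fun z => u' z i) (X y) * θ k (u y)
        + (pd 1 (fun z => u' z i) (X y) * σ k (u y) + ∑ l : Fin m,
          pd l.succ.succ (fun z => u' z i) (X y) * if l.succ.succ = k then 1 else 0) := by
    intro k
    rw [pd_congr hD (h := fun z => u' (X z) i) (fun z hz => by simp only [hu' z hz]) hy,
      pd_comp (g := fun w => u' w i) (differentiableAt_pi.1 hd i)
        (hX.1.differentiableAt (hD.mem_nhds hy))]
    simp only [Fin.sum_univ_succ, Fin.succ_zero_eq_one, (hX.2 y hy).1, (hX.2 y hy).2.1,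
      hX.pd_rest hD hy]
  have e1 : ∀ l : Fin m, l.succ.succ ≠ 1 := fun l e => Fin.succ_ne_zero l (Fin.succ_injective _ e)
  refine ⟨?_, ?_, fun l => ?_⟩
  · rw [h]; simp [Fin.succ_ne_zero]
  · rw [h]; simp [e1]
  · rw [h]; simp [add_assoc]

/-- The conditions `h0` and `h1` say that along `u'_t = V' u'_x` the chain rule `∂_k u = θ_k u'_x +
σ_k u'_t (+ u'_k)` reproduces the original equations. -/
theorem mapsSystem_of_speeds {V V' : Fin (m + 1) → State → State}
    (hθ : ∀ k, ContDiffOn ℝ ∞ (θ k) Ω) (hσ : ∀ k, ContDiffOn ℝ ∞ (σ k) Ω)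
    (hθc : ClosedByVirtue Ω V θ) (hσc : ClosedByVirtue Ω V σ)
    (hdet : ∀ p ∈ Ω, θ 0 p * σ 1 p - θ 1 p * σ 0 p ≠ 0)
    (h0 : ∀ p ∈ Ω, ∀ i, θ 1 p + σ 1 p * V' 0 p i = V 0 p i * (θ 0 p + σ 0 p * V' 0 p i))
    (h1 : ∀ p ∈ Ω, ∀ (l : Fin m) i, V' l.succ p i = V l.succ p i * (θ 0 p + σ 0 p * V' 0 p i)
      - θ l.succ.succ p - σ l.succ.succ p * V' 0 p i) :
    MapsSystem Ω θ σ V V' := by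
  intro D u hD hu huΩ
  have hsm : ∀ {g : State → ℝ}, ContDiffOn ℝ ∞ g Ω →
      DifferentiableOn ℝ (fun z => g (u z)) D := fun hg =>
    (contDiffOn_comp hg hu huΩ).differentiableOn (by simp)
  have hstrict : ∀ {D' : Set (Fin (m + 2) → ℝ)} {X}, D' ⊆ D → IsOpen D' → IsReciprocal θ σ D' u X →
      ∀ y ∈ D', ContDiffAt ℝ ∞ X y ∧
        ∃ L : (Fin (m + 2) → ℝ) ≃L[ℝ] (Fin (m + 2) → ℝ), HasFDerivAt X (L : _ →L[ℝ] _) y :=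
    fun hsub hD' hX y hy => ⟨(hX.contDiffOn hD' hθ hσ (hu.mono hsub)
      (huΩ.mono_left hsub)).contDiffAt (hD'.mem_nhds hy),
      hX.exists_equiv hD' hdet (huΩ.mono_left hsub) hy⟩
  refine ⟨fun hs y hy => ?_, fun X u' hX hu' => ?_⟩
  · obtain ⟨r, hr, hrD⟩ := Metric.isOpen_iff.1 hD y hy
    have hpot : ∀ {θ : Fin (m + 2) → State → ℝ}, (∀ k, ContDiffOn ℝ ∞ (θ k) Ω) →
        ClosedByVirtue Ω V θ → ∃ X : (Fin (m + 2) → ℝ) → ℝ, ∀ z ∈ Metric.ball y r,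
          DifferentiableAt ℝ X z ∧ ∀ k, pd k X z = θ k (u z) := fun hθ hc =>
      exists_potential (convex_ball y r) Metric.isOpen_ball (g := fun k z => _)
        (fun k => (hsm (hθ k)).mono hrD) fun z hz j k => hc D u hD hu huΩ hs z (hrD hz) j k
    obtain ⟨X₀, hX₀⟩ := hpot hθ hθc
    obtain ⟨X₁, hX₁⟩ := hpot hσ hσc
    let X : (Fin (m + 2) → ℝ) → (Fin (m + 2) → ℝ) := fun z =>
      Fin.cons (X₀ z) (Fin.cons (X₁ z) fun l => z l.succ.succ)
    have hrec : IsReciprocal θ σ (Metric.ball y r) u X := by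
      refine ⟨differentiableOn_pi.2 fun l => ?_, fun z hz => ⟨(hX₀ z hz).2, (hX₁ z hz).2,
        fun l => rfl⟩⟩
      refine Fin.cases ?_ (fun l => Fin.cases ?_ (fun l => ?_) l) l
      · exact fun z hz => (hX₀ z hz).1.differentiableWithinAt
      · exact fun z hz => (hX₁ z hz).1.differentiableWithinAt
      · exact (differentiable_apply l.succ.succ).differentiableOn
    obtain ⟨hc, L, hL⟩ := hstrict hrD Metric.isOpen_ball hrec y (Metric.mem_ball_self hr)
    have hst := hc.hasStrictFDerivAt' hL (by simp)
    -- Local injectivity comes from the inverse function theorem; `u'` is then `u` composed with an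
    -- inverse.
    have hinj : InjOn X (hst.toOpenPartialHomeomorph X).source :=
      (hst.toOpenPartialHomeomorph X).injOn
    refine ⟨Metric.ball y r ∩ (hst.toOpenPartialHomeomorph X).source, inter_subset_left.trans hrD,
      Metric.isOpen_ball.inter (hst.toOpenPartialHomeomorph X).open_source,
      ⟨Metric.mem_ball_self hr, hst.mem_toOpenPartialHomeomorph_source⟩, X,
      fun w => u (Function.invFunOn X (Metric.ball y r ∩ (hst.toOpenPartialHomeomorph X).source) w),
      ⟨hrec.1.mono inter_subset_left, fun z hz => hrec.2 z hz.1⟩, hinj.mono inter_subset_right,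
      fun z hz => ?_⟩
    exact congrArg u ((hinj.mono inter_subset_right).leftInvOn_invFunOn hz)
  · have hloc := hstrict subset_rfl hD hX
    -- Smoothness is local: near `X y` the field `u'` is `u` composed with a local inverse. Global
    -- injectivity of `X` is not needed, because `u' ∘ X = u` is given.
    have hud : ∀ y ∈ D, ContDiffAt ℝ ∞ u' (X y) := by
      intro y hy
      obtain ⟨hc, L, hL⟩ := hloc y hy
      have hg := hc.to_localInverse hL (by simp)
      have hst := hc.hasStrictFDerivAt' hL (by simp)
      have hgy : hst.localInverse X L y (X y) = y := hst.localInverse_apply_image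
      have hu2 : ContDiffAt ℝ ∞ u (hst.localInverse X L y (X y)) := by
        rw [hgy]
        exact hu.contDiffAt (hD.mem_nhds hy)
      refine (hu2.comp (X y) hg).congr_of_eventuallyEq ?_
      have hmem : ∀ᶠ w in 𝓝 (X y), hst.localInverse X L y w ∈ D :=
        hst.localInverse_tendsto (hD.mem_nhds hy)
      filter_upwards [hmem, hst.eventually_right_inverse] with w hw hw'
      rw [← hw', hu' _ hw]
      simp [hw']
    refine ⟨?_, ?_, ?_⟩
    · rw [isOpen_iff_mem_nhds]
      rintro _ ⟨y, hy, rfl⟩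
      obtain ⟨hc, L, hL⟩ := hloc y hy
      rw [← (hc.hasStrictFDerivAt' hL (by simp)).map_nhds_eq_of_equiv]
      exact image_mem_map (hD.mem_nhds hy)
    · rintro _ ⟨y, hy, rfl⟩
      exact (hud y hy).contDiffWithinAt
    · have hiff : ∀ y ∈ D, (∀ k i, pd k.succ (fun z => u z i) y
          = V k (u y) i * pd 0 (fun z => u z i) y) ↔ ∀ k i, pd k.succ (fun z => u' z i) (X y)
          = V' k (u' (X y)) i * pd 0 (fun z => u' z i) (X y) := by
        intro y hy
        rw [hu' y hy]
        have hp := huΩ hy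
        rw [forall_comm, forall_comm (α := Fin (m + 1))]
        refine forall_congr' fun i => ?_
        obtain ⟨e0, e1, e2⟩ := hX.pd_eq hD hu' hy ((hud y hy).differentiableAt (by simp)) i
        have k0 := h0 _ hp i
        -- If this factor vanished, `h0` would reduce to `θ₁ = V θ₀` and the determinant would be
        -- zero.
        have hne : σ 1 (u y) - V 0 (u y) i * σ 0 (u y) ≠ 0 := fun hz => hdet _ hp (by
          linear_combination θ 0 (u y) * hz - σ 0 (u y) * k0
            + σ 0 (u y) * V' 0 (u y) i * hz)
        rw [Fin.forall_fin_succ, Fin.forall_fin_succ, Fin.succ_zero_eq_one, e0, e1]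
        -- By `h0`, the difference of the two sides is this non-zero factor times `u'_t - V' u'_x`.
        have hfirst : pd 0 (fun z => u' z i) (X y) * θ 1 (u y)
            + pd 1 (fun z => u' z i) (X y) * σ 1 (u y)
            = V 0 (u y) i * (pd 0 (fun z => u' z i) (X y) * θ 0 (u y)
              + pd 1 (fun z => u' z i) (X y) * σ 0 (u y)) ↔
            pd 1 (fun z => u' z i) (X y) = V' 0 (u y) i * pd 0 (fun z => u' z i) (X y) := by
          constructor
          · intro h
            rw [← sub_eq_zero]
            refine (mul_eq_zero.1 (?_ : (σ 1 (u y) - V 0 (u y) i * σ 0 (u y)) * _ = 0)).resolve_left hne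
            linear_combination h - pd 0 (fun z => u' z i) (X y) * k0
          · intro h
            rw [h]
            linear_combination pd 0 (fun z => u' z i) (X y) * k0
        rw [hfirst]
        refine and_congr_right fun hh => forall_congr' fun l => ?_
        rw [e2, h1 _ hp l i, hh]
        constructor
        · intro h
          linear_combination h
        · intro h
          linear_combination h
      constructor
      · rintro hs _ ⟨y, hy, rfl⟩
        exact (hiff y hy).1 (hs y hy)
      · exact fun hs y hy => (hiff y hy).2 (hs _ ⟨y, hy, rfl⟩)

end

section

variable {I : Fin 3 → Set ℝ} {f F : Fin 3 → ℝ → ℝ}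

/-! ### The reciprocal transformations of the linear system -/

theorem ClosedByVirtue.mono {m : ℕ} {Ω Ω' : Set State} {V : Fin m → State → State}
    {θ : Fin (m + 1) → State → ℝ} (h : ClosedByVirtue Ω V θ) (hΩ : Ω' ⊆ Ω) :
    ClosedByVirtue Ω' V θ := fun D u hD hu huΩ => h D u hD hu (huΩ.mono_right hΩ)

theorem dA_add_dM_mul_eta (p : State) (i : Fin 3) :
    dA p + dM p * eta p i = linSpeed p i * (dB p + dN p * eta p i) := by
  simp only [dA, dM, dB, dN]
  fin_cases i <;> simp [linSpeed, eta_zero, eta_one, eta_two] <;> ring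

theorem mapsSystem_linear : MapsSystem (Dom I) ![dB, dA] ![dN, dM] ![linSpeed] ![eta] := by
  obtain ⟨hB, hA, hN, hM⟩ := contDiff_densities
  refine mapsSystem_of_speeds (m := 0) (fun k => ?_) (fun k => ?_)
    (closedByVirtue_dB.mono dom_subset_box) (closedByVirtue_dN.mono dom_subset_box)
    (fun p hp => dB_mul_dM_sub_ne_zero hp.2) (fun p _ i => dA_add_dM_mul_eta p i)
    (fun p _ l => l.elim0)
  · fin_cases k
    exacts [hB.contDiffOn, hA.contDiffOn]
  · fin_cases k
    exacts [hN.contDiffOn, hM.contDiffOn]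

/-- The defining formula of `μ` is thus the general transformation rule for speeds, since `B + N η`
is a multiple of the product of differences. The same holds for `λ`. -/
theorem mu_eq (f F : Fin 3 → ℝ → ℝ) (p : State) (i : Fin 3) : mu f F p i
    = nSpeed f p i * (dB p + dN p * eta p i) - fluxP f F p - fluxR f p * eta p i := by
  simp only [mu, dB, dN]
  fin_cases i <;> simp [nSpeed, eta_zero, eta_one, eta_two, prodDiff_zero, prodDiff_one,
    prodDiff_two] <;> ring

theorem lam_eq (f F : Fin 3 → ℝ → ℝ) (p : State) (i : Fin 3) : lam f F p i
    = bSpeed f p i * (dB p + dN p * eta p i) - fluxQ f p - fluxS f F p * eta p i := by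
  simp only [lam, dB, dN]
  fin_cases i <;> simp [bSpeed, eta_zero, eta_one, eta_two, prodDiff_zero, prodDiff_one,
    prodDiff_two] <;> ring

theorem mapsSystem_extended (hI : ∀ i, IsOpen (I i)) (h : SmoothPrimitive I f F) :
    MapsSystem (Dom I) ![dB, dA, fluxP f F, fluxQ f] ![dN, dM, fluxR f, fluxS f F]
      ![linSpeed, nSpeed f, bSpeed f] ![eta, mu f F, lam f F] := by
  obtain ⟨hB, hA, hN, hM⟩ := contDiff_densities
  obtain ⟨hQ, hR, hP, hS⟩ := contDiffOn_fluxes hI h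
  have hsub := dom_subset_box (I := I)
  refine mapsSystem_of_speeds (m := 2) (fun k => ?_) (fun k => ?_)
    ((closedByVirtue_extended_dB hI h).mono hsub) ((closedByVirtue_extended_dN hI h).mono hsub)
    (fun p hp => dB_mul_dM_sub_ne_zero hp.2) (fun p _ i => dA_add_dM_mul_eta p i)
    (fun p _ l i => ?_)
  · fin_cases k
    exacts [hB.contDiffOn, hA.contDiffOn, hP.mono hsub, hQ.mono hsub]
  · fin_cases k
    exacts [hN.contDiffOn, hM.contDiffOn, hR.mono hsub, hS.mono hsub]
  · fin_cases l
    exacts [mu_eq f F p i, lam_eq f F p i]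

/-! ### Hamiltonian densities of the linear system -/

theorem exists_primitive {s : Set ℝ} (hs : IsOpen s) (hc : s.OrdConnected) {g : ℝ → ℝ}
    (hg : ContDiffOn ℝ ∞ g s) : ∃ G : ℝ → ℝ, ContDiffOn ℝ ∞ G s ∧ ∀ t ∈ s, HasDerivAt G (g t) t := by
  obtain ⟨G, hG⟩ := hc.convex.exists_forall_hasDerivWithinAt (hg.differentiableOn (by simp))
  have hG' : ∀ t ∈ s, HasDerivAt G (g t) t := fun t ht => (hG t ht).hasDerivAt (hs.mem_nhds ht)
  exact ⟨G, (contDiffOn_infty_iff_deriv_of_isOpen hs).2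
    ⟨fun t ht => (hG' t ht).differentiableAt.differentiableWithinAt,
      hg.congr fun t ht => (hG' t ht).deriv⟩, hG'⟩

/-- A first order linear equation for `H'`, solved with an integrating factor and two quadratures.
-/
theorem exists_density_one {s : Set ℝ} (hs : IsOpen s) (hc : s.OrdConnected) {g : ℝ → ℝ}
    (hg : ContDiffOn ℝ ∞ g s) (h0 : ∀ t ∈ s, g t ≠ 0) (c : ℝ) : ∃ H H' : ℝ → ℝ,
      ContDiffOn ℝ ∞ H s ∧ ∀ t ∈ s, HasDerivAt H (H' t) t ∧ ∃ d, HasDerivAt H' d t ∧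
        g t * d + (1 / 2) * deriv g t * H' t = c := by
  have hgd : ∀ t ∈ s, HasDerivAt g (deriv g t) t := fun t ht =>
    ((hg.differentiableOn (by simp)).differentiableAt (hs.mem_nhds ht)).hasDerivAt
  -- This is `|g|^{-1/2}`: the real logarithm takes the absolute value, so negative `g` is included.
  let E : ℝ → ℝ := fun t => Real.exp (-(1 / 2) * Real.log (g t))
  have hE : ContDiffOn ℝ ∞ E s := (contDiffOn_const.mul (hg.log h0)).exp
  have hE0 : ∀ t, E t ≠ 0 := fun t => (Real.exp_pos _).ne'
  have hEd : ∀ t ∈ s, HasDerivAt E (E t * (-(1 / 2) * (deriv g t / g t))) t := fun t ht =>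
    (((hgd t ht).log (h0 t ht)).const_mul (-(1 / 2))).exp
  obtain ⟨K, hK, hKd⟩ := exists_primitive hs hc (g := fun t => c / (g t * E t))
    (contDiffOn_const.div (hg.mul hE) fun t ht => mul_ne_zero (h0 t ht) (hE0 t))
  obtain ⟨H, hH, hHd⟩ := exists_primitive hs hc (hE.mul hK)
  refine ⟨H, fun t => E t * K t, hH, fun t ht => ⟨hHd t ht, _, (hEd t ht).mul (hKd t ht), ?_⟩⟩
  have := h0 t ht
  have := hE0 t
  field_simp
  ring

/-- The diagonal operator decouples the problem: `h` is a sum of functions of one variable, and the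
flux weights them by the constant speeds. -/
theorem exists_hamiltonian_density (hI : ∀ i, IsOpen (I i) ∧ (I i).OrdConnected)
    (h : Admissible I f F) : ∃ h k : State → ℝ, ContDiffOn ℝ ∞ h (Box I) ∧
      ContDiffOn ℝ ∞ k (Box I) ∧ IsLocalHamiltonianFlow (Box I) (linOp f) h linSpeed ∧
      ClosedByVirtue (Box I) ![linSpeed] ![h, k] := by
  have key := fun i => exists_density_one (hI i).1 (hI i).2 (h i).1
    (fun s hs => ((h i).2 s hs).1) (linSpeed 0 i / kap i)
  choose H H' hH hH' using key
  have hgrad : ∀ p ∈ Box I, HasGrad (fun q => ∑ i, H i (q i)) (fun k => H' k (p k)) p := by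
    intro p hp
    refine (HasGrad.sum Finset.univ fun i _ =>
      HasGrad.comp_coord ((hH' i _ (hp i)).1)).congr_grad fun k => ?_
    simp [kron]
  have hgrad' : ∀ p ∈ Box I, HasGrad (fun q => ∑ i, linSpeed 0 i * H i (q i))
      (fun k => linSpeed 0 k * H' k (p k)) p := by
    intro p hp
    refine (HasGrad.sum Finset.univ fun i _ =>
      (HasGrad.comp_coord ((hH' i _ (hp i)).1)).const_mul _).congr_grad fun k => ?_
    simp [kron]
  refine ⟨fun q => ∑ i, H i (q i), fun q => ∑ i, linSpeed 0 i * H i (q i),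
    ContDiffOn.sum fun i _ => contDiffOn_comp_coord (hH i),
    ContDiffOn.sum fun i _ => contDiffOn_const.mul (contDiffOn_comp_coord (hH i)), ?_, ?_⟩
  · intro u hu x i
    obtain ⟨-, d, hd, e⟩ := hH' i _ (hu.2 x i)
    have h1 : (fun y => grad (fun q => ∑ i, H i (q i)) (u y) i) = fun y => H' i (u y i) :=
      funext fun y => (hgrad _ (hu.2 y)).2 i
    have h2 : deriv (fun y => H' i (u y i)) x = d * dx u i x :=
      (hd.comp x (hasDerivAt_apply hu.1 i x)).deriv
    have h3 := congrFun h1 x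
    simp only [linOp, h1, h2]
    beta_reduce at h3
    rw [h3]
    have hk := kap_ne_zero i
    have e' : kap i * (f i (u x i) * d + 1 / 2 * deriv (f i) (u x i) * H' i (u x i))
        = linSpeed 0 i := by
      rw [e]
      field_simp
    change _ = linSpeed 0 i * _
    rw [← e']
    ring
  · refine closedByVirtue_of_pd (fun k p hp => ?_) fun k i p hp => ?_
    · fin_cases k
      exacts [(hgrad p hp).1, (hgrad' p hp).1]
    · fin_cases k
      change pd i (fun q => ∑ i, linSpeed 0 i * H i (q i)) p
        = linSpeed 0 i * pd i (fun q => ∑ i, H i (q i)) p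
      rw [(hgrad' p hp).2, (hgrad p hp).2]

/-! ### Equations for a density and its flux, obtained from test fields -/

/-- A field through a given point with a given direction of the derivative. -/
theorem exists_field {Ω : Set State} (hΩ : IsOpen Ω) {p : State} (hp : p ∈ Ω) (j : Fin 3) :
    ∃ u ∈ SmoothFields Ω, ∃ δ : ℝ, δ ≠ 0 ∧ u 0 = p ∧ ∀ i, dx u i 0 = δ * kron i j := by
  obtain ⟨r, hr, hrΩ⟩ := Metric.isOpen_iff.1 hΩ p hp
  -- The sine keeps the field in the ball for all `x`, with non-zero derivative at `0`.
  refine ⟨fun x => p + (r / 2 * Real.sin x) • Pi.single j (1 : ℝ), ⟨?_, fun x => hrΩ ?_⟩, r / 2,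
    by positivity, by simp, fun i => ?_⟩
  · exact contDiff_const.add ((contDiff_const.mul Real.contDiff_sin).smul contDiff_const)
  · rw [Metric.mem_ball, dist_eq_norm, add_sub_cancel_left, norm_smul, Pi.norm_single, norm_one,
      mul_one, norm_mul, Real.norm_eq_abs, Real.norm_eq_abs, abs_of_pos (half_pos hr)]
    have := Real.abs_sin_le_one x
    nlinarith
  · have : HasDerivAt (fun x => p i + r / 2 * Real.sin x * (Pi.single j (1 : ℝ) : State) i)
        (r / 2 * Real.cos 0 * (Pi.single j (1 : ℝ) : State) i) 0 :=
      (((Real.hasDerivAt_sin 0).const_mul (r / 2)).mul_const _).const_add _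
    unfold dx
    refine this.deriv.trans ?_
    simp [kron, Pi.single_apply]

/-- A field with `u_x` along one axis isolates one coefficient of the flow. The Hessian of `h` thus
comes out diagonal wherever `f ≠ 0`. -/
theorem hessian_of_isLocalHamiltonianFlow (hI : ∀ i, IsOpen (I i))
    {h : State → ℝ} (hh : ContDiffOn ℝ ∞ h (Box I))
    (hH : IsLocalHamiltonianFlow (Box I) (linOp f) h linSpeed) {p : State} (hp : p ∈ Box I)
    (i j : Fin 3) : kap i * f i (p i) * pd j (pd i h) p
      + kron i j * ((1 / 2) * kap i * deriv (f i) (p i) * pd i h p) = kron i j * linSpeed p i := by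
  obtain ⟨u, hu, δ, hδ, rfl, hd⟩ := exists_field (isOpen_box hI) hp j
  have e := hH u hu 0 i
  have hΩ := isOpen_box hI
  have h1 : deriv (fun y => grad h (u y) i) 0 = ∑ k, pd k (pd i h) (u 0) * dx u k 0 :=
    (hasDerivAt_comp_field (ContDiffOn.hasGrad hΩ (contDiffOn_pd hΩ hh i) hp).1 hu.1).deriv
  simp only [linOp, h1, hd] at e
  have h2 : ∑ k, pd k (pd i h) (u 0) * (δ * kron k j) = pd j (pd i h) (u 0) * δ := by
    rw [Finset.sum_eq_single j (fun k _ hk => by simp [kron, hk]) (by simp)]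
    simp [kron]
  rw [h2] at e
  refine mul_left_cancel₀ hδ ?_
  unfold grad at e
  linear_combination e

theorem pd_flux_of_closedByVirtue (hI : ∀ i, IsOpen (I i)) {h k : State → ℝ}
    (hh : ContDiffOn ℝ ∞ h (Box I)) (hk : ContDiffOn ℝ ∞ k (Box I))
    (hc : ClosedByVirtue (Box I) ![linSpeed] ![h, k]) {p : State} (hp : p ∈ Box I) (j : Fin 3) :
    pd j k p = linSpeed p j * pd j h p := by
  have hΩ := isOpen_box hI
  -- A linear travelling wave in the `j`-th component, an exact solution; it is restricted to where
  -- it stays in the box.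
  let u : (Fin 2 → ℝ) → State := fun y i => p i + kron i j * (y 0 + linSpeed p i * y 1)
  have hu : ContDiff ℝ ∞ u := contDiff_pi.2 fun i => contDiff_const.add (contDiff_const.mul
    ((contDiff_apply ℝ ℝ (0 : Fin 2)).add (contDiff_const.mul (contDiff_apply ℝ ℝ (1 : Fin 2)))))
  have hu0 : u 0 = p := by ext i; simp [u]
  have hud : ∀ y i, pd 0 (fun z => u z i) y = kron i j ∧
      pd 1 (fun z => u z i) y = kron i j * linSpeed p i := by
    intro y i
    have : HasFDerivAt (fun z => u z i) (kron i j • ((ContinuousLinearMap.proj 0 :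
        (Fin 2 → ℝ) →L[ℝ] ℝ) + linSpeed p i • ContinuousLinearMap.proj 1)) y :=
      (((hasFDerivAt_apply (0 : Fin 2) y).add ((hasFDerivAt_apply (1 : Fin 2) y).const_mul
        (linSpeed p i))).const_mul (kron i j)).const_add (p i)
    unfold pd
    rw [this.fderiv]
    simp
  have e := hc (u ⁻¹' Box I) u (hΩ.preimage hu.continuous) hu.contDiffOn (fun _ hy => hy)
    (fun y _ k i => by
      fin_cases k
      change pd 1 (fun z => u z i) y = linSpeed p i * pd 0 (fun z => u z i) y
      rw [(hud y i).1, (hud y i).2, mul_comm]) 0 (by simpa [hu0] using hp) 0 1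
  have hg : ∀ {g : State → ℝ}, ContDiffOn ℝ ∞ g (Box I) → DifferentiableAt ℝ g (u 0) := fun hg =>
    (ContDiffOn.hasGrad hΩ hg (hu0.symm ▸ hp)).1
  change pd 0 (fun z => k (u z)) 0 = pd 1 (fun z => h (u z)) 0 at e
  rw [pd_comp (hg hk) (hu.differentiable (by simp) 0), pd_comp (hg hh)
    (hu.differentiable (by simp) 0)] at e
  simp only [hud, hu0] at e
  rw [Finset.sum_eq_single j (fun i _ hi => by simp [kron, hi]) (by simp),
    Finset.sum_eq_single j (fun i _ hi => by simp [kron, hi]) (by simp)] at e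
  simp only [kron, if_true] at e
  linear_combination e

end

section

variable {I : Fin 3 → Set ℝ} {f F : Fin 3 → ℝ → ℝ} {h k : State → ℝ} {p : State}

/-! ### Transformed densities -/

/-- The transformed density. -/
def tDen (h k : State → ℝ) (p : State) : ℝ :=
  (h p * dM p - k p * dN p) / (dB p * dM p - dA p * dN p)

/-- The transformed flux. -/
def tFlux (h k : State → ℝ) (p : State) : ℝ :=
  (k p * dB p - h p * dA p) / (dB p * dM p - dA p * dN p)

/-- The factors `1, 1, -1/2`. -/
def rFac : State := ![1, 1, -(1 / 2)]

/-- The gradient of the transformed density. -/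
def tGrad (h k : State → ℝ) (i : Fin 3) (p : State) : ℝ :=
  -(rFac i * (pd i h p - tDen h k p * pd i dB p - tFlux h k p * pd i dN p) / prodDiff p i)

theorem contDiffOn_tDen (hh : ContDiffOn ℝ ∞ h (Dom I)) (hk : ContDiffOn ℝ ∞ k (Dom I)) :
    ContDiffOn ℝ ∞ (tDen h k) (Dom I) ∧ ContDiffOn ℝ ∞ (tFlux h k) (Dom I) := by
  obtain ⟨hB, hA, hN, hM⟩ := contDiff_densities
  have hΔ : ContDiffOn ℝ ∞ (fun p => dB p * dM p - dA p * dN p) (Dom I) :=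
    ((hB.mul hM).sub (hA.mul hN)).contDiffOn
  exact ⟨((hh.mul hM.contDiffOn).sub (hk.mul hN.contDiffOn)).div hΔ fun p hp =>
      dB_mul_dM_sub_ne_zero hp.2,
    ((hk.mul hB.contDiffOn).sub (hh.mul hA.contDiffOn)).div hΔ fun p hp =>
      dB_mul_dM_sub_ne_zero hp.2⟩

theorem dM_sub_div (hp : Function.Injective p) (i : Fin 3) :
    (dM p - linSpeed p i * dN p) / (dB p * dM p - dA p * dN p) = -(rFac i / prodDiff p i) := by
  have h01 : p 0 - p 1 ≠ 0 := sub_ne_zero_of_injective hp (by decide)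
  have h02 : p 0 - p 2 ≠ 0 := sub_ne_zero_of_injective hp (by decide)
  have h12 : p 1 - p 2 ≠ 0 := sub_ne_zero_of_injective hp (by decide)
  have h10 : p 1 - p 0 ≠ 0 := sub_ne_zero_of_injective hp (by decide)
  have h20 : p 2 - p 0 ≠ 0 := sub_ne_zero_of_injective hp (by decide)
  have h21 : p 2 - p 1 ≠ 0 := sub_ne_zero_of_injective hp (by decide)
  rw [dB_mul_dM_sub]
  fin_cases i <;> simp [linSpeed, rFac, dM, dN, prodDiff_zero, prodDiff_one, prodDiff_two] <;>
    field_simp <;> ring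

/-- By Cramer's rule `h = sB + tN` and `k = sA + tM`, with `s` and `t` the transformed density and
flux. The closedness relations turn the derivatives of this system into `∂_i t = η^i ∂_i s`. -/
theorem hasGrad_tDen (hp : Function.Injective p) (hh : HasGrad h (fun i => pd i h p) p)
    (hk : HasGrad k (fun i => linSpeed p i * pd i h p) p) :
    HasGrad (tDen h k) (fun i => tGrad h k i p) p ∧
      HasGrad (tFlux h k) (fun i => eta p i * tGrad h k i p) p := by
  obtain ⟨gB, -, gN, -⟩ := hasGrad_densities p
  have hB : HasGrad dB (fun i => pd i dB p) p := ⟨gB.1, fun _ => rfl⟩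
  have hN : HasGrad dN (fun i => pd i dN p) p := ⟨gN.1, fun _ => rfl⟩
  have hA : HasGrad dA (fun i => linSpeed p i * pd i dB p) p :=
    ⟨(hasGrad_densities p).2.1.1, pd_dA p⟩
  have hM : HasGrad dM (fun i => linSpeed p i * pd i dN p) p :=
    ⟨(hasGrad_densities p).2.2.2.1, pd_dM p⟩
  have hΔ := (hB.mul hM).sub (hA.mul hN)
  have h0 := dB_mul_dM_sub_ne_zero hp
  have hG : ∀ i, tGrad h k i p = (pd i h p - tDen h k p * pd i dB p - tFlux h k p * pd i dN p)
      * ((dM p - linSpeed p i * dN p) / (dB p * dM p - dA p * dN p)) := fun i => by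
    rw [dM_sub_div hp, tGrad]
    ring
  refine ⟨(((hh.mul hM).sub (hk.mul hN)).div hΔ h0).congr_grad fun i => ?_,
    (((hk.mul hB).sub (hh.mul hA)).div hΔ h0).congr_grad fun i => ?_⟩
  · rw [hG, tDen, tFlux]
    generalize hΔe : dB p * dM p - dA p * dN p = Δ at h0 ⊢
    field_simp
    rw [← hΔe]
    ring
  · have he := dA_add_dM_mul_eta p i
    have hη : eta p i * (dM p - linSpeed p i * dN p) = linSpeed p i * dB p - dA p := by
      linear_combination he
    have e2 : eta p i * tGrad h k i p
        = (pd i h p - tDen h k p * pd i dB p - tFlux h k p * pd i dN p)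
          * ((linSpeed p i * dB p - dA p) / (dB p * dM p - dA p * dN p)) := by
      rw [hG, ← hη]
      ring
    rw [e2, tDen, tFlux]
    generalize hΔe : dB p * dM p - dA p * dN p = Δ at h0 ⊢
    field_simp
    rw [← hΔe]
    ring

/-! ### Potentials for the nonlocal terms -/

/-- The gradient of `N`. -/
def nCoef : State := ![1, 1, -2]

/-- The coefficients of the gradient of `B`. -/
def bCoef : State := ![-2, -2, 4]

theorem pd_dN_eq (i : Fin 3) (p : State) : pd i dN p = nCoef i := by
  rw [(hasGrad_densities p).2.2.1.2]
  rfl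

theorem pd_dB_eq (i : Fin 3) (p : State) : pd i dB p = bCoef i * p i := by
  rw [(hasGrad_densities p).1.2]
  fin_cases i <;> rfl

theorem kron_comm (i j : Fin 3) : kron i j = kron j i := by simp [kron, eq_comm]

theorem sum_kron_mul (k : Fin 3) (a : Fin 3 → ℝ) : ∑ i, kron k i * a i = a k := by
  simp [kron]

/-- The flux, for the flow generated by `N`, of a Hamiltonian density of the linear system. -/
def nFlux (f : Fin 3 → ℝ → ℝ) (h : State → ℝ) (p : State) : ℝ :=
  (∑ i, kap i * f i (p i) * (nCoef i * pd i h p)) - dM p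

/-- The flux for the flow generated by `B`. -/
def bFlux (f : Fin 3 → ℝ → ℝ) (h : State → ℝ) (p : State) : ℝ :=
  (∑ i, kap i * f i (p i) * (bCoef i * p i * pd i h p)) - dA p

/-- These fluxes are `(∇h, ∇N) - M` and `(∇h, ∇B) - A`. The Hessian equation eliminates second
derivatives, and the subtracted functions remove the terms caused by the speeds of the linear
system. -/
theorem hasGrad_nFlux (hI : ∀ i, IsOpen (I i)) (hf : SmoothPrimitive I f F)
    (hh : ContDiffOn ℝ ∞ h (Box I)) (hp : p ∈ Box I)
    (hess : ∀ i j, kap i * f i (p i) * pd j (pd i h) p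
      + kron i j * ((1 / 2) * kap i * deriv (f i) (p i) * pd i h p) = kron i j * linSpeed p i) :
    HasGrad (nFlux f h) (fun k => nSpeed f p k * pd k h p) p ∧
      HasGrad (bFlux f h) (fun k => bSpeed f p k * pd k h p) p := by
  have hg : ∀ i, HasGrad (pd i h) (fun k => pd k (pd i h) p) p := fun i =>
    ContDiffOn.hasGrad (isOpen_box hI) (contDiffOn_pd (isOpen_box hI) hh i) hp
  have hk := hasGrad_kap_mul hI hf hp
  refine ⟨((HasGrad.sum Finset.univ fun i _ => (hk i).mul ((hg i).const_mul (nCoef i))).sub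
    ⟨(hasGrad_densities p).2.2.2.1, fun k => pd_dM p k⟩).congr_grad fun k => ?_,
    ((HasGrad.sum Finset.univ fun i _ => (hk i).mul (((HasGrad.coord i p).const_mul
      (bCoef i)).mul (hg i))).sub
    ⟨(hasGrad_densities p).2.1.1, fun k => pd_dA p k⟩).congr_grad fun k => ?_⟩
  · have e : ∀ i, kap i * (deriv (f i) (p i) * kron k i) * (nCoef i * pd i h p)
        + kap i * f i (p i) * (nCoef i * pd k (pd i h) p) = kron k i * (nCoef i * (linSpeed p i
          + (1 / 2) * kap i * deriv (f i) (p i) * pd i h p)) := fun i => by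
      have := hess i k
      rw [kron_comm i k] at this
      linear_combination nCoef i * this
    simp only [e, sum_kron_mul, pd_dN_eq]
    fin_cases k <;> simp [nSpeed, nCoef, kap, linSpeed]
    ring
  · have e : ∀ i, kap i * (deriv (f i) (p i) * kron k i) * (bCoef i * p i * pd i h p)
        + kap i * f i (p i) * (bCoef i * kron k i * pd i h p + bCoef i * p i * pd k (pd i h) p)
        = kron k i * (bCoef i * (p i * (linSpeed p i
          + (1 / 2) * kap i * deriv (f i) (p i) * pd i h p) + kap i * f i (p i) * pd i h p)) :=
      fun i => by
        have := hess i k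
        rw [kron_comm i k] at this
        linear_combination bCoef i * p i * this
    simp only [e, sum_kron_mul, pd_dB_eq]
    fin_cases k <;> simp [bSpeed, bCoef, kap, linSpeed] <;> ring

/-- The differential of `h = sB + tN`, with `dt` replaced by `η ds`. -/
theorem tGrad_mul (hp : Function.Injective p) (i : Fin 3) :
    tGrad h k i p * (dB p + dN p * eta p i)
      = pd i h p - tDen h k p * pd i dB p - tFlux h k p * pd i dN p := by
  have := prodDiff_ne_zero hp i
  have e : rFac i * (dB p + dN p * eta p i) = -prodDiff p i := by
    simp only [dB, dN]
    fin_cases i <;> simp [rFac, eta_zero, eta_one, eta_two, prodDiff_zero, prodDiff_one,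
      prodDiff_two] <;> ring
  rw [tGrad, neg_mul, div_mul_eq_mul_div, neg_eq_iff_eq_neg, div_eq_iff this]
  linear_combination (pd i h p - tDen h k p * pd i dB p - tFlux h k p * pd i dN p) * e

/-- The functions representing the nonlocal terms. -/
def tPotential (f F : Fin 3 → ℝ → ℝ) (h k : State → ℝ) : Fin 4 → State → ℝ :=
  ![tDen h k, tFlux h k,
    fun p => nFlux f h p - tDen h k p * fluxP f F p - tFlux h k p * fluxR f p + 1,
    fun p => bFlux f h p - tDen h k p * fluxQ f p - tFlux h k p * fluxS f F p]

/-- The potentials are fluxes of the transformed density: the flux for each flow, corrected by `s`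
and `t` times the coefficients of the reciprocal forms. `mu_eq` and `lam_eq` then match the
derivatives. -/
theorem pd_tPotential (hI : ∀ i, IsOpen (I i)) (hf : SmoothPrimitive I f F) (hp : p ∈ Dom I)
    (hh : ContDiffOn ℝ ∞ h (Box I)) (hk : HasGrad k (fun i => linSpeed p i * pd i h p) p)
    (hess : ∀ i j, kap i * f i (p i) * pd j (pd i h) p
      + kron i j * ((1 / 2) * kap i * deriv (f i) (p i) * pd i h p) = kron i j * linSpeed p i)
    (α : Fin 4) (j : Fin 3) :
    pd j (tPotential f F h k α) p = tailR f F α p j * tGrad h k j p := by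
  obtain ⟨g0, g1⟩ := hasGrad_tDen hp.2 (ContDiffOn.hasGrad (isOpen_box hI) hh hp.1) hk
  obtain ⟨gn, gb⟩ := hasGrad_nFlux hI hf hh hp.1 hess
  obtain ⟨hP, hQ, hR, hS⟩ := pd_fluxes hI hf hp.1 j
  obtain ⟨gQ, gR, gP, gS⟩ := hasGrad_fluxes hI hf hp.1
  have gQ' : HasGrad (fluxQ f) (fun i => pd i (fluxQ f) p) p := ⟨gQ.1, fun _ => rfl⟩
  have gR' : HasGrad (fluxR f) (fun i => pd i (fluxR f) p) p := ⟨gR.1, fun _ => rfl⟩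
  have gP' : HasGrad (fluxP f F) (fun i => pd i (fluxP f F) p) p := ⟨gP.1, fun _ => rfl⟩
  have gS' : HasGrad (fluxS f F) (fun i => pd i (fluxS f F) p) p := ⟨gS.1, fun _ => rfl⟩
  have ht := tGrad_mul (h := h) (k := k) hp.2 j
  fin_cases α
  · exact (g0.2 j).trans (one_mul _).symm
  · exact g1.2 j
  · refine ((((gn.sub (g0.mul gP')).sub (g1.mul gR')).add (HasGrad.const 1 p)).2 j).trans ?_
    change _ = mu f F p j * _
    beta_reduce
    rw [mu_eq, hP, hR]
    linear_combination -nSpeed f p j * ht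
  · refine (((gb.sub (g0.mul gQ')).sub (g1.mul gS')).2 j).trans ?_
    change _ = lam f F p j * _
    beta_reduce
    rw [lam_eq, hQ, hS]
    linear_combination -bSpeed f p j * ht

/-! ### The transformed flow, coefficient by coefficient -/

theorem hasGrad_tGrad (hI : ∀ i, IsOpen (I i)) (hp : p ∈ Dom I)
    (hh : ContDiffOn ℝ ∞ h (Box I)) (hk : HasGrad k (fun i => linSpeed p i * pd i h p) p)
    (i : Fin 3) :
    HasGrad (tGrad h k i) (fun l => -(rFac i * (pd l (pd i h) p - (tGrad h k l p * (bCoef i * p i)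
      + tDen h k p * (bCoef i * kron l i)) - eta p l * tGrad h k l p * nCoef i) / prodDiff p i
      - rFac i * (pd i h p - tDen h k p * (bCoef i * p i) - tFlux h k p * nCoef i)
        * ((kron l i - kron l (i + 1)) * (p i - p (i + 2))
          + (p i - p (i + 1)) * (kron l i - kron l (i + 2))) / prodDiff p i ^ 2)) p := by
  obtain ⟨g0, g1⟩ := hasGrad_tDen hp.2 (ContDiffOn.hasGrad (isOpen_box hI) hh hp.1) hk
  have hg : HasGrad (pd i h) (fun k => pd k (pd i h) p) p :=
    ContDiffOn.hasGrad (isOpen_box hI) (contDiffOn_pd (isOpen_box hI) hh i) hp.1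
  unfold tGrad at g0 g1 ⊢
  simp only [pd_dB_eq, pd_dN_eq] at g0 g1 ⊢
  refine (((((hg.sub (g0.mul ((HasGrad.coord i p).const_mul (bCoef i)))).sub
    (g1.mul (HasGrad.const (nCoef i) p))).const_mul (rFac i)).div (hasGrad_prodDiff i p)
    (prodDiff_ne_zero hp.2 i)).neg).congr_grad fun l => ?_
  ring

/-- The coefficient of `u^l_x` in the `i`-th component for `l ≠ i`; the initial `0` is the mixed
second derivative of `h`. Solving `hE` for the gradient component makes this a rational identity. -/
theorem flow_identity_offdiag (hp : Function.Injective p) (φ φ₁ E : State) {i l : Fin 3}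
    (hil : i ≠ l) (e : ℝ) (hE : E i = -(rFac i * e / prodDiff p i)) :
    prodDiff p i ^ 2 * φ i * -(rFac i * (0 - (E l * (bCoef i * p i)) - eta p l * E l * nCoef i)
        / prodDiff p i
      - rFac i * e * ((kron l i - kron l (i + 1)) * (p i - p (i + 2))
          + (p i - p (i + 1)) * (kron l i - kron l (i + 2))) / prodDiff p i ^ 2)
      + ∑ j, jetB p φ φ₁ i j l * E j = 0 := by
  have h01 : p 0 - p 1 ≠ 0 := sub_ne_zero_of_injective hp (by decide)
  have h02 : p 0 - p 2 ≠ 0 := sub_ne_zero_of_injective hp (by decide)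
  have h12 : p 1 - p 2 ≠ 0 := sub_ne_zero_of_injective hp (by decide)
  have h10 : p 1 - p 0 ≠ 0 := sub_ne_zero_of_injective hp (by decide)
  have h20 : p 2 - p 0 ≠ 0 := sub_ne_zero_of_injective hp (by decide)
  have h21 : p 2 - p 1 ≠ 0 := sub_ne_zero_of_injective hp (by decide)
  simp only [Fin.sum_univ_three]
  fin_cases i <;> fin_cases l <;> simp [kron, prodDiff_zero, prodDiff_one, prodDiff_two, rFac,
    eta_zero, eta_one, eta_two, nCoef, bCoef, jetB] at hil hE ⊢ <;> rw [hE] <;> field_simp <;> ring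

/-- The coefficient of `u^i_x`. The `+ 1` in the potential of `μ` is an integration constant, and it
alone produces the right side `η`: without it the sum would be zero. -/
theorem flow_identity_diag (hp : Function.Injective p) (f F : Fin 3 → ℝ → ℝ) (η : State) (H s t : ℝ)
    (i : Fin 3) (hH : kap i * f i (p i) * H + (1 / 2) * kap i * deriv (f i) (p i) * η i
      = linSpeed p i) :
    gUp f p i * -(rFac i * (H - (-(rFac i * (η i - s * (bCoef i * p i) - t * nCoef i) / prodDiff p i)
          * (bCoef i * p i) + s * bCoef i)
        - eta p i * -(rFac i * (η i - s * (bCoef i * p i) - t * nCoef i) / prodDiff p i) * nCoef i)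
        / prodDiff p i
      - rFac i * (η i - s * (bCoef i * p i) - t * nCoef i)
        * ((p i - p (i + 2)) + (p i - p (i + 1))) / prodDiff p i ^ 2)
      + ∑ j, jetB p (fun i => f i (p i)) (fun i => deriv (f i) (p i)) i j i
          * -(rFac j * (η j - s * (bCoef j * p j) - t * nCoef j) / prodDiff p j)
      + (lam f F p i * s + mu f F p i * t
        + eta p i * ((∑ j, kap j * f j (p j) * (nCoef j * η j)) - dM p
          - s * fluxP f F p - t * fluxR f p + 1)
        + ((∑ j, kap j * f j (p j) * (bCoef j * p j * η j)) - dA p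
          - s * fluxQ f p - t * fluxS f F p)) = eta p i := by
  have h01 : p 0 - p 1 ≠ 0 := sub_ne_zero_of_injective hp (by decide)
  have h02 : p 0 - p 2 ≠ 0 := sub_ne_zero_of_injective hp (by decide)
  have h12 : p 1 - p 2 ≠ 0 := sub_ne_zero_of_injective hp (by decide)
  have h10 : p 1 - p 0 ≠ 0 := sub_ne_zero_of_injective hp (by decide)
  have h20 : p 2 - p 0 ≠ 0 := sub_ne_zero_of_injective hp (by decide)
  have h21 : p 2 - p 1 ≠ 0 := sub_ne_zero_of_injective hp (by decide)
  have hH' : f i (p i) * H = linSpeed p i / kap i - (1 / 2) * deriv (f i) (p i) * η i := by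
    have := kap_ne_zero i
    field_simp
    linear_combination 2 * hH
  -- The second derivative `H` enters only multiplied by `f`, so `hH'` removes it without dividing
  -- by `f`.
  have e1 : ∀ a b : ℝ, gUp f p i * -(rFac i * (H - a) / prodDiff p i - b)
      = -(rFac i * prodDiff p i * (f i (p i) * H - f i (p i) * a)) + gUp f p i * b := by
    intro a b
    have := prodDiff_ne_zero hp i
    unfold gUp
    field_simp
    ring
  rw [sub_sub, e1, hH']
  simp only [Fin.sum_univ_three, lam, mu, fluxP, fluxQ, fluxR, fluxS, dM, dA, gUp]
  fin_cases i <;> simp [kron, prodDiff_zero, prodDiff_one, prodDiff_two, rFac, kap, linSpeed,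
    eta_zero, eta_one, eta_two, nCoef, bCoef, jetB] <;> field_simp <;> ring

end

section

variable {I : Fin 3 → Set ℝ} {f F : Fin 3 → ℝ → ℝ} {h k : State → ℝ} {p : State}

theorem flow_identity (hI : ∀ i, IsOpen (I i)) (hp : p ∈ Dom I)
    (hh : ContDiffOn ℝ ∞ h (Box I)) (hk : HasGrad k (fun i => linSpeed p i * pd i h p) p)
    (h0 : ∀ i, f i (p i) ≠ 0)
    (hess : ∀ i j, kap i * f i (p i) * pd j (pd i h) p
      + kron i j * ((1 / 2) * kap i * deriv (f i) (p i) * pd i h p) = kron i j * linSpeed p i)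
    (i l : Fin 3) : gUp f p i * pd l (tGrad h k i) p + (∑ j, funB f i j l p * tGrad h k j p)
      + kron i l * ∑ α, tailL f F α p i * tPotential f F h k α p = kron i l * eta p i := by
  rw [(hasGrad_tGrad hI hp hh hk i).2 l]
  have hG : ∀ j, tGrad h k j p = -(rFac j * (pd j h p - tDen h k p * (bCoef j * p j)
      - tFlux h k p * nCoef j) / prodDiff p j) := fun j => by rw [tGrad, pd_dB_eq, pd_dN_eq]
  rcases eq_or_ne i l with rfl | hil
  · have hd := flow_identity_diag hp.2 f F (fun j => pd j h p) (pd i (pd i h) p) (tDen h k p)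
      (tFlux h k p) i (by simpa [kron] using hess i i)
    have e1 : kron i i = 1 := if_pos rfl
    have e2 : kron i (i + 1) = 0 := by fin_cases i <;> rfl
    have e3 : kron i (i + 2) = 0 := by fin_cases i <;> rfl
    have hsum : ∑ α, tailL f F α p i * tPotential f F h k α p = lam f F p i * tDen h k p
        + mu f F p i * tFlux h k p
        + eta p i * (nFlux f h p - tDen h k p * fluxP f F p - tFlux h k p * fluxR f p + 1)
        + 1 * (bFlux f h p - tDen h k p * fluxQ f p - tFlux h k p * fluxS f F p) :=
      Fin.sum_univ_four _
    rw [hsum]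
    simp only [e1, e2, e3, hG, nFlux, bFlux, funB]
    linear_combination hd
  · have e1 : kron i l = 0 := if_neg hil
    have hH : pd l (pd i h) p = 0 := by
      have := hess i l
      rw [e1, zero_mul, zero_mul, add_zero] at this
      exact (mul_eq_zero.1 this).resolve_left (mul_ne_zero (kap_ne_zero i) (h0 i))
    have hd := flow_identity_offdiag hp.2 (fun i => f i (p i)) (fun i => deriv (f i) (p i))
      (fun j => tGrad h k j p) hil _ (hG i)
    have e2 : kron l i = 0 := if_neg (Ne.symm hil)
    rw [e2] at hd
    simp only [e1, hH, e2, mul_zero, add_zero, zero_mul]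
    exact hd

theorem isNonlocalHamiltonianFlow_tDen (hI : ∀ i, IsOpen (I i)) (hf : Admissible I f F)
    (hh : ContDiffOn ℝ ∞ h (Box I)) (hk : ContDiffOn ℝ ∞ k (Box I))
    (hH : IsLocalHamiltonianFlow (Box I) (linOp f) h linSpeed)
    (hc : ClosedByVirtue (Box I) ![linSpeed] ![h, k]) :
    IsNonlocalHamiltonianFlow (Dom I) (tLocal f) (tailL f F) (tailR f F) (tDen h k) eta := by
  have hs := hf.smoothPrimitive
  have hsub := dom_subset_box (I := I)
  have hΩ := isOpen_dom hI
  have hgk : ∀ p ∈ Dom I, HasGrad k (fun i => linSpeed p i * pd i h p) p := fun p hp =>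
    ⟨(ContDiffOn.hasGrad (isOpen_box hI) hk hp.1).1,
      pd_flux_of_closedByVirtue hI hh hk hc hp.1⟩
  have hess := fun p (hp : p ∈ Dom I) => hessian_of_isLocalHamiltonianFlow hI hh hH hp.1
  have hgt : ∀ p ∈ Dom I, HasGrad (tDen h k) (fun i => tGrad h k i p) p := fun p hp =>
    (hasGrad_tDen hp.2 (ContDiffOn.hasGrad (isOpen_box hI) hh hp.1) (hgk p hp)).1
  obtain ⟨ct, cf⟩ := contDiffOn_tDen (hh.mono hsub) (hk.mono hsub)
  obtain ⟨hQ, hR, hP, hS⟩ := contDiffOn_fluxes hI hs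
  obtain ⟨cB, cA, cN, cM⟩ := contDiff_densities
  have cg : ∀ i, ContDiffOn ℝ ∞ (fun p => kap i * f i (p i)) (Box I) := fun i =>
    contDiffOn_const.mul (contDiffOn_comp_coord (hs i).1)
  have ch := fun i => contDiffOn_pd (isOpen_box hI) hh i
  have cc : ∀ i : Fin 3, ContDiffOn ℝ ∞ (fun p : State => p i) (Box I) := fun i =>
    (contDiff_apply ℝ ℝ i).contDiffOn
  have cn : ContDiffOn ℝ ∞ (nFlux f h) (Box I) :=
    (ContDiffOn.sum fun i _ => (cg i).mul (contDiffOn_const.mul (ch i))).sub cM.contDiffOn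
  have cb : ContDiffOn ℝ ∞ (bFlux f h) (Box I) :=
    (ContDiffOn.sum fun i _ => (cg i).mul ((contDiffOn_const.mul (cc i)).mul (ch i))).sub
      cA.contDiffOn
  refine ⟨tPotential f F h k, fun α => ?_, fun α p hp j => ?_, fun u hu x i => ?_⟩
  · fin_cases α
    · exact ct
    · exact cf
    · exact (((cn.mono hsub).sub (ct.mul (hP.mono hsub))).sub (cf.mul (hR.mono hsub))).add
        contDiffOn_const
    · exact ((cb.mono hsub).sub (ct.mul (hQ.mono hsub))).sub (cf.mul (hS.mono hsub))
  · rw [pd_tPotential hI hs hp hh (hgk p hp) (hess p hp), (hgt p hp).2]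
  · have hp := hu.2 x
    have h0 : ∀ i, f i (u x i) ≠ 0 := fun i => ((hf i).2 _ (hp.1 i)).1
    have e : ∀ y j, grad (tDen h k) (u y) j = tGrad h k j (u y) := fun y j =>
      (hgt _ (hu.2 y)).2 j
    have hd : deriv (fun y => grad (tDen h k) (u y) i) x
        = ∑ l, pd l (tGrad h k i) (u x) * dx u l x := by
      simp only [e]
      exact (hasDerivAt_comp_field (hasGrad_tGrad hI hp hh (hgk _ hp) i).1 hu.1).deriv
    rw [tLocal_eq hp.2 h0, hd]
    simp only [e]
    have hid := fun l => flow_identity (F := F) hI hp hh (hgk _ hp) h0 (hess _ hp) i l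
    have e1 : ∑ α, tailL f F α (u x) i * dx u i x * tPotential f F h k α (u x)
        = ∑ l, kron i l * ((∑ α, tailL f F α (u x) i * tPotential f F h k α (u x)) * dx u l x) := by
      rw [sum_kron_mul, Finset.sum_mul]
      exact Finset.sum_congr rfl fun α _ => by ring
    have e2 : eta (u x) i * dx u i x = ∑ l, kron i l * (eta (u x) i * dx u l x) :=
      (sum_kron_mul i fun l => eta (u x) i * dx u l x).symm
    rw [e1, e2, Finset.sum_comm, Finset.mul_sum, ← Finset.sum_add_distrib,
      ← Finset.sum_add_distrib]
    -- Both sides are now linear forms in `u_x`, compared term by term.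
    refine Finset.sum_congr rfl fun l _ => ?_
    have e3 : ∑ j, funB f i j l (u x) * dx u l x * tGrad h k j (u x)
        = (∑ j, funB f i j l (u x) * tGrad h k j (u x)) * dx u l x := by
      rw [Finset.sum_mul]
      exact Finset.sum_congr rfl fun j _ => by ring
    rw [e3]
    linear_combination dx u l x * hid l

end

end

end HydroType

/-! ### Assembly of the statements -/

theorem mainTheorem7 (I : Fin 3 → Set ℝ)
    (hI : ∀ i, IsOpen (I i) ∧ (I i).OrdConnected ∧ (I i).Nonempty) :
    -- the reciprocal transformation maps the linear system to the 3-component system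
    (ClosedByVirtue (Box I) ![linSpeed] ![dB, dA] ∧
      ClosedByVirtue (Box I) ![linSpeed] ![dN, dM] ∧
      MapsSystem (Dom I) ![dB, dA] ![dN, dM] ![linSpeed] ![eta]) ∧
    -- the statements for arbitrary functions `f, φ, ψ`
    (∀ f F : Fin 3 → ℝ → ℝ, Admissible I f F →
      -- local Hamiltonian structures of the linear system
      (FlatOn (Box I) (linMetric f) ∧
        (∀ u ∈ SmoothFields (Box I), ∀ c x, linOp f u c x = dnOp (linMetric f) u c x) ∧
        IsHamiltonian (Box I) (linOp f)) ∧
      -- the flows generated by `N` and `B`, their fluxes, the extended transformation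
      (IsLocalHamiltonianFlow (Box I) (linOp f) dN (nSpeed f) ∧
        IsLocalHamiltonianFlow (Box I) (linOp f) dB (bSpeed f) ∧
        FlowsCommute (Box I) linSpeed (nSpeed f) ∧
        FlowsCommute (Box I) linSpeed (bSpeed f) ∧
        (∀ p ∈ Box I,
          fluxQ f p = (1 / 2) * ∑ i, kap i * f i (p i) * pd i dB p ^ 2 ∧
          fluxR f p = (1 / 2) * ∑ i, kap i * f i (p i) * pd i dN p ^ 2 ∧
          fluxP f F p + fluxS f F p = ∑ i, kap i * f i (p i) * pd i dB p * pd i dN p) ∧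
        ClosedByVirtue (Box I) ![linSpeed, nSpeed f, bSpeed f] ![dB, dA, fluxP f F, fluxQ f] ∧
        ClosedByVirtue (Box I) ![linSpeed, nSpeed f, bSpeed f] ![dN, dM, fluxR f, fluxS f F] ∧
        MapsSystem (Dom I) ![dB, dA, fluxP f F, fluxQ f] ![dN, dM, fluxR f, fluxS f F]
          ![linSpeed, nSpeed f, bSpeed f] ![eta, mu f F, lam f F] ∧
        FlowsCommute (Dom I) eta (mu f F) ∧ FlowsCommute (Dom I) eta (lam f F)) ∧
      -- the transformed metric and its curvature
      ((∀ p ∈ Dom I, dB p * dM p - dA p * dN p ≠ 0 ∧ ∀ i j, tMetric f p i j =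
          (dM p - dN p * linSpeed p i) * (dM p - dN p * linSpeed p j)
            / (dB p * dM p - dA p * dN p) ^ 2 * linMetric f p i j) ∧
        (∀ p ∈ Dom I, ∀ i j k l, curvature (tMetric f) i j k l p =
          (lam f F p i + lam f F p j + mu f F p i * eta p j + mu f F p j * eta p i)
            * ((if i = k ∧ j = l then 1 else 0) - (if i = l ∧ j = k then 1 else 0)))) ∧
      -- the nonlocal operator: its local part belongs to the metric, it is Hamiltonian
      ((∀ u ∈ SmoothFields (Dom I), ∀ c x, tLocal f u c x = dnOp (tMetric f) u c x) ∧
        IsHamiltonian (Dom I) (tOp f F)) ∧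
      -- Hamiltonian densities of the linear system and of the transformed system
      ((∃ h k : State → ℝ, ContDiffOn ℝ ∞ h (Box I) ∧ ContDiffOn ℝ ∞ k (Box I) ∧
          IsLocalHamiltonianFlow (Box I) (linOp f) h linSpeed ∧
          ClosedByVirtue (Box I) ![linSpeed] ![h, k]) ∧
        (∀ h k : State → ℝ, ContDiffOn ℝ ∞ h (Box I) → ContDiffOn ℝ ∞ k (Box I) →
          IsLocalHamiltonianFlow (Box I) (linOp f) h linSpeed →
          ClosedByVirtue (Box I) ![linSpeed] ![h, k] →
          IsNonlocalHamiltonianFlow (Dom I) (tLocal f) (tailL f F) (tailR f F)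
            (fun p => (h p * dM p - k p * dN p) / (dB p * dM p - dA p * dN p)) eta))) ∧
    -- compatibility, linear dependence on `f, φ, ψ`; different functions give different operators,
    -- and the choice of the antiderivatives does not matter
    (∀ f₁ F₁ f₂ F₂ : Fin 3 → ℝ → ℝ, Admissible I f₁ F₁ → Admissible I f₂ F₂ →
      Compatible (Dom I) (tOp f₁ F₁) (tOp f₂ F₂) ∧
      (∀ c₁ c₂ : ℝ, (∀ i, ∀ s ∈ I i, c₁ * f₁ i s + c₂ * f₂ i s ≠ 0) →
        ∀ u ∈ Fields (Dom I), ∀ c ∈ Test, ∀ x,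
          tOp (fun i s => c₁ * f₁ i s + c₂ * f₂ i s) (fun i s => c₁ * F₁ i s + c₂ * F₂ i s) u c x
            = c₁ • tOp f₁ F₁ u c x + c₂ • tOp f₂ F₂ u c x) ∧
      ((∀ u ∈ Fields (Dom I), ∀ c ∈ Test, ∀ x, tOp f₁ F₁ u c x = tOp f₂ F₂ u c x) ↔
        ∀ i, Set.EqOn (f₁ i) (f₂ i) (I i))) ∧
    -- constant `f, φ, ψ`
    (∀ a : Fin 3 → ℝ, (∀ i, a i ≠ 0) →
      (a 0 + a 1 + a 2 = 0 →
        (∀ p, lam (fun i _ => a i) (fun i s => a i * s) p = 0 ∧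
          mu (fun i _ => a i) (fun i s => a i * s) p = 0) ∧
        FlatOn (Dom I) (tMetric fun i _ => a i) ∧
        ∀ F, Admissible I (fun i _ => a i) F → ∀ u ∈ Fields (Dom I), ∀ c ∈ Test, ∀ x,
          tOp (fun i _ => a i) F u c x = dnOp (tMetric fun i _ => a i) u c x) ∧
      (FlatOn (Dom I) (tMetric fun i _ => a i) → a 0 + a 1 + a 2 = 0)) := by
  have hIo := fun i => (hI i).1
  have hIc := fun i => (⟨(hI i).1, (hI i).2.1⟩ : IsOpen (I i) ∧ (I i).OrdConnected)
  refine ⟨⟨closedByVirtue_dB, closedByVirtue_dN, mapsSystem_linear⟩, fun f F h => ?_,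
    fun f₁ F₁ f₂ F₂ h₁ h₂ => ⟨tOp_compatible hIo h₁ h₂, fun c₁ c₂ h0 u hu c hc x =>
      tOp_linComb hIo h₁ h₂ h0 hu hc x, tOp_eq_iff hI h₁.smoothPrimitive h₂.smoothPrimitive⟩,
    fun a ha => ⟨fun h0 => ⟨fun p => ⟨?_, ?_⟩, tMetric_const_flat hIo ha h0,
      fun F hF u hu c hc x => tOp_const_eq_dnOp hIc ha h0 hF hu hc x⟩,
      sum_eq_zero_of_flat hI ha⟩⟩
  · have hs := h.smoothPrimitive
    have hf : ∀ p ∈ Dom I, ∀ i, f i (p i) ≠ 0 := fun p hp i => ((h i).2 _ (hp.1 i)).1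
    exact ⟨⟨linMetric_flat hIo h, fun u hu c x => linOp_eq_dnOp hIo h (hu.2 x) c,
        linOp_isHamiltonian hIo h⟩,
      ⟨isLocalHamiltonianFlow_dN _ f, isLocalHamiltonianFlow_dB _ f,
        flowsCommute_linSpeed (isOpen_box hIo) (contDiffOn_nSpeed hIo hs)
          fun p hp k i hki => pd_nSpeed hIo hs hp hki,
        flowsCommute_linSpeed (isOpen_box hIo) (contDiffOn_bSpeed hIo hs)
          fun p hp k i hki => pd_bSpeed hIo hs hp hki,
        fun p _ => flux_identities f F p, closedByVirtue_extended_dB hIo hs,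
        closedByVirtue_extended_dN hIo hs, mapsSystem_extended hIo hs,
        flowsCommute_eta hIo hs 2, flowsCommute_eta hIo hs 3⟩,
      ⟨fun p hp => ⟨dB_mul_dM_sub_ne_zero hp.2, tMetric_eq hp.2 (hf p hp)⟩,
        fun p hp => curvature_tMetric hIo h hp⟩,
      ⟨fun u hu c x => tLocal_eq_dnOp hIo h (hu.2 x) c, tOp_isHamiltonian hIo h⟩,
      exists_hamiltonian_density hIc h, fun h' k hh hk hH hc =>
        isNonlocalHamiltonianFlow_tDen hIo h hh hk hH hc⟩
  · ext i
    rw [lam_const, h0, mul_zero, Pi.zero_apply]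
  · ext i
    rw [mu_const, h0, mul_zero, Pi.zero_apply]
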